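/- Let $n\ge 2$ be an integer and $R>0$. Write points of $\mathbb R^n$ as $y=(y',t)$ with $y'\in\mathbb R^{n-1}$, $t\in\mathbb R$, and put $B_r'=\{y'\in\mathbb R^{n-1}:|y'|<r\}$ and $G_r=\{(y',t):|y'|<r,\ 0<t<r\}$. Consider $$Q(u)=\Delta u-\frac{u_iu_j}{1+|Du|^2}u_{ij}-\frac{n u_t}{t}.$$ For a function $\varphi$ on $B_R'$ define the local terms as follows. Put $c_0=\varphi$ and, successively for even $i$ with $2\le i\le n$, $$c_i=\frac{F_i}{i(n+1-i)},$$ where $F_i(y')$ is the coefficient of $t^{i-2}$ in the expansion in powers of $t$ of $Q(\varphi+c_2t^2+\cdots+c_{i-2}t^{i-2})(y',t)$; thus, for example, $c_2=\frac1{2(n-1)}\Big(\Delta_{y'}\varphi-\frac{\varphi_\alpha\varphi_\beta}{1+|D_{y'}\varphi|^2}\varphi_{\alpha\beta}\Big)$. For $n$ odd put in addition $$c_{n+1,1}=-\frac{F_{n+1,1}}{n+1},$$ where $F_{n+1,1}(y')$ is the coefficient of $t^{n-1}$ in the expansion of $Q(\varphi+c_2t^2+\cdots+c_{n-1}t^{n-1})(y',t)$.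 Let $$u_*=\varphi+c_2t^2+c_4t^4+\cdots+c_nt^n\quad(n\text{ even}),\qquad u_*=\varphi+c_2t^2+\cdots+c_{n-1}t^{n-1}+c_{n+1,1}t^{n+1}\log t\quad(n\text{ odd}).$$ Theorem. Let $\ell=n+2$ if $n$ is even and $\ell=n+3$ if $n$ is odd. Let $\varphi\in C^\ell(B_R')$ and let $u\in C(\overline{G_R})\cap C^\infty(G_R)$ satisfy $Q(u)=0$ in $G_R$ and $u(y',0)=\varphi(y')$ for $y'\in B_R'$. Then there exist $r\in(0,R)$ and $C>0$ such that $$|u-u_*|\le C\,t^{n+1}\qquad\text{for all }(y',t)\in G_r.$$ Moreover, if the $C^\ell$-norm of $\varphi$ in $B_R'$ is finite, then $r$ and $C$ can be chosen depending only on $n$, $R$, (an upper bound of) the $L^\infty$-norm of $u$ in $G_R$ and (an upper bound of) the $C^\ell$-norm of $\varphi$ in $B_R'$. -/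

import Mathlib

open Set Metric
open scoped ContDiff

/-- The tangential space `ℝ^{n-1}`, with points `y'` and the Euclidean norm. -/
abbrev TangentialSpace (n : ℕ) : Type := EuclideanSpace ℝ (Fin (n - 1))

/-- Indices of the coordinates of `y = (y', t) ∈ ℝⁿ`: `some α` is the tangential coordinate `y_α`,
`none` is the last coordinate `y_n = t`. -/
abbrev CoordIndex (n : ℕ) : Type := Option (Fin (n - 1))

/-- The coordinate vectors of `ℝⁿ = ℝ^{n-1} × ℝ`. -/
noncomputable def coordVec (n : ℕ) : CoordIndex n → TangentialSpace n × ℝ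
  | some α => (EuclideanSpace.single α 1, 0)
  | none => (0, 1)

/-- The partial derivative `u_i`. -/
noncomputable def partialD (n : ℕ) (i : CoordIndex n) (u : TangentialSpace n × ℝ → ℝ) :
    TangentialSpace n × ℝ → ℝ :=
  fun p => fderiv ℝ u p (coordVec n i)

/-- The cylinder `G_r = {(y', t) : |y'| < r, 0 < t < r}`. -/
def cylinderG (n : ℕ) (r : ℝ) : Set (TangentialSpace n × ℝ) :=
  {p | ‖p.1‖ < r ∧ 0 < p.2 ∧ p.2 < r}

/-- The operator `Q(u) = Δu - u_i u_j u_{ij} / (1 + |Du|²) - n u_t / t`. -/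
noncomputable def minimalGraphOp (n : ℕ) (u : TangentialSpace n × ℝ → ℝ)
    (p : TangentialSpace n × ℝ) : ℝ :=
  (∑ i : CoordIndex n, partialD n i (partialD n i u) p)
    - (∑ i : CoordIndex n, ∑ j : CoordIndex n,
        partialD n i u p * partialD n j u p / (1 + ∑ k : CoordIndex n, partialD n k u p ^ 2)
          * partialD n j (partialD n i u) p)
    - n * partialD n none u p / p.2

/-- `u ∈ C(closure G_R) ∩ C^∞(G_R)` solves `Q(u) = 0` in `G_R` with `u = φ` on
`B'_R = {(y', 0) : |y'| < R}`. -/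
structure IsMinimalGraphSolution (n : ℕ) (R : ℝ) (φ : TangentialSpace n → ℝ)
    (u : TangentialSpace n × ℝ → ℝ) : Prop where
  continuousOn : ContinuousOn u (closure (cylinderG n R))
  smoothOn : ContDiffOn ℝ ∞ u (cylinderG n R)
  equation : ∀ p ∈ cylinderG n R, minimalGraphOp n u p = 0
  boundary : ∀ y ∈ ball (0 : TangentialSpace n) R, u (y, 0) = φ y

/-- The order of differentiability of `φ`: `n + 2` for `n` even, `n + 3` for `n` odd. -/
def dataOrder (n : ℕ) : ℕ := if Even n then n + 2 else n + 3

/-! ### The local terms of the formal expansion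

A polynomial `∑ a_k(y') t^k` in `t` is given by the sequence `a` of its coefficients. -/

/-- Coefficients of the partial derivatives of `∑ a_k(y') t^k`. -/
noncomputable def formalD (n : ℕ) :
    CoordIndex n → (ℕ → TangentialSpace n → ℝ) → (ℕ → TangentialSpace n → ℝ)
  | some α, a => fun k y => fderiv ℝ (a k) y (EuclideanSpace.single α 1)
  | none, a => fun k y => (k + 1) * a (k + 1) y

/-- The expression `∑ a_k(y') t^k` at a fixed `y'`, as a power series in `t`. -/
def seriesAt (n : ℕ) (a : ℕ → TangentialSpace n → ℝ) (y : TangentialSpace n) : PowerSeries ℝ :=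
  PowerSeries.mk fun k => a k y

/-- The expansion in powers of `t`, at a fixed `y'`, of `Q(∑ a_k(y') t^k)`, for coefficients with
`a_1 = 0`. The last series is that of `u_t / t`; the inverse is that of power series (the constant
term of `1 + |Du|²` is positive). -/
noncomputable def formalOp (n : ℕ) (a : ℕ → TangentialSpace n → ℝ) (y : TangentialSpace n) :
    PowerSeries ℝ :=
  (∑ i : CoordIndex n, seriesAt n (formalD n i (formalD n i a)) y)
    - (∑ i : CoordIndex n, ∑ j : CoordIndex n,
        seriesAt n (formalD n i a) y * seriesAt n (formalD n j a) y
          * (1 + ∑ k : CoordIndex n, seriesAt n (formalD n k a) y ^ 2)⁻¹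
          * seriesAt n (formalD n j (formalD n i a)) y)
    - PowerSeries.C (n : ℝ) * seriesAt n (fun k => formalD n none a (k + 1)) y

/-- The coefficients of `φ + c_2 t² + ⋯ + c_{2j} t^{2j}`. With `i = 2(j+1)`, the next coefficient is
`c_i = F_i / (i (n + 1 - i))`, where `F_i = F_i(φ, c_2, …, c_{i-2})` is the coefficient of `t^{i-2}`
in `Q(φ + c_2 t² + ⋯ + c_{i-2} t^{i-2})`. -/
noncomputable def localExpansion (n : ℕ) (φ : TangentialSpace n → ℝ) :
    ℕ → ℕ → TangentialSpace n → ℝ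
  | 0 => fun k => if k = 0 then φ else 0
  | j + 1 => Function.update (localExpansion n φ j) (2 * (j + 1)) fun y =>
      (formalOp n (localExpansion n φ j) y).coeff (2 * j)
        / ((2 * (j + 1) : ℝ) * ((n : ℝ) + 1 - 2 * (j + 1)))

/-- The coefficient `c_{2j}`, with `c_0 = φ` (used for `2j ≤ n`). -/
noncomputable def localCoeff (n : ℕ) (φ : TangentialSpace n → ℝ) (j : ℕ) (y : TangentialSpace n) :
    ℝ :=
  localExpansion n φ j (2 * j) y

/-- For `n` odd, `c_{n+1,1} = -F_{n+1,1} / (n + 1)`, where `F_{n+1,1}` is the coefficient of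
`t^{n-1}` in `Q(φ + c_2 t² + ⋯ + c_{n-1} t^{n-1})`. -/
noncomputable def logCoeff (n : ℕ) (φ : TangentialSpace n → ℝ) (y : TangentialSpace n) : ℝ :=
  -(1 / ((n : ℝ) + 1)) * (formalOp n (localExpansion n φ (n / 2)) y).coeff (n - 1)

/-- `u_* = φ + c_2 t² + ⋯ + c_n t^n` for `n` even, and
`u_* = φ + c_2 t² + ⋯ + c_{n-1} t^{n-1} + c_{n+1,1} t^{n+1} log t` for `n` odd. -/
noncomputable def uStar (n : ℕ) (φ : TangentialSpace n → ℝ) (p : TangentialSpace n × ℝ) : ℝ :=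
  (∑ j ∈ Finset.range (n / 2 + 1), localCoeff n φ j p.1 * p.2 ^ (2 * j))
    + if Even n then 0 else logCoeff n φ p.1 * p.2 ^ (n + 1) * Real.log p.2

/-!
The proof uses the maximum principle only. Put `P(u) = (1 + |Du|²) Q(u)`, which is a polynomial in
the derivatives of `u` and `u_t / t` (`clearedOp`, `clearedGraphOp`). At an interior maximum of the
difference of two functions the gradients agree and the coefficient matrix is nonnegative, so that a
strict supersolution lying above a solution on the boundary of a cylinder lies above it inside
(`comparison_principle`). No gradient estimate for the solution is needed.

For a first bound, the barrier `φ + A |y' - y₀|² + B t²` with `B` much larger than `A` is a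
supersolution irrespective of its gradient, because the coefficients of `Q` are bounded and
`t² ↦ 2 - 2n < 0`. Moving the centre `y₀` one gets `|u - φ| ≤ C t²`, and hence `|u - u_*| ≤ C t²`
(`exists_initial_bound`).

Next, a bound `|u - u_*| ≤ C t^k` with `2 ≤ k ≤ n` is improved to order `t^{k+1}` on a smaller
cylinder (`exists_step_bound`). The barrier is
`u_* + A t^k |y' - y₀|² + B (t^{k+1} - t^{k+2})`. The indicial polynomial of the equation is
`k (k - 1 - n)`, so that `t^k` contributes with a favourable sign, and so does `t^{k+1}` if `k < n`;
for `k = n` it contributes zero and the sign comes from `-t^{n+2}`. All other terms are `O(t^k)`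
(`exists_clearedOp_perturbation_bound`), and `B = b / τ` dominates them when the height `τ` of the
cylinder is small. After `n - 1` such steps the order is `t^{n+1}`.

It remains to see that `u_*` solves the equation up to `O(t^n)`
(`exists_isApproxSolution_uStar`). The coefficients are defined such that those of `t^k` in the
expansion of the operator vanish for `k < n - 1` (`coeff_formalCleared_localExpansion`): adding
`c t^i` changes the coefficient of `t^{i-2}` by a nonzero multiple of `c`, and the odd coefficients
vanish by symmetry. The coefficient of `t^{n-1}` is zero for `n` even, and is cancelled by
`t^{n+1} log t` for `n` odd. Formal expansions are compared with functions through polynomials in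
`t`. Uniformity of the constants is obtained by carrying out all constructions for families of
boundary values that are bounded in `C^ℓ` (`UnifC`); the local terms are then bounded families, too,
since they are polynomials in the derivatives of `φ` and in `1 / (1 + |Dφ|²)`. The local statement
follows from the uniform one on a cylinder of half the size.
-/

/-! ### The operator with cleared denominator -/

/-- The polynomial expression `(1 + |q|²)(tr h - ν v) - ∑ q_i q_j h_{ij}`. For `q = Du`, `h = D²u`,
`v = u_t / t` and `ν = n` it is `(1 + |Du|²) Q(u)`. It is defined over any commutative ring since it
is evaluated on real numbers, on polynomials in `t` and on power series in `t`. -/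
def clearedOp {A I : Type*} [CommRing A] [Fintype I] (ν : A) (q : I → A) (h : I → I → A) (v : A) :
    A :=
  (1 + ∑ k, q k ^ 2) * (∑ i, h i i - ν * v) - ∑ i, ∑ j, q i * q j * h i j

lemma map_clearedOp {A A' I : Type*} [CommRing A] [CommRing A'] [Fintype I] (f : A →+* A') (ν : A)
    (q : I → A) (h : I → I → A) (v : A) :
    f (clearedOp ν q h v) = clearedOp (f ν) (fun i => f (q i)) (fun i j => f (h i j)) (f v) := by
  simp [clearedOp, map_sum]

lemma clearedOp_neg {A I : Type*} [CommRing A] [Fintype I] (ν : A) (q : I → A) (h : I → I → A)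
    (v : A) :
    clearedOp ν (fun i => -q i) (fun i j => -h i j) (-v) = -clearedOp ν q h v := by
  simp only [clearedOp, neg_sq, neg_mul, neg_neg, mul_neg, Finset.sum_neg_distrib]
  ring

/-- The value at `p` of `(1 + |Du|²) Q(u)`. -/
noncomputable def clearedGraphOp (n : ℕ) (u : TangentialSpace n × ℝ → ℝ)
    (p : TangentialSpace n × ℝ) : ℝ :=
  clearedOp (n : ℝ) (fun i => partialD n i u p) (fun i j => partialD n j (partialD n i u) p)
    (partialD n none u p / p.2)

lemma clearedGraphOp_eq (n : ℕ) (u : TangentialSpace n × ℝ → ℝ) (p : TangentialSpace n × ℝ) :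
    clearedGraphOp n u p = (1 + ∑ k, partialD n k u p ^ 2) * minimalGraphOp n u p := by
  have hpos : (1 + ∑ k, partialD n k u p ^ 2) ≠ 0 := by positivity
  simp only [clearedGraphOp, clearedOp, minimalGraphOp]
  have h2 : ∑ i, ∑ j, partialD n i u p * partialD n j u p / (1 + ∑ k, partialD n k u p ^ 2)
          * partialD n j (partialD n i u) p =
      (∑ i, ∑ j, partialD n i u p * partialD n j u p * partialD n j (partialD n i u) p)
        / (1 + ∑ k, partialD n k u p ^ 2) := by
    simp only [Finset.sum_div]
    refine Finset.sum_congr rfl fun i _ => Finset.sum_congr rfl fun j _ => ?_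
    ring
  rw [h2]
  field_simp
  ring

/-! ### The second derivative test and the comparison principle -/

lemma partialD_partialD {n : ℕ} {v : TangentialSpace n × ℝ → ℝ} {p : TangentialSpace n × ℝ}
    (hv : ContDiffAt ℝ 2 v p) (i j : CoordIndex n) :
    partialD n j (partialD n i v) p = fderiv ℝ (fderiv ℝ v) p (coordVec n j) (coordVec n i) := by
  have h1 : DifferentiableAt ℝ (fderiv ℝ v) p :=
    (hv.fderiv_right (m := 1) (by norm_num)).differentiableAt (by norm_num)
  unfold partialD
  rw [fderiv_clm_apply h1 (differentiableAt_const _)]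
  simp

lemma ContDiffAt.eventually_differentiableAt {n : ℕ} {v : TangentialSpace n × ℝ → ℝ}
    {p : TangentialSpace n × ℝ} (hv : ContDiffAt ℝ 2 v p) :
    ∀ᶠ z in nhds p, DifferentiableAt ℝ v z := by
  filter_upwards [hv.eventually (by simp)] with z hz
  exact hz.differentiableAt (by norm_num)

lemma partialD_add {n : ℕ} {u v : TangentialSpace n × ℝ → ℝ} {p : TangentialSpace n × ℝ}
    (hu : DifferentiableAt ℝ u p) (hv : DifferentiableAt ℝ v p) (i : CoordIndex n) :
    partialD n i (fun z => u z + v z) p = partialD n i u p + partialD n i v p := by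
  simp [partialD, fderiv_fun_add hu hv]

lemma ContDiffAt.differentiableAt_partialD {n : ℕ} {v : TangentialSpace n × ℝ → ℝ}
    {p : TangentialSpace n × ℝ} (hv : ContDiffAt ℝ 2 v p) (i : CoordIndex n) :
    DifferentiableAt ℝ (partialD n i v) p := by
  have h1 : DifferentiableAt ℝ (fderiv ℝ v) p :=
    (hv.fderiv_right (m := 1) (by norm_num)).differentiableAt (by norm_num)
  exact h1.clm_apply (differentiableAt_const _)

lemma partialD_congr {n : ℕ} {u v : TangentialSpace n × ℝ → ℝ} {p : TangentialSpace n × ℝ}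
    (h : u =ᶠ[nhds p] v) (i : CoordIndex n) : partialD n i u p = partialD n i v p := by
  simp [partialD, h.fderiv_eq]

lemma partialD_partialD_add {n : ℕ} {u v : TangentialSpace n × ℝ → ℝ}
    {p : TangentialSpace n × ℝ} (hu : ContDiffAt ℝ 2 u p) (hv : ContDiffAt ℝ 2 v p)
    (i j : CoordIndex n) :
    partialD n j (partialD n i fun z => u z + v z) p
      = partialD n j (partialD n i u) p + partialD n j (partialD n i v) p := by
  rw [← partialD_add (hu.differentiableAt_partialD i) (hv.differentiableAt_partialD i)]
  refine partialD_congr ?_ j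
  filter_upwards [hu.eventually_differentiableAt, hv.eventually_differentiableAt] with z h1 h2
  exact partialD_add h1 h2 i

lemma partialD_neg (n : ℕ) (u : TangentialSpace n × ℝ → ℝ) (i : CoordIndex n) :
    partialD n i (fun z => -u z) = fun z => -partialD n i u z := by
  ext z
  simp [partialD, fderiv_fun_neg]

lemma clearedGraphOp_neg (n : ℕ) (u : TangentialSpace n × ℝ → ℝ) (p : TangentialSpace n × ℝ) :
    clearedGraphOp n (fun z => -u z) p = -clearedGraphOp n u p := by
  simp only [clearedGraphOp, partialD_neg, neg_div, clearedOp_neg]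

/-- At a local maximum the second derivative in any direction is nonpositive. -/
lemma IsLocalMax.hessian_nonpos {n : ℕ} {v : TangentialSpace n × ℝ → ℝ}
    {p : TangentialSpace n × ℝ} (hv : ContDiffAt ℝ 2 v p) (hmax : IsLocalMax v p)
    (x : TangentialSpace n × ℝ) : fderiv ℝ (fderiv ℝ v) p x x ≤ 0 := by
  by_contra! hpos
  set f : ℝ → ℝ := fun s => v (p + s • x) with hf
  have hline : ∀ s : ℝ, HasDerivAt (fun s : ℝ => p + s • x) x s := fun s => by
    simpa using ((hasDerivAt_id s).smul_const x).const_add p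
  have hcont : Filter.Tendsto (fun s : ℝ => p + s • x) (nhds 0) (nhds p) := by
    simpa using (hline 0).continuousAt.tendsto
  have hf' : deriv f =ᶠ[nhds 0] fun s => fderiv ℝ v (p + s • x) x := by
    filter_upwards [hcont.eventually hv.eventually_differentiableAt] with s hs
    have h2 : HasDerivAt f (fderiv ℝ v (p + s • x) x) s :=
      HasFDerivAt.comp_hasDerivAt (f := fun s : ℝ => p + s • x) s hs.hasFDerivAt (hline s)
    exact h2.deriv
  have h1 : DifferentiableAt ℝ (fderiv ℝ v) p :=
    (hv.fderiv_right (m := 1) (by norm_num)).differentiableAt (by norm_num)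
  have hf'' : deriv (deriv f) 0 = fderiv ℝ (fderiv ℝ v) p x x := by
    rw [hf'.deriv_eq]
    have h2 : HasFDerivAt (fderiv ℝ v) (fderiv ℝ (fderiv ℝ v) p) (p + (0 : ℝ) • x) := by
      simpa using h1.hasFDerivAt
    have h3 : HasDerivAt (fun s : ℝ => fderiv ℝ v (p + s • x)) (fderiv ℝ (fderiv ℝ v) p x) 0 :=
      HasFDerivAt.comp_hasDerivAt (f := fun s : ℝ => p + s • x) 0 h2 (hline 0)
    simpa using (h3.clm_apply (hasDerivAt_const (0 : ℝ) x)).deriv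
  have hfmax : IsLocalMax f 0 := by
    have := hcont.eventually hmax
    simpa [IsLocalMax, IsMaxFilter, hf] using this
  have hfc : ContinuousAt f 0 := by
    have h2 : ContinuousAt v (p + (0 : ℝ) • x) := by simpa using hv.continuousAt
    exact ContinuousAt.comp (f := fun s : ℝ => p + s • x) h2 (hline 0).continuousAt
  have hfmin : IsLocalMin f 0 :=
    isLocalMin_of_deriv_deriv_pos (by rw [hf'']; exact hpos) hfmax.deriv_eq_zero hfc
  have hconst : f =ᶠ[nhds 0] fun _ => f 0 := by
    filter_upwards [hfmin, hfmax] with s h3 h4 using le_antisymm h4 h3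
  have h0 : deriv (deriv f) 0 = 0 := by
    rw [hconst.deriv.deriv_eq]
    simp
  linarith [hf'']

/-- The coefficient matrix `(1 + |q|²) I - q ⊗ q` is nonnegative, because
`|q|² tr h - ∑ q_i q_j h_{ij}` is half the sum over `i, j` of the values of the quadratic form `h`
at `q_i e_j - q_j e_i`. -/
lemma clearedOp_principal_nonpos {I : Type*} [Fintype I] [DecidableEq I] (q : I → ℝ)
    (h : I → I → ℝ) (hneg : ∀ ξ : I → ℝ, ∑ i, ∑ j, ξ i * ξ j * h i j ≤ 0) :
    (1 + ∑ k, q k ^ 2) * (∑ i, h i i) - ∑ i, ∑ j, q i * q j * h i j ≤ 0 := by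
  have htr : ∑ i, h i i ≤ 0 := by
    refine Finset.sum_nonpos fun i _ => ?_
    have := hneg (Pi.single i 1)
    simpa [Pi.single_apply] using this
  have hpair : ∀ k l : I,
      q k ^ 2 * h l l + q l ^ 2 * h k k - q k * q l * (h k l + h l k) ≤ 0 := by
    intro k l
    have := hneg (q k • Pi.single l 1 - q l • Pi.single k 1)
    have e : ∑ i, ∑ j, (q k • Pi.single l (1 : ℝ) - q l • Pi.single k 1 : I → ℝ) i *
        (q k • Pi.single l (1 : ℝ) - q l • Pi.single k 1 : I → ℝ) j * h i j
        = q k ^ 2 * h l l + q l ^ 2 * h k k - q k * q l * (h k l + h l k) := by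
      simp [Pi.single_apply, sub_mul, mul_sub, Finset.sum_sub_distrib]
      ring
    linarith
  have hsum : ∑ k, ∑ l, (q k ^ 2 * h l l + q l ^ 2 * h k k - q k * q l * (h k l + h l k)) ≤ 0 :=
    Finset.sum_nonpos fun k _ => Finset.sum_nonpos fun l _ => hpair k l
  have e1 : ∑ k, ∑ l, q k ^ 2 * h l l = (∑ k, q k ^ 2) * ∑ i, h i i := by
    rw [Finset.sum_mul_sum]
  have e2 : ∑ k, ∑ l, q l ^ 2 * h k k = (∑ k, q k ^ 2) * ∑ i, h i i := by
    rw [Finset.sum_comm, e1]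
  have e3 : ∑ k, ∑ l, q k * q l * h l k = ∑ k, ∑ l, q k * q l * h k l := by
    rw [Finset.sum_comm]
    exact Finset.sum_congr rfl fun i _ => Finset.sum_congr rfl fun j _ => by ring
  simp only [mul_add, Finset.sum_sub_distrib, Finset.sum_add_distrib, e1, e2, e3] at hsum
  nlinarith

/-- The comparison principle on the cylinder `{|y - y₀| < ρ, 0 < t < τ}`. No regularity is needed
on its boundary, and the singular term `u_t / t` does no harm, since the gradients agree at an
interior maximum of the difference. -/
theorem comparison_principle {n : ℕ} {U w : TangentialSpace n × ℝ → ℝ} {y₀ : TangentialSpace n}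
    {ρ τ : ℝ} (hU : ContinuousOn U (closedBall y₀ ρ ×ˢ Icc 0 τ))
    (hw : ContinuousOn w (closedBall y₀ ρ ×ˢ Icc 0 τ))
    (hU2 : ∀ p ∈ ball y₀ ρ ×ˢ Ioo 0 τ, ContDiffAt ℝ 2 U p)
    (hw2 : ∀ p ∈ ball y₀ ρ ×ˢ Ioo 0 τ, ContDiffAt ℝ 2 w p)
    (hlt : ∀ p ∈ ball y₀ ρ ×ˢ Ioo 0 τ, clearedGraphOp n w p < clearedGraphOp n U p)
    (hbd : ∀ p ∈ closedBall y₀ ρ ×ˢ Icc 0 τ, (p.2 = 0 ∨ p.2 = τ ∨ dist p.1 y₀ = ρ) → U p ≤ w p) :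
    ∀ p ∈ closedBall y₀ ρ ×ˢ Icc 0 τ, U p ≤ w p := by
  intro p hp
  by_contra! hcon
  have hK : IsCompact (closedBall y₀ ρ ×ˢ Icc 0 τ) := (isCompact_closedBall y₀ ρ).prod isCompact_Icc
  obtain ⟨m, hm, hmax⟩ := hK.exists_isMaxOn ⟨p, hp⟩ (hU.sub hw)
  have hmp := hmax hp
  simp only [Pi.sub_apply, mem_ofPred_eq] at hmp
  have hmpos : w m < U m := by linarith
  have hmint : m ∈ ball y₀ ρ ×ˢ Ioo 0 τ := by
    have h1 : m.2 ≠ 0 := fun h => absurd (hbd m hm (Or.inl h)) (by linarith)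
    have h2 : m.2 ≠ τ := fun h => absurd (hbd m hm (Or.inr (Or.inl h))) (by linarith)
    have h3 : dist m.1 y₀ ≠ ρ := fun h => absurd (hbd m hm (Or.inr (Or.inr h))) (by linarith)
    obtain ⟨ha, hb⟩ := hm
    exact ⟨lt_of_le_of_ne ha h3, lt_of_le_of_ne hb.1 (Ne.symm h1), lt_of_le_of_ne hb.2 h2⟩
  have hopen : IsOpen (ball y₀ ρ ×ˢ Ioo 0 τ) := isOpen_ball.prod isOpen_Ioo
  set v : TangentialSpace n × ℝ → ℝ := fun z => U z + -w z with hv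
  have hvmax : IsLocalMax v m := by
    filter_upwards [hopen.mem_nhds hmint] with z hz
    have := hmax ⟨ball_subset_closedBall hz.1, Ioo_subset_Icc_self hz.2⟩
    simp only [Pi.sub_apply, mem_ofPred_eq] at this
    simp only [hv]
    linarith
  have hU2m := hU2 m hmint
  have hw2m := hw2 m hmint
  have hvm : ContDiffAt ℝ 2 v m := hU2m.add hw2m.neg
  have hgrad : ∀ i, partialD n i U m = partialD n i w m := by
    intro i
    have h1 : partialD n i v m = 0 := by simp [partialD, hvmax.fderiv_eq_zero]
    rw [partialD_add (hU2m.differentiableAt (by norm_num))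
      (hw2m.neg.differentiableAt (by norm_num)), partialD_neg] at h1
    linarith
  have hhess : ∀ i j, partialD n j (partialD n i v) m
      = partialD n j (partialD n i U) m - partialD n j (partialD n i w) m := by
    intro i j
    rw [hv, partialD_partialD_add hU2m hw2m.neg, partialD_neg, partialD_neg]
    ring
  have hneg : ∀ ξ : CoordIndex n → ℝ,
      ∑ i, ∑ j, ξ i * ξ j * partialD n j (partialD n i v) m ≤ 0 := by
    intro ξ
    have := hvmax.hessian_nonpos hvm (∑ i, ξ i • coordVec n i)
    have e : fderiv ℝ (fderiv ℝ v) m (∑ i, ξ i • coordVec n i) (∑ i, ξ i • coordVec n i)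
        = ∑ i, ∑ j, ξ i * ξ j * partialD n j (partialD n i v) m := by
      simp only [partialD_partialD hvm, map_sum, map_smul, _root_.sum_apply,
        _root_.smul_apply, smul_eq_mul, Finset.mul_sum]
      exact Finset.sum_congr rfl fun i _ => Finset.sum_congr rfl fun j _ => by ring
    linarith
  have hfin := clearedOp_principal_nonpos (fun i => partialD n i w m) _ hneg
  have hcmp := hlt m hmint
  simp only [clearedGraphOp, clearedOp, hgrad] at hcmp
  simp only [hhess, mul_sub, Finset.sum_sub_distrib] at hfin
  linarith

/-! ### Derivatives of sums of products `f(y') g(t)` -/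

/-- The function `(y', t) ↦ f(y') g(t)`. -/
def sepFun {n : ℕ} (f : TangentialSpace n → ℝ) (g : ℝ → ℝ) (p : TangentialSpace n × ℝ) : ℝ :=
  f p.1 * g p.2

/-- The tangential partial derivative `∂_α f`. -/
noncomputable def tanD {n : ℕ} (α : Fin (n - 1)) (f : TangentialSpace n → ℝ) :
    TangentialSpace n → ℝ :=
  fun y => fderiv ℝ f y (EuclideanSpace.single α 1)

/-- The factor in `y'` of `∂_i (f(y') g(t))`. -/
noncomputable def sepLeft {n : ℕ} (i : CoordIndex n) (f : TangentialSpace n → ℝ) :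
    TangentialSpace n → ℝ :=
  match i with
  | some α => tanD α f
  | none => f

/-- The factor in `t` of `∂_i (f(y') g(t))`. -/
noncomputable def sepRight {n : ℕ} (i : CoordIndex n) (g : ℝ → ℝ) : ℝ → ℝ :=
  match i with
  | some _ => g
  | none => deriv g

lemma partialD_sepFun {n : ℕ} {f : TangentialSpace n → ℝ} {g : ℝ → ℝ}
    {p : TangentialSpace n × ℝ} (hf : DifferentiableAt ℝ f p.1) (hg : DifferentiableAt ℝ g p.2)
    (i : CoordIndex n) :
    partialD n i (sepFun f g) p = sepFun (sepLeft i f) (sepRight i g) p := by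
  have h1 : HasFDerivAt (fun z : TangentialSpace n × ℝ => f z.1) _ p :=
    HasFDerivAt.comp p hf.hasFDerivAt hasFDerivAt_fst
  have h2 : HasFDerivAt (fun z : TangentialSpace n × ℝ => g z.2) _ p :=
    HasFDerivAt.comp p hg.hasFDerivAt hasFDerivAt_snd
  have h3 : HasFDerivAt (sepFun f g) _ p := h1.mul h2
  unfold partialD
  rw [h3.fderiv]
  cases i with
  | none => simp [coordVec, sepFun, sepLeft, sepRight]
  | some α => simp [coordVec, sepFun, sepLeft, sepRight, tanD, mul_comm]

lemma ContDiffAt.sepFun {n : ℕ} {f : TangentialSpace n → ℝ} {g : ℝ → ℝ} {m : WithTop ℕ∞}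
    {p : TangentialSpace n × ℝ} (hf : ContDiffAt ℝ m f p.1) (hg : ContDiffAt ℝ m g p.2) :
    ContDiffAt ℝ m (sepFun f g) p :=
  (hf.comp p contDiffAt_fst).mul (hg.comp p contDiffAt_snd)

lemma ContDiffAt.differentiableAt_tanD {n : ℕ} {f : TangentialSpace n → ℝ}
    {y : TangentialSpace n} (hf : ContDiffAt ℝ 2 f y) (α : Fin (n - 1)) :
    DifferentiableAt ℝ (tanD α f) y :=
  ((hf.fderiv_right (m := 1) (by norm_num)).differentiableAt (by norm_num)).clm_apply
    (differentiableAt_const _)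

lemma ContDiffAt.differentiableAt_sepLeft {n : ℕ} {f : TangentialSpace n → ℝ}
    {y : TangentialSpace n} (hf : ContDiffAt ℝ 2 f y) (i : CoordIndex n) :
    DifferentiableAt ℝ (sepLeft i f) y := by
  cases i with
  | none => exact hf.differentiableAt (by norm_num)
  | some α => exact hf.differentiableAt_tanD α

lemma ContDiffAt.differentiableAt_sepRight {n : ℕ} {g : ℝ → ℝ} {t : ℝ}
    (hg : ContDiffAt ℝ 2 g t) (i : CoordIndex n) :
    DifferentiableAt ℝ (sepRight i g) t := by
  cases i with
  | some α => exact hg.differentiableAt (by norm_num)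
  | none =>
    exact ((hg.fderiv_right (m := 1) (by norm_num)).differentiableAt (by norm_num)).clm_apply
      (differentiableAt_const 1)

lemma partialD_partialD_sepFun {n : ℕ} {f : TangentialSpace n → ℝ} {g : ℝ → ℝ}
    {p : TangentialSpace n × ℝ} (hf : ContDiffAt ℝ 2 f p.1) (hg : ContDiffAt ℝ 2 g p.2)
    (i j : CoordIndex n) :
    partialD n j (partialD n i (sepFun f g)) p
      = sepFun (sepLeft j (sepLeft i f)) (sepRight j (sepRight i g)) p := by
  rw [← partialD_sepFun (hf.differentiableAt_sepLeft i) (hg.differentiableAt_sepRight i)]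
  refine partialD_congr ?_ j
  have h1 := continuousAt_fst.eventually (hf.eventually (by simp))
  have h2 := continuousAt_snd.eventually (hg.eventually (by simp))
  filter_upwards [h1, h2] with z hz1 hz2
  exact partialD_sepFun (hz1.differentiableAt (by norm_num)) (hz2.differentiableAt (by norm_num)) i

/-- The function `∑_{k < N} a_k(y') t^k`. -/
def evalSeries {n : ℕ} (N : ℕ) (a : ℕ → TangentialSpace n → ℝ) (p : TangentialSpace n × ℝ) : ℝ :=
  ∑ k ∈ Finset.range N, a k p.1 * p.2 ^ k

lemma partialD_evalSeries {n N : ℕ} {a : ℕ → TangentialSpace n → ℝ} {p : TangentialSpace n × ℝ}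
    (ha : ∀ k, DifferentiableAt ℝ (a k) p.1) (hN : a N = 0) (i : CoordIndex n) :
    partialD n i (evalSeries N a) p = evalSeries N (formalD n i a) p := by
  have hd : ∀ k, DifferentiableAt ℝ (sepFun (a k) fun t => t ^ k) p := fun k =>
    ((ha k).comp p differentiableAt_fst).mul
      ((differentiableAt_pow k).comp p differentiableAt_snd)
  have e : partialD n i (evalSeries N a) p
      = ∑ k ∈ Finset.range N, partialD n i (sepFun (a k) fun t => t ^ k) p := by
    have : evalSeries N a = fun z => ∑ k ∈ Finset.range N, sepFun (a k) (fun t => t ^ k) z := rfl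
    simp only [partialD, this, fderiv_fun_sum fun k _ => hd k, _root_.sum_apply]
  rw [e]
  simp only [partialD_sepFun (ha _) (differentiableAt_pow _)]
  cases i with
  | some α => rfl
  | none =>
    have e1 : ∀ k, sepFun (sepLeft none (a k)) (sepRight (n := n) none fun t : ℝ => t ^ k) p
        = a k p.1 * (k * p.2 ^ (k - 1)) := fun k => by simp [sepFun, sepLeft, sepRight]
    simp only [e1, evalSeries, formalD]
    have h1 := Finset.sum_range_succ (fun k => a k p.1 * (k * p.2 ^ (k - 1))) N
    rw [Finset.sum_range_succ'] at h1
    simp only [hN, Pi.zero_apply, zero_mul, add_zero, CharP.cast_eq_zero, mul_zero] at h1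
    rw [← h1]
    refine Finset.sum_congr rfl fun k _ => ?_
    push_cast
    ring

lemma formalD_eq_zero {n N : ℕ} {a : ℕ → TangentialSpace n → ℝ} (hN : ∀ k ≥ N, a k = 0)
    (i : CoordIndex n) : ∀ k ≥ N, formalD n i a k = 0 := by
  intro k hk
  cases i with
  | some α => ext y; simp [formalD, hN k hk]
  | none => ext y; simp [formalD, hN (k + 1) (by omega)]

lemma ContDiffAt.differentiableAt_formalD {n : ℕ} {a : ℕ → TangentialSpace n → ℝ}
    {y : TangentialSpace n} (ha : ∀ k, ContDiffAt ℝ 2 (a k) y) (i : CoordIndex n) (k : ℕ) :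
    DifferentiableAt ℝ (formalD n i a k) y := by
  cases i with
  | some α => exact (ha k).differentiableAt_tanD α
  | none => exact ((ha (k + 1)).differentiableAt (by norm_num)).const_mul _

lemma partialD_partialD_evalSeries {n N : ℕ} {a : ℕ → TangentialSpace n → ℝ}
    {p : TangentialSpace n × ℝ} (ha : ∀ᶠ y in nhds p.1, ∀ k, ContDiffAt ℝ 2 (a k) y)
    (hN : ∀ k ≥ N, a k = 0) (i j : CoordIndex n) :
    partialD n j (partialD n i (evalSeries N a)) p
      = evalSeries N (formalD n j (formalD n i a)) p := by
  rw [← partialD_evalSeries (ContDiffAt.differentiableAt_formalD ha.self_of_nhds i)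
    (formalD_eq_zero hN i N le_rfl)]
  refine partialD_congr ?_ j
  filter_upwards [continuousAt_fst.eventually ha] with z hz
  exact partialD_evalSeries (fun k => (hz k).differentiableAt (by norm_num)) (hN N le_rfl) i

lemma ContDiffAt.evalSeries {n N : ℕ} {a : ℕ → TangentialSpace n → ℝ} {m : WithTop ℕ∞}
    {p : TangentialSpace n × ℝ} (ha : ∀ k, ContDiffAt ℝ m (a k) p.1) :
    ContDiffAt ℝ m (evalSeries N a) p := by
  have : _root_.evalSeries N a
      = fun z => ∑ k ∈ Finset.range N, _root_.sepFun (a k) (fun t => t ^ k) z := rfl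
  rw [this]
  exact ContDiffAt.sum fun k _ => (ha k).sepFun (contDiffAt_id.pow k)

/-! ### Perturbation of the operator near the boundary -/

/-- The anisotropic weights measuring the size of derivatives near `t = 0`: weight `1` for the
tangential directions and `t` for the normal one. For an even expansion in `t` the gradient is
bounded by the weights. -/
def weight {n : ℕ} (t : ℝ) : CoordIndex n → ℝ
  | some _ => 1
  | none => t

lemma weight_pos {n : ℕ} {t : ℝ} (ht : 0 < t) (i : CoordIndex n) : 0 < weight t i := by
  cases i <;> simp [weight, ht]

lemma weight_le_one {n : ℕ} {t : ℝ} (ht : t ≤ 1) (i : CoordIndex n) : weight t i ≤ 1 := by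
  cases i <;> simp [weight, ht]

lemma abs_sum_le_card_mul {I : Type*} [Fintype I] {f : I → ℝ} {b : ℝ} (h : ∀ i, |f i| ≤ b) :
    |∑ i, f i| ≤ Fintype.card I * b := by
  refine (Finset.abs_sum_le_sum_abs _ _).trans ?_
  refine (Finset.sum_le_card_nsmul _ _ b fun i _ => h i).trans ?_
  simp

lemma abs_sum_sum_le_card_mul {I : Type*} [Fintype I] {f : I → I → ℝ} {b : ℝ}
    (h : ∀ i j, |f i j| ≤ b) : |∑ i, ∑ j, f i j| ≤ Fintype.card I * (Fintype.card I * b) :=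
  abs_sum_le_card_mul fun i => abs_sum_le_card_mul (h i)

lemma clearedOp_add_sub {n : ℕ} (ν t : ℝ) (q d : CoordIndex n → ℝ)
    (h e : CoordIndex n → CoordIndex n → ℝ) :
    clearedOp ν (fun i => q i + d i) (fun i j => h i j + e i j) ((q none + d none) / t)
        - clearedOp ν q h (q none / t)
        - (1 + ∑ i, (q i + d i) ^ 2) * (e none none - ν * (d none / t))
      = (1 + ∑ i, (q i + d i) ^ 2) * (∑ α, e (some α) (some α))
        - ∑ i, ∑ j, (q i + d i) * (q j + d j) * e i j
        + (∑ i, d i * ((q i + d i) + q i)) * (∑ i, h i i - ν * (q none / t))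
        - ∑ i, ∑ j, (d i * (q j + d j) + q i * d j) * h i j := by
  have e1 : ∑ i, (q i + d i) ^ 2 = ∑ i, q i ^ 2 + ∑ i, d i * ((q i + d i) + q i) := by
    rw [← Finset.sum_add_distrib]
    exact Finset.sum_congr rfl fun i _ => by ring
  have e2 : ∑ i, (h i i + e i i) = ∑ i, h i i + (e none none + ∑ α, e (some α) (some α)) := by
    rw [Finset.sum_add_distrib, Fintype.sum_option (f := fun i => e i i)]
  have e3 : ∑ i, ∑ j, (q i + d i) * (q j + d j) * (h i j + e i j)
      = ∑ i, ∑ j, q i * q j * h i j + ∑ i, ∑ j, (d i * (q j + d j) + q i * d j) * h i j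
        + ∑ i, ∑ j, (q i + d i) * (q j + d j) * e i j := by
    simp only [← Finset.sum_add_distrib]
    exact Finset.sum_congr rfl fun i _ => Finset.sum_congr rfl fun j _ => by ring
  simp only [clearedOp, e2, e3]
  rw [e1]
  ring

/-- Up to an error controlled by the weighted size `ε` of the perturbation, the operator changes by
its leading part `(1 + |Dw|²)(ψ_tt - ν ψ_t / t)`. -/
lemma exists_clearedOp_perturbation_bound (n : ℕ) (ν C : ℝ) :
    ∃ K : ℝ, 0 ≤ K ∧ ∀ (t ε : ℝ) (q d : CoordIndex n → ℝ) (h e : CoordIndex n → CoordIndex n → ℝ),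
      0 < t → t ≤ 1 →
      (∀ i, |q i| ≤ C * weight t i) → (∀ i, |d i| ≤ C * weight t i) →
      (∀ i j, |h i j| * weight t j ≤ C * weight t i) →
      (∀ i j, |h i j| * weight t i ≤ C * weight t j) →
      (∀ i, |d i| * weight t i ≤ ε) → (∀ i j, |e i j| * (weight t i * weight t j) ≤ ε) →
      |clearedOp ν (fun i => q i + d i) (fun i j => h i j + e i j) ((q none + d none) / t)
        - clearedOp ν q h (q none / t)
        - (1 + ∑ i, (q i + d i) ^ 2) * (e none none - ν * (d none / t))| ≤ K * ε := by
  set N : ℝ := (Fintype.card (CoordIndex n) : ℝ) with hN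
  set m : ℝ := (Fintype.card (Fin (n - 1)) : ℝ) with hm
  have hN0 : 0 ≤ N := by positivity
  have hm0 : 0 ≤ m := by positivity
  refine ⟨(1 + N * (4 * C ^ 2)) * m + N * (N * (4 * C ^ 2)) + N * (3 * |C|) * (N * |C| + |ν| * |C|)
    + N * (N * (3 * C ^ 2)), by positivity, ?_⟩
  intro t ε q d h e ht ht1 hq hd hh hh' hdε heε
  have hC : 0 ≤ C := by
    have := (abs_nonneg _).trans (hq none)
    exact nonneg_of_mul_nonneg_left this (weight_pos ht none)
  have hε : 0 ≤ ε := (mul_nonneg (abs_nonneg _) (weight_pos ht none).le).trans (hdε none)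
  rw [abs_of_nonneg hC, clearedOp_add_sub]
  have hw0 : ∀ i, 0 < weight (n := n) t i := weight_pos ht
  have hw1 : ∀ i, weight (n := n) t i ≤ 1 := weight_le_one ht1
  have hwq : ∀ i, |q i + d i| ≤ 2 * C * weight t i := fun i =>
    (abs_add_le _ _).trans (by linarith [hq i, hd i])
  have hwq1 : ∀ i, (q i + d i) ^ 2 ≤ 4 * C ^ 2 := by
    intro i
    have h1 : |q i + d i| ≤ 2 * C := (hwq i).trans (by nlinarith [hw1 i])
    nlinarith [sq_abs (q i + d i), abs_nonneg (q i + d i)]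
  have hW : |1 + ∑ i, (q i + d i) ^ 2| ≤ 1 + N * (4 * C ^ 2) := by
    have := abs_sum_le_card_mul (f := fun i => (q i + d i) ^ 2) (b := 4 * C ^ 2)
      (fun i => by rw [abs_of_nonneg (sq_nonneg _)]; exact hwq1 i)
    exact (abs_add_le _ _).trans (by rw [abs_one]; linarith)
  have b1 : |(1 + ∑ i, (q i + d i) ^ 2) * (∑ α, e (some α) (some α))|
      ≤ (1 + N * (4 * C ^ 2)) * (m * ε) := by
    rw [abs_mul]
    refine mul_le_mul hW (abs_sum_le_card_mul fun α => ?_) (abs_nonneg _) (by positivity)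
    simpa [weight] using heε (some α) (some α)
  have b2 : |∑ i, ∑ j, (q i + d i) * (q j + d j) * e i j| ≤ N * (N * (4 * C ^ 2 * ε)) := by
    refine abs_sum_sum_le_card_mul fun i j => ?_
    rw [abs_mul, abs_mul]
    calc |q i + d i| * |q j + d j| * |e i j|
        ≤ (2 * C * weight t i) * (2 * C * weight t j) * |e i j| := by
          gcongr
          · exact mul_nonneg (by positivity) (hw0 i).le
          · exact hwq i
          · exact hwq j
      _ = 4 * C ^ 2 * (|e i j| * (weight t i * weight t j)) := by ring
      _ ≤ 4 * C ^ 2 * ε := by gcongr; exact heε i j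
  have b3 : |∑ i, d i * ((q i + d i) + q i)| ≤ N * (3 * C * ε) := by
    refine abs_sum_le_card_mul fun i => ?_
    rw [abs_mul]
    calc |d i| * |q i + d i + q i| ≤ |d i| * (3 * C * weight t i) := by
          gcongr
          exact (abs_add_le _ _).trans (by linarith [hwq i, hq i])
      _ = 3 * C * (|d i| * weight t i) := by ring
      _ ≤ 3 * C * ε := by gcongr; exact hdε i
  have b4 : |∑ i, h i i - ν * (q none / t)| ≤ N * C + |ν| * C := by
    have h1 : |∑ i, h i i| ≤ N * C := abs_sum_le_card_mul fun i =>
      le_of_mul_le_mul_right (hh i i) (hw0 i)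
    have h2 : |q none / t| ≤ C := by
      rw [abs_div, abs_of_pos ht, div_le_iff₀ ht]
      exact hq none
    refine (abs_sub _ _).trans ?_
    rw [abs_mul]
    gcongr
  have b5 : |∑ i, ∑ j, (d i * (q j + d j) + q i * d j) * h i j| ≤ N * (N * (3 * C ^ 2 * ε)) := by
    refine abs_sum_sum_le_card_mul fun i j => ?_
    have h1 : |d i * (q j + d j) * h i j| ≤ 2 * C ^ 2 * ε := by
      rw [abs_mul, abs_mul]
      calc |d i| * |q j + d j| * |h i j| ≤ |d i| * (2 * C * weight t j) * |h i j| := by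
            gcongr; exact hwq j
        _ = 2 * C * (|d i| * (|h i j| * weight t j)) := by ring
        _ ≤ 2 * C * (|d i| * (C * weight t i)) :=
          mul_le_mul_of_nonneg_left (mul_le_mul_of_nonneg_left (hh i j) (abs_nonneg _))
            (by positivity)
        _ = 2 * C ^ 2 * (|d i| * weight t i) := by ring
        _ ≤ 2 * C ^ 2 * ε := by gcongr; exact hdε i
    have h2 : |q i * d j * h i j| ≤ C ^ 2 * ε := by
      rw [abs_mul, abs_mul]
      calc |q i| * |d j| * |h i j| ≤ C * weight t i * |d j| * |h i j| := by gcongr; exact hq i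
        _ = C * (|d j| * (|h i j| * weight t i)) := by ring
        _ ≤ C * (|d j| * (C * weight t j)) :=
          mul_le_mul_of_nonneg_left (mul_le_mul_of_nonneg_left (hh' i j) (abs_nonneg _))
            (by positivity)
        _ = C ^ 2 * (|d j| * weight t j) := by ring
        _ ≤ C ^ 2 * ε := by gcongr; exact hdε j
    rw [add_mul]
    exact (abs_add_le _ _).trans (by linarith)
  have b34 : |(∑ i, d i * ((q i + d i) + q i)) * (∑ i, h i i - ν * (q none / t))|
      ≤ N * (3 * C * ε) * (N * C + |ν| * C) := by
    rw [abs_mul]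
    exact mul_le_mul b3 b4 (abs_nonneg _) (by positivity)
  refine (abs_sub _ _).trans ?_
  have := (abs_add_le ((1 + ∑ i, (q i + d i) ^ 2) * (∑ α, e (some α) (some α))
        - ∑ i, ∑ j, (q i + d i) * (q j + d j) * e i j)
        ((∑ i, d i * ((q i + d i) + q i)) * (∑ i, h i i - ν * (q none / t))))
  have := abs_sub ((1 + ∑ i, (q i + d i) ^ 2) * (∑ α, e (some α) (some α)))
    (∑ i, ∑ j, (q i + d i) * (q j + d j) * e i j)
  linarith

/-! ### Barriers -/

lemma hasFDerivAt_mul_norm_sub_sq {n : ℕ} (A : ℝ) (y₀ y : TangentialSpace n) :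
    HasFDerivAt (fun y => A * ‖y - y₀‖ ^ 2) (A • (2 • innerSL ℝ (y - y₀))) y := by
  have h1 : HasFDerivAt (fun y => y - y₀) (ContinuousLinearMap.id ℝ (TangentialSpace n)) y :=
    (hasFDerivAt_id y).sub_const y₀
  simpa using h1.norm_sq.const_mul A

lemma tanD_mul_norm_sub_sq {n : ℕ} (A : ℝ) (y₀ : TangentialSpace n) (α : Fin (n - 1)) :
    tanD α (fun y => A * ‖y - y₀‖ ^ 2) = fun y => 2 * A * (y α - y₀ α) := by
  ext y
  rw [tanD, (hasFDerivAt_mul_norm_sub_sq A y₀ y).fderiv]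
  simp [EuclideanSpace.inner_single_right]
  ring

lemma tanD_tanD_mul_norm_sub_sq {n : ℕ} (A : ℝ) (y₀ y : TangentialSpace n) (α β : Fin (n - 1)) :
    tanD β (tanD α (fun y => A * ‖y - y₀‖ ^ 2)) y = 2 * A * if α = β then 1 else 0 := by
  rw [tanD_mul_norm_sub_sq, tanD]
  have h1 : HasFDerivAt (fun y : TangentialSpace n => 2 * A * (y α - y₀ α))
      ((2 * A) • EuclideanSpace.proj α) y :=
    ((EuclideanSpace.proj α : TangentialSpace n →L[ℝ] ℝ).hasFDerivAt.sub_const _).const_mul _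
  rw [h1.fderiv]
  simp

lemma contDiff_mul_norm_sub_sq {n : ℕ} (A : ℝ) (y₀ : TangentialSpace n) {m : WithTop ℕ∞} :
    ContDiff ℝ m (fun y => A * ‖y - y₀‖ ^ 2) :=
  contDiff_const.mul ((contDiff_id.sub contDiff_const).norm_sq ℝ)

lemma tanD_const {n : ℕ} (c : ℝ) (α : Fin (n - 1)) : tanD (n := n) α (fun _ => c) = fun _ => 0 := by
  ext y
  simp [tanD]

lemma deriv_pow_add_one (m : ℕ) :
    deriv (fun t : ℝ => t ^ (m + 1)) = fun t => ((m : ℝ) + 1) * t ^ m := by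
  ext t
  simp

lemma deriv_const_mul_pow_add_one (c : ℝ) (m : ℕ) :
    deriv (fun t : ℝ => c * t ^ (m + 1)) = fun t => c * (((m : ℝ) + 1) * t ^ m) := by
  ext t
  rw [deriv_const_mul _ (differentiableAt_pow _), deriv_pow_add_one]


/-- On `G_r` the function `S` is an approximate solution with error `O(t^n)`, whose derivatives up
to order two have the sizes, in terms of the weights, of those of an even expansion in `t`. -/
structure IsApproxSolution (n : ℕ) (r C : ℝ) (S : TangentialSpace n × ℝ → ℝ) : Prop where
  contDiffAt : ∀ p ∈ cylinderG n r, ContDiffAt ℝ 2 S p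
  continuousOn : ContinuousOn S (ball 0 r ×ˢ Ico 0 r)
  grad : ∀ p ∈ cylinderG n r, ∀ i, |partialD n i S p| ≤ C * weight p.2 i
  hess : ∀ p ∈ cylinderG n r, ∀ i j,
    |partialD n j (partialD n i S) p| * weight p.2 j ≤ C * weight p.2 i
  hess' : ∀ p ∈ cylinderG n r, ∀ i j,
    |partialD n j (partialD n i S) p| * weight p.2 i ≤ C * weight p.2 j
  residual : ∀ p ∈ cylinderG n r, |clearedGraphOp n S p| ≤ C * p.2 ^ n

/-- `U` is a solution on `G_r`, up to multiplication by the positive factor `1 + |DU|²`, which is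
continuous up to `t = 0`. -/
structure IsClearedSolution (n : ℕ) (r : ℝ) (U : TangentialSpace n × ℝ → ℝ) : Prop where
  contDiffAt : ∀ p ∈ cylinderG n r, ContDiffAt ℝ 2 U p
  continuousOn : ContinuousOn U (ball 0 r ×ˢ Ico 0 r)
  equation : ∀ p ∈ cylinderG n r, clearedGraphOp n U p = 0

lemma IsApproxSolution.neg {n : ℕ} {r C : ℝ} {S : TangentialSpace n × ℝ → ℝ}
    (hS : IsApproxSolution n r C S) : IsApproxSolution n r C (fun z => -S z) where
  contDiffAt p hp := (hS.contDiffAt p hp).neg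
  continuousOn := hS.continuousOn.neg
  grad p hp i := by simpa [partialD_neg] using hS.grad p hp i
  hess p hp i j := by simpa [partialD_neg] using hS.hess p hp i j
  hess' p hp i j := by simpa [partialD_neg] using hS.hess' p hp i j
  residual p hp := by simpa [clearedGraphOp_neg] using hS.residual p hp

lemma IsClearedSolution.neg {n : ℕ} {r : ℝ} {U : TangentialSpace n × ℝ → ℝ}
    (hU : IsClearedSolution n r U) : IsClearedSolution n r (fun z => -U z) where
  contDiffAt p hp := (hU.contDiffAt p hp).neg
  continuousOn := hU.continuousOn.neg
  equation p hp := by simp [clearedGraphOp_neg, hU.equation p hp]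

/-- The closed cylinders on which the comparison principle is used lie in the domain. -/
lemma closedBall_prod_Icc_subset {n : ℕ} {r τ : ℝ} {y₀ : TangentialSpace n} (hy₀ : ‖y₀‖ < r / 2)
    (hτ : τ ≤ r / 2) (hr : 0 < r) : closedBall y₀ (r / 2) ×ˢ Icc 0 τ ⊆ ball 0 r ×ˢ Ico 0 r := by
  rintro ⟨y, t⟩ ⟨hy, ht⟩
  have h1 := norm_le_norm_add_norm_sub' y y₀
  simp only [mem_closedBall, dist_eq_norm] at hy
  exact ⟨by simpa using by linarith, ht.1, by linarith [ht.2]⟩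

/-- The barrier `A t^{m+2} |y' - y₀|² + B (t^{m+3} - t^{m+4})`. -/
noncomputable def stepBarrier {n : ℕ} (m : ℕ) (A B : ℝ) (y₀ : TangentialSpace n)
    (p : TangentialSpace n × ℝ) : ℝ :=
  sepFun (fun y => A * ‖y - y₀‖ ^ 2) (fun t => t ^ (m + 1 + 1)) p
    + sepFun (fun _ => B) (fun t => t ^ (m + 2 + 1) - t ^ (m + 3 + 1)) p

lemma deriv_pow_sub_pow (m : ℕ) (a b : ℝ) :
    deriv (fun t : ℝ => a * t ^ (m + 1) - b * t ^ (m + 2))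
      = fun t => a * ((m : ℝ) + 1) * t ^ m - b * (m + 2) * t ^ (m + 1) := by
  ext t
  have h1 := (hasDerivAt_pow (m + 1) t).const_mul a
  have h2 := (hasDerivAt_pow (m + 2) t).const_mul b
  rw [(h1.fun_sub h2).deriv]
  push_cast
  ring

lemma contDiffAt_stepBarrier {n m : ℕ} (A B : ℝ) (y₀ : TangentialSpace n)
    (p : TangentialSpace n × ℝ) : ContDiffAt ℝ 2 (stepBarrier m A B y₀) p := by
  refine ContDiffAt.add (ContDiffAt.sepFun ?_ ?_) (ContDiffAt.sepFun ?_ ?_)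
  · exact (contDiff_mul_norm_sub_sq A y₀).contDiffAt
  · fun_prop
  · fun_prop
  · fun_prop

section stepBarrier

variable {n m : ℕ} (A B : ℝ) (y₀ : TangentialSpace n) (p : TangentialSpace n × ℝ)

lemma partialD_stepBarrier (i : CoordIndex n) :
    partialD n i (stepBarrier m A B y₀) p = match i with
      | some α => 2 * A * (p.1 α - y₀ α) * p.2 ^ (m + 2)
      | none => A * ‖p.1 - y₀‖ ^ 2 * ((m + 2) * p.2 ^ (m + 1))
          + B * ((m + 3) * p.2 ^ (m + 2) - (m + 4) * p.2 ^ (m + 3)) := by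
  have h1 : ContDiffAt ℝ 2 (fun y => A * ‖y - y₀‖ ^ 2) p.1 :=
    (contDiff_mul_norm_sub_sq A y₀).contDiffAt
  have e : stepBarrier m A B y₀ = fun p =>
    sepFun (fun y => A * ‖y - y₀‖ ^ 2) (fun t => t ^ (m + 1 + 1)) p
    + sepFun (fun _ => B) (fun t => 1 * t ^ (m + 2 + 1) - 1 * t ^ (m + 2 + 2)) p := by
    ext p
    simp only [one_mul]
    rfl
  rw [e, partialD_add, partialD_sepFun, partialD_sepFun]
  · cases i with
    | some α => simp [sepFun, sepLeft, sepRight, tanD_mul_norm_sub_sq, tanD_const]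
    | none =>
      simp only [sepFun, sepLeft, sepRight, deriv_pow_add_one, deriv_pow_sub_pow]
      push_cast
      ring
  · fun_prop
  · fun_prop
  · exact h1.differentiableAt (by norm_num)
  · fun_prop
  · exact (h1.sepFun (contDiffAt_id.pow _)).differentiableAt (by norm_num)
  · exact (ContDiffAt.sepFun (m := 2) contDiffAt_const (by fun_prop)).differentiableAt
      (by norm_num)

lemma partialD_partialD_stepBarrier (i j : CoordIndex n) :
    partialD n j (partialD n i (stepBarrier m A B y₀)) p = match i, j with
      | some α, some β => 2 * A * (if α = β then 1 else 0) * p.2 ^ (m + 2)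
      | some α, none => 2 * A * (p.1 α - y₀ α) * ((m + 2) * p.2 ^ (m + 1))
      | none, some α => 2 * A * (p.1 α - y₀ α) * ((m + 2) * p.2 ^ (m + 1))
      | none, none => A * ‖p.1 - y₀‖ ^ 2 * ((m + 2) * (m + 1) * p.2 ^ m)
          + B * ((m + 3) * (m + 2) * p.2 ^ (m + 1) - (m + 4) * (m + 3) * p.2 ^ (m + 2)) := by
  have h1 : ContDiffAt ℝ 2 (fun y => A * ‖y - y₀‖ ^ 2) p.1 :=
    (contDiff_mul_norm_sub_sq A y₀).contDiffAt
  have e : stepBarrier m A B y₀ = fun p =>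
    sepFun (fun y => A * ‖y - y₀‖ ^ 2) (fun t => t ^ (m + 1 + 1)) p
    + sepFun (fun _ => B) (fun t => 1 * t ^ (m + 2 + 1) - 1 * t ^ (m + 2 + 2)) p := by
    ext p
    simp only [one_mul]
    rfl
  rw [e, partialD_partialD_add, partialD_partialD_sepFun, partialD_partialD_sepFun]
  · rcases i with _ | α <;> rcases j with _ | β
    · have e2 : ∀ t : ℝ, (1 : ℝ) * ((m + 2 : ℕ) + 1) * t ^ (m + 2) - 1 * ((m + 2 : ℕ) + 2) *
          t ^ (m + 2 + 1) = ((m : ℝ) + 3) * t ^ (m + 1 + 1) - (m + 4) * t ^ (m + 1 + 2) := by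
        intro t; push_cast; ring
      simp only [sepFun, sepLeft, sepRight, deriv_pow_add_one, deriv_pow_sub_pow,
        deriv_const_mul_pow_add_one, e2]
      push_cast
      ring
    · simp only [sepFun, sepLeft, sepRight, deriv_pow_add_one, tanD_mul_norm_sub_sq, tanD_const]
      push_cast
      ring
    · simp only [sepFun, sepLeft, sepRight, deriv_pow_add_one, tanD_mul_norm_sub_sq, tanD_const]
      push_cast
      ring
    · simp only [sepFun, sepLeft, sepRight, tanD_tanD_mul_norm_sub_sq, tanD_const]
      ring
  · fun_prop
  · fun_prop
  · exact h1
  · fun_prop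
  · exact h1.sepFun (contDiffAt_id.pow _)
  · exact ContDiffAt.sepFun (m := 2) contDiffAt_const (by fun_prop)

end stepBarrier

/-- The weighted sizes of the derivatives of the barrier. The coefficient `B` enters only through a
bound `b` for `B t`: this allows to choose `B = b / τ` with the height `τ` of the cylinder as small
as needed afterwards. -/
lemma stepBarrier_bounds {n m : ℕ} {A B b : ℝ} {y₀ : TangentialSpace n}
    {p : TangentialSpace n × ℝ} (hA : 0 ≤ A) (hB : 0 ≤ B) (ht : 0 < p.2) (ht1 : p.2 ≤ 1)
    (hy : ‖p.1 - y₀‖ ≤ 1) (hb : B * p.2 ≤ b) :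
    (∀ i, |partialD n i (stepBarrier m A B y₀) p|
      ≤ (2 * A * (m + 2) ^ 2 + 2 * b * (m + 4) ^ 2) * weight p.2 i) ∧
    (∀ i, |partialD n i (stepBarrier m A B y₀) p| * weight p.2 i
      ≤ (2 * A * (m + 2) ^ 2 + 2 * b * (m + 4) ^ 2) * p.2 ^ (m + 2)) ∧
    (∀ i j, |partialD n j (partialD n i (stepBarrier m A B y₀)) p|
        * (weight p.2 i * weight p.2 j)
      ≤ (2 * A * (m + 2) ^ 2 + 2 * b * (m + 4) ^ 2) * p.2 ^ (m + 2)) := by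
  obtain ⟨y, t⟩ := p
  simp only at ht ht1 hy hb
  have hb0 : 0 ≤ b := (mul_nonneg hB ht.le).trans hb
  set E : ℝ := 2 * A * (m + 2) ^ 2 + 2 * b * (m + 4) ^ 2 with hE
  have hm : (0 : ℝ) ≤ m := m.cast_nonneg
  have hE0 : 0 ≤ E := by positivity
  have hyα : ∀ α, |y α - y₀ α| ≤ 1 := fun α => by
    have := PiLp.norm_apply_le (y - y₀) α
    simp only [PiLp.sub_apply, Real.norm_eq_abs] at this
    linarith
  have hy2 : ‖y - y₀‖ ^ 2 ≤ 1 := pow_le_one₀ (norm_nonneg _) hy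
  have hpow : ∀ l k : ℕ, k ≤ l → t ^ l ≤ t ^ k := fun l k h =>
    pow_le_pow_of_le_one ht.le ht1 h
  have hp : ∀ k : ℕ, 0 < t ^ k := fun k => pow_pos ht k
  have hE1 : 2 * A ≤ E := by
    nlinarith [mul_nonneg hA hm, mul_nonneg hA (mul_nonneg hm hm),
      mul_nonneg hb0 (sq_nonneg ((m : ℝ) + 4))]
  have hE2 : A * (m + 2) + b * (2 * m + 7) ≤ E := by
    nlinarith [mul_nonneg hA hm, mul_nonneg hA (mul_nonneg hm hm), mul_nonneg hb0 hm,
      mul_nonneg hb0 (mul_nonneg hm hm)]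
  have hE3 : 2 * A * (m + 2) ≤ E := by
    nlinarith [mul_nonneg hA hm, mul_nonneg hA (mul_nonneg hm hm), mul_nonneg hb0 hm,
      mul_nonneg hb0 (mul_nonneg hm hm)]
  have hE4 : A * ((m + 2) * (m + 1)) + b * ((m + 3) * (m + 2) + (m + 4) * (m + 3)) ≤ E := by
    nlinarith [mul_nonneg hA hm, mul_nonneg hA (mul_nonneg hm hm), mul_nonneg hb0 hm,
      mul_nonneg hb0 (mul_nonneg hm hm)]
  have hsome : ∀ α, |2 * A * (y α - y₀ α) * t ^ (m + 2)| ≤ E * t ^ (m + 2) := by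
    intro α
    rw [abs_mul, abs_mul, abs_of_nonneg (by positivity : 0 ≤ 2 * A), abs_of_pos (hp _)]
    gcongr
    nlinarith [hyα α, abs_nonneg (y α - y₀ α)]
  have hnone : |A * ‖y - y₀‖ ^ 2 * ((m + 2) * t ^ (m + 1))
      + B * ((m + 3) * t ^ (m + 2) - (m + 4) * t ^ (m + 3))| ≤ E * t ^ (m + 1) := by
    have h1 : |A * ‖y - y₀‖ ^ 2 * ((m + 2) * t ^ (m + 1))| ≤ A * (m + 2) * t ^ (m + 1) := by
      rw [abs_of_nonneg (by positivity)]
      have : A * ‖y - y₀‖ ^ 2 ≤ A := by nlinarith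
      calc _ ≤ A * ((m + 2) * t ^ (m + 1)) := by gcongr
        _ = _ := by ring
    have h2 : |B * ((m + 3) * t ^ (m + 2) - (m + 4) * t ^ (m + 3))|
        ≤ b * (2 * m + 7) * t ^ (m + 1) := by
      have e : B * ((m + 3) * t ^ (m + 2) - (m + 4) * t ^ (m + 3))
          = B * t * (((m + 3) - (m + 4) * t) * t ^ (m + 1)) := by ring
      rw [e, abs_mul (B * t), abs_mul _ (t ^ (m + 1)), abs_of_nonneg (mul_nonneg hB ht.le),
        abs_of_pos (hp _), mul_assoc b]
      gcongr
      rw [abs_le]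
      constructor <;> nlinarith
    calc _ ≤ _ := abs_add_le _ _
      _ ≤ (A * (m + 2) + b * (2 * m + 7)) * t ^ (m + 1) := by linarith
      _ ≤ _ := by gcongr
  have hmixed : ∀ α, |2 * A * (y α - y₀ α) * ((m + 2) * t ^ (m + 1))| * t ≤ E * t ^ (m + 2) := by
    intro α
    rw [abs_mul, abs_mul, abs_of_nonneg (by positivity : 0 ≤ 2 * A),
      abs_of_nonneg (by positivity : 0 ≤ ((m : ℝ) + 2) * t ^ (m + 1))]
    calc 2 * A * |y α - y₀ α| * ((m + 2) * t ^ (m + 1)) * t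
        ≤ 2 * A * 1 * ((m + 2) * t ^ (m + 1)) * t := by gcongr; exact hyα α
      _ = 2 * A * (m + 2) * t ^ (m + 2) := by ring
      _ ≤ _ := by gcongr
  have hnn : |A * ‖y - y₀‖ ^ 2 * ((m + 2) * (m + 1) * t ^ m)
          + B * ((m + 3) * (m + 2) * t ^ (m + 1) - (m + 4) * (m + 3) * t ^ (m + 2))|
        ≤ E * t ^ m := by
    have h1 : |A * ‖y - y₀‖ ^ 2 * ((m + 2) * (m + 1) * t ^ m)|
        ≤ A * ((m + 2) * (m + 1)) * t ^ m := by
      rw [abs_of_nonneg (by positivity)]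
      have : A * ‖y - y₀‖ ^ 2 ≤ A := by nlinarith
      calc _ ≤ A * ((m + 2) * (m + 1) * t ^ m) := by gcongr
        _ = _ := by ring
    have h2 : |B * ((m + 3) * (m + 2) * t ^ (m + 1) - (m + 4) * (m + 3) * t ^ (m + 2))|
        ≤ b * ((m + 3) * (m + 2) + (m + 4) * (m + 3)) * t ^ m := by
      have e : B * ((m + 3) * (m + 2) * t ^ (m + 1) - (m + 4) * (m + 3) * t ^ (m + 2))
          = B * t * (((m + 3) * (m + 2) - (m + 4) * (m + 3) * t) * t ^ m) := by ring
      rw [e, abs_mul (B * t), abs_mul _ (t ^ m), abs_of_nonneg (mul_nonneg hB ht.le),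
        abs_of_pos (hp _), mul_assoc b]
      gcongr
      have h3 : 0 ≤ ((m : ℝ) + 4) * (m + 3) := by positivity
      have h4 : 0 ≤ ((m : ℝ) + 3) * (m + 2) := by positivity
      rw [abs_le]
      constructor <;> nlinarith
    calc _ ≤ _ := abs_add_le _ _
      _ ≤ (A * ((m + 2) * (m + 1)) + b * ((m + 3) * (m + 2) + (m + 4) * (m + 3))) * t ^ m := by
        linarith
      _ ≤ _ := by gcongr
  refine ⟨fun i => ?_, fun i => ?_, fun i j => ?_⟩
  · rw [partialD_stepBarrier]
    rcases i with _ | α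
    · exact hnone.trans (by
        have := hpow (m + 1) 1 (by omega)
        simp only [weight]
        gcongr
        simpa using this)
    · exact (hsome α).trans
        (by simpa [weight] using mul_le_mul_of_nonneg_left (hpow (m + 2) 0 (by omega)) hE0)
  · rw [partialD_stepBarrier]
    rcases i with _ | α
    · simp only [weight]
      calc _ ≤ E * t ^ (m + 1) * t := by gcongr
        _ = _ := by ring
    · simpa [weight] using hsome α
  · rw [partialD_partialD_stepBarrier]
    rcases i with _ | α <;> rcases j with _ | β <;> simp only [weight, one_mul, mul_one]
    · calc _ ≤ E * t ^ m * (t * t) := by gcongr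
        _ = _ := by ring
    · exact hmixed β
    · exact hmixed α
    · split_ifs
      · rw [mul_one, abs_of_nonneg (by positivity)]
        gcongr
      · simpa using by positivity

/-- The barrier is a strict supersolution of the leading part of the linearized operator. The powers
`t^{m+2}` and `t^{m+3}` contribute nonpositive terms as long as `m + 2 ≤ n`. In the critical case
`m + 3 = n + 1` the power `t^{m+3}` is annihilated and the sign comes from `-t^{m+4}`. -/
lemma stepBarrier_leading {n m : ℕ} (hmn : m + 2 ≤ n) {A B : ℝ} {y₀ : TangentialSpace n}
    {p : TangentialSpace n × ℝ} (hA : 0 ≤ A) (hB : 0 ≤ B) (ht : 0 < p.2) (ht1 : p.2 ≤ 1 / 2) :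
    partialD n none (partialD n none (stepBarrier m A B y₀)) p
      - n * (partialD n none (stepBarrier m A B y₀) p / p.2) ≤ -(B * p.2 ^ (m + 2)) := by
  rw [partialD_partialD_stepBarrier, partialD_stepBarrier]
  obtain ⟨l, rfl⟩ := Nat.exists_eq_add_of_le hmn
  obtain ⟨y, t⟩ := p
  simp only at ht ht1 ⊢
  set z := ‖y - y₀‖ ^ 2 with hz
  have hz0 : 0 ≤ z := by positivity
  have e : (A * z * ((m + 2) * t ^ (m + 1)) + B * ((m + 3) * t ^ (m + 2) - (m + 4) * t ^ (m + 3)))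
      / t = A * z * ((m + 2) * t ^ m) + B * ((m + 3) * t ^ (m + 1) - (m + 4) * t ^ (m + 2)) := by
    field_simp
    ring
  rw [e]
  push_cast
  have h1 : 0 ≤ A * z * ((m + 2) * (l + 1) * t ^ m) := by positivity
  have h2 : 0 ≤ B * t ^ (m + 1) * ((l : ℝ) * ((m + 3) - (m + 4) * t) + (m + 3) * t) := by
    have h3 : (0 : ℝ) ≤ (m + 3) - (m + 4) * t := by nlinarith [(m.cast_nonneg : (0 : ℝ) ≤ m)]
    positivity
  linear_combination h1 + h2

/-- The maximum principle improves a one-sided bound of order `t^k` to one of order `t^{k+1}`, with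
constants that depend only on the given bounds, for `2 ≤ k = m + 2 ≤ n`. -/
theorem exists_step_bound {n m : ℕ} (hmn : m + 2 ≤ n) {r C M : ℝ} (hr : 0 < r) (hr1 : r ≤ 1)
    (hC : 0 ≤ C) (hM : 0 ≤ M) :
    ∃ r' ∈ Ioo 0 r, ∃ C' : ℝ, ∀ U S : TangentialSpace n × ℝ → ℝ,
      IsClearedSolution n r U → IsApproxSolution n r C S →
      (∀ y ∈ ball (0 : TangentialSpace n) r, U (y, 0) = S (y, 0)) →
      (∀ p ∈ cylinderG n r, U p - S p ≤ M * p.2 ^ (m + 2)) →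
      ∀ p ∈ cylinderG n r', U p - S p ≤ C' * p.2 ^ (m + 3) := by
  -- `A` and `b = B τ` make the barrier large enough on the sides and on the top of the cylinder;
  -- `τ` is chosen last, so small that `B = b / τ` dominates all error terms.
  set A : ℝ := 4 * M / r ^ 2 with hAdef
  set b : ℝ := 2 * M + 1 with hbdef
  have hA : 0 ≤ A := by positivity
  have hb : 0 < b := by positivity
  set E : ℝ := 2 * A * (m + 2) ^ 2 + 2 * b * (m + 4) ^ 2 with hE
  have hE0 : 0 ≤ E := by positivity
  obtain ⟨K, hK0, hK⟩ := exists_clearedOp_perturbation_bound n n (C + E)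
  set τ : ℝ := min (r / 2) (b / (C + K * E + 1)) with hτdef
  have hτ0 : 0 < τ := lt_min (by positivity) (by positivity)
  have hτr : τ ≤ r / 2 := min_le_left _ _
  set B : ℝ := b / τ with hBdef
  have hB0 : 0 < B := by positivity
  have hBτ : B * τ = b := by rw [hBdef]; field_simp
  have hBlarge : C + K * E < B := by
    have h1 : τ ≤ b / (C + K * E + 1) := min_le_right _ _
    rw [le_div_iff₀ (by positivity)] at h1
    have h2 : C + K * E + 1 ≤ B := by
      rw [hBdef, le_div_iff₀ hτ0]
      linarith
    linarith
  refine ⟨τ, ⟨hτ0, by linarith⟩, B, ?_⟩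
  intro U S hU hS hUS hUM p₀ hp₀
  set y₀ := p₀.1 with hy₀
  have hy₀r : ‖y₀‖ < r / 2 := hp₀.1.trans_le hτr
  have hsub := closedBall_prod_Icc_subset hy₀r hτr hr
  have hsub' : ∀ p ∈ closedBall y₀ (r / 2) ×ˢ Icc 0 τ, 0 < p.2 → p ∈ cylinderG n r := by
    intro p hp hpt
    have := hsub hp
    exact ⟨by simpa using this.1, hpt, this.2.2⟩
  have hint : ∀ p ∈ ball y₀ (r / 2) ×ˢ Ioo 0 τ, p ∈ cylinderG n r := fun p hp =>
    hsub' p ⟨ball_subset_closedBall hp.1, Ioo_subset_Icc_self hp.2⟩ hp.2.1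
  have hψ : ∀ p, ContDiffAt ℝ 2 (stepBarrier m A B y₀) p := contDiffAt_stepBarrier A B y₀
  have hψc : Continuous (stepBarrier m A B y₀) :=
    continuous_iff_continuousAt.2 fun p => (hψ p).continuousAt
  have key := comparison_principle (U := U) (w := fun p => S p + stepBarrier m A B y₀ p)
    (y₀ := y₀) (ρ := r / 2) (τ := τ) (hU.continuousOn.mono hsub)
    ((hS.continuousOn.mono hsub).add hψc.continuousOn)
    (fun p hp => hU.contDiffAt p (hint p hp))
    (fun p hp => (hS.contDiffAt p (hint p hp)).add (hψ p)) ?_ ?_ p₀ ?_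
  · have h1 : stepBarrier m A B y₀ p₀ ≤ B * p₀.2 ^ (m + 3) := by
      simp only [stepBarrier, sepFun, hy₀, sub_self, norm_zero]
      have : 0 ≤ B * p₀.2 ^ (m + 4) := mul_nonneg hB0.le (pow_nonneg hp₀.2.1.le _)
      ring_nf at this ⊢
      linarith
    linarith
  · intro p hp
    have hpG := hint p hp
    have ht : 0 < p.2 := hpG.2.1
    have htτ : p.2 < τ := hp.2.2
    have ht1 : p.2 ≤ 1 := by linarith
    rw [hU.equation p hpG]
    obtain ⟨b1, b2, b3⟩ := stepBarrier_bounds (m := m) (y₀ := y₀) (b := b) hA hB0.le ht ht1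
      (by have := mem_ball_iff_norm.1 hp.1; linarith) (by rw [← hBτ]; gcongr)
    have hw : ∀ i, 0 ≤ weight (n := n) p.2 i := fun i => (weight_pos ht i).le
    have hper := hK p.2 (E * p.2 ^ (m + 2)) (fun i => partialD n i S p)
      (fun i => partialD n i (stepBarrier m A B y₀) p)
      (fun i j => partialD n j (partialD n i S) p)
      (fun i j => partialD n j (partialD n i (stepBarrier m A B y₀)) p) ht ht1
      (fun i => (hS.grad p hpG i).trans (mul_le_mul_of_nonneg_right (by linarith) (hw i)))
      (fun i => (b1 i).trans (mul_le_mul_of_nonneg_right (by linarith) (hw i)))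
      (fun i j => (hS.hess p hpG i j).trans (mul_le_mul_of_nonneg_right (by linarith) (hw i)))
      (fun i j => (hS.hess' p hpG i j).trans (mul_le_mul_of_nonneg_right (by linarith) (hw j)))
      b2 b3
    have hSd := hS.contDiffAt p hpG
    have ew : clearedGraphOp n (fun p => S p + stepBarrier m A B y₀ p) p
        = clearedOp (n : ℝ) (fun i => partialD n i S p + partialD n i (stepBarrier m A B y₀) p)
          (fun i j => partialD n j (partialD n i S) p
            + partialD n j (partialD n i (stepBarrier m A B y₀)) p)
          ((partialD n none S p + partialD n none (stepBarrier m A B y₀) p) / p.2) := by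
      simp only [clearedGraphOp, partialD_partialD_add hSd (hψ p),
        partialD_add (hSd.differentiableAt (by norm_num)) ((hψ p).differentiableAt (by norm_num))]
    rw [← ew] at hper
    have hlead := stepBarrier_leading hmn (y₀ := y₀) (p := p) hA hB0.le ht (by linarith)
    have hres := hS.residual p hpG
    have htn : p.2 ^ n ≤ p.2 ^ (m + 2) := pow_le_pow_of_le_one ht.le ht1 hmn
    have htm : 0 < p.2 ^ (m + 2) := pow_pos ht _
    set W : ℝ := 1 + ∑ i, (partialD n i S p + partialD n i (stepBarrier m A B y₀) p) ^ 2
    have hW : 1 ≤ W := by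
      have : 0 ≤ ∑ i, (partialD n i S p + partialD n i (stepBarrier m A B y₀) p) ^ 2 :=
        Finset.sum_nonneg fun i _ => sq_nonneg _
      linarith
    have hWlead := mul_le_mul_of_nonneg_left hlead (by linarith : 0 ≤ W)
    have h5 : 0 ≤ (W - 1) * (B * p.2 ^ (m + 2)) :=
      mul_nonneg (by linarith) (mul_nonneg hB0.le htm.le)
    have h6 := (abs_le.1 hper).2
    have h7 := (abs_le.1 hres).2
    have h8 : C * p.2 ^ n ≤ C * p.2 ^ (m + 2) := by gcongr
    have h9 : (C + K * E) * p.2 ^ (m + 2) < B * p.2 ^ (m + 2) := by gcongr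
    have e9 : clearedGraphOp n S p = clearedOp (n : ℝ) (fun i => partialD n i S p)
      (fun i j => partialD n j (partialD n i S) p) (partialD n none S p / p.2) := rfl
    rw [← e9] at h6
    linarith
  · intro p hp hcase
    simp only [stepBarrier, sepFun]
    rcases eq_or_lt_of_le hp.2.1 with h0 | hpos
    · have hpe : p = (p.1, 0) := by rw [h0]
      have hb0 := hUS p.1 (hsub hp).1
      rw [← hpe] at hb0
      simp [← h0, hb0]
    · have hpG := hsub' p hp hpos
      have h1 := hUM p hpG
      have ht2 : p.2 ≤ 1 / 2 := by linarith [hp.2.2]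
      have hB2 : B * (p.2 ^ (m + 2 + 1) - p.2 ^ (m + 3 + 1))
          = B * p.2 * (1 - p.2) * p.2 ^ (m + 2) := by
        ring
      have htm : 0 < p.2 ^ (m + 2) := pow_pos hpos _
      rcases hcase with h | h | h
      · exact absurd h hpos.ne'
      · have h2 : 0 ≤ A * ‖p.1 - y₀‖ ^ 2 * p.2 ^ (m + 1 + 1) := by positivity
        have h3 : M ≤ B * p.2 * (1 - p.2) := by rw [h, hBτ, ← h]; nlinarith
        have h4 := mul_le_mul_of_nonneg_right h3 htm.le
        rw [← hB2] at h4
        linarith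
      · have h2 : 0 ≤ B * p.2 * (1 - p.2) * p.2 ^ (m + 2) :=
          mul_nonneg (mul_nonneg (by positivity) (by linarith)) htm.le
        rw [← hB2] at h2
        have h3 : A * ‖p.1 - y₀‖ ^ 2 = M := by
          rw [← dist_eq_norm, h, hAdef]
          field_simp
          ring
        rw [h3]
        have e : p.2 ^ (m + 1 + 1) = p.2 ^ (m + 2) := rfl
        rw [e]
        linarith
  · exact ⟨mem_closedBall_self (by positivity), hp₀.2.1.le, hp₀.2.2.le⟩

/-- The barrier `φ + A |y' - y₀|² + B t²`. -/
noncomputable def initialBarrier {n : ℕ} (φ : TangentialSpace n → ℝ) (A B : ℝ)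
    (y₀ : TangentialSpace n) (p : TangentialSpace n × ℝ) : ℝ :=
  (sepFun φ (fun _ => 1) p + sepFun (fun y => A * ‖y - y₀‖ ^ 2) (fun _ => 1) p)
    + sepFun (fun _ => B) (fun t => t ^ (1 + 1)) p

lemma contDiffAt_initialBarrier {n : ℕ} {φ : TangentialSpace n → ℝ} (A B : ℝ)
    (y₀ : TangentialSpace n) {p : TangentialSpace n × ℝ} (hφ : ContDiffAt ℝ 2 φ p.1) :
    ContDiffAt ℝ 2 (initialBarrier φ A B y₀) p := by
  refine ContDiffAt.add (ContDiffAt.add (hφ.sepFun ?_) (ContDiffAt.sepFun ?_ ?_))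
    (ContDiffAt.sepFun ?_ ?_)
  · fun_prop
  · exact (contDiff_mul_norm_sub_sq A y₀).contDiffAt
  · fun_prop
  · fun_prop
  · fun_prop

/-- The coefficient matrix `(1 + |Dw|²) I - Dw ⊗ Dw` is bounded by `1 + |Dw|²` and
`w_tt - n w_t / t = -2(n - 1) B`, so that for large `B` the barrier is a strict supersolution, no
matter how large its gradient is. -/
lemma clearedGraphOp_initialBarrier_neg {n : ℕ} (hn : 2 ≤ n) {φ : TangentialSpace n → ℝ}
    {A B C : ℝ} {y₀ : TangentialSpace n} {p : TangentialSpace n × ℝ} (hA : 0 ≤ A)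
    (hφ : ContDiffAt ℝ 2 φ p.1) (hC : ∀ α β, |tanD β (tanD α φ) p.1| ≤ C) (ht : 0 < p.2)
    (hB : (n : ℝ) * (C + 2 * A) + n * (n * C) < B) :
    clearedGraphOp n (initialBarrier φ A B y₀) p < 0 := by
  have hn1 : (2 : ℝ) ≤ n := by exact_mod_cast hn
  have hC0 : 0 ≤ C := (abs_nonneg _).trans (hC ⟨0, by omega⟩ ⟨0, by omega⟩)
  have h1 : ContDiffAt ℝ 2 (fun y => A * ‖y - y₀‖ ^ 2) p.1 :=
    (contDiff_mul_norm_sub_sq A y₀).contDiffAt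
  have s1 : ContDiffAt ℝ 2 (sepFun φ fun _ => (1 : ℝ)) p := hφ.sepFun contDiffAt_const
  have s2 : ContDiffAt ℝ 2 (sepFun (fun y => A * ‖y - y₀‖ ^ 2) fun _ => (1 : ℝ)) p :=
    h1.sepFun contDiffAt_const
  have s3 : ContDiffAt ℝ 2 (sepFun (n := n) (fun _ => B) fun t => t ^ (1 + 1)) p :=
    contDiffAt_const.sepFun (by fun_prop)
  have hq : partialD n none (initialBarrier φ A B y₀) p = 2 * B * p.2 := by
    have e : initialBarrier φ A B y₀ = fun p =>
      (sepFun φ (fun _ => 1) p + sepFun (fun y => A * ‖y - y₀‖ ^ 2) (fun _ => 1) p)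
        + sepFun (fun _ => B) (fun t => t ^ (1 + 1)) p := rfl
    rw [e, partialD_add ((s1.add s2).differentiableAt (by norm_num))
      (s3.differentiableAt (by norm_num)), partialD_add (s1.differentiableAt (by norm_num))
      (s2.differentiableAt (by norm_num)), partialD_sepFun (hφ.differentiableAt (by norm_num))
      (by fun_prop), partialD_sepFun (h1.differentiableAt (by norm_num)) (by fun_prop),
      partialD_sepFun (by fun_prop) (by fun_prop)]
    simp only [sepFun, sepLeft, sepRight, deriv_const', deriv_pow_add_one]
    push_cast
    ring
  have hh : ∀ i j, partialD n j (partialD n i (initialBarrier φ A B y₀)) p = match i, j with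
      | some α, some β => tanD β (tanD α φ) p.1 + 2 * A * if α = β then 1 else 0
      | none, none => 2 * B
      | _, _ => 0 := by
    intro i j
    have e : initialBarrier φ A B y₀ = fun p =>
      (sepFun φ (fun _ => 1) p + sepFun (fun y => A * ‖y - y₀‖ ^ 2) (fun _ => 1) p)
        + sepFun (fun _ => B) (fun t => t ^ (1 + 1)) p := rfl
    rw [e, partialD_partialD_add (s1.add s2) s3, partialD_partialD_add s1 s2,
      partialD_partialD_sepFun hφ contDiffAt_const, partialD_partialD_sepFun h1 contDiffAt_const,
      partialD_partialD_sepFun contDiffAt_const (by fun_prop)]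
    rcases i with _ | α <;> rcases j with _ | β <;>
      simp only [sepFun, sepLeft, sepRight, deriv_const', deriv_const_mul_pow_add_one,
        deriv_pow_add_one, tanD_const, tanD_tanD_mul_norm_sub_sq]
    · norm_num
      ring
    · simp
    · simp
    · simp
  simp only [clearedGraphOp, clearedOp, hh, hq, Fintype.sum_option, mul_zero, Finset.sum_const_zero,
    add_zero, zero_add, if_true, mul_one]
  set a : Fin (n - 1) → ℝ := fun α => partialD n (some α) (initialBarrier φ A B y₀) p with ha
  have hcard : (Fintype.card (Fin (n - 1)) : ℝ) ≤ n := by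
    rw [Fintype.card_fin]; exact_mod_cast Nat.sub_le n 1
  have ediv : 2 * B * p.2 / p.2 = 2 * B := by field_simp
  rw [ediv]
  set s : ℝ := ∑ α, a α ^ 2 with hs
  have hs0 : 0 ≤ s := Finset.sum_nonneg fun _ _ => sq_nonneg _
  set W : ℝ := 1 + ((2 * B * p.2) ^ 2 + s) with hW
  have hW1 : 1 ≤ W := by nlinarith [sq_nonneg (2 * B * p.2)]
  have htr : ∑ α, (tanD α (tanD α φ) p.1 + 2 * A) ≤ n * (C + 2 * A) := by
    have := abs_sum_le_card_mul (f := fun α => tanD α (tanD α φ) p.1 + 2 * A)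
      (b := C + 2 * A) fun α => by
        refine (abs_add_le _ _).trans ?_
        simp only [abs_of_nonneg (by positivity : 0 ≤ 2 * A)]
        linarith [hC α α]
    exact (le_abs_self _).trans (this.trans (by gcongr))
  have hquad : -(W * (n * (n * C))) ≤ ∑ α, ∑ β, a α * a β * (tanD β (tanD α φ) p.1
      + 2 * A * if α = β then 1 else 0) := by
    have e1 : ∑ α, ∑ β, a α * a β * (tanD β (tanD α φ) p.1 + 2 * A * if α = β then 1 else 0)
        = ∑ α, ∑ β, a α * a β * tanD β (tanD α φ) p.1 + 2 * A * s := by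
      simp only [mul_add, Finset.sum_add_distrib, hs, Finset.mul_sum]
      congr 1
      refine Finset.sum_congr rfl fun α _ => ?_
      simp
      ring
    have h2 := abs_sum_sum_le_card_mul (f := fun α β => a α * a β * tanD β (tanD α φ) p.1)
      (b := W * C) fun α β => by
        have h3 : ∀ γ, a γ ^ 2 ≤ s := fun γ =>
          Finset.single_le_sum (f := fun γ => a γ ^ 2) (fun _ _ => sq_nonneg _) (Finset.mem_univ γ)
        have h4 : |a α * a β| ≤ W := by
          rw [abs_mul]
          nlinarith [h3 α, h3 β, sq_abs (a α), sq_abs (a β), sq_nonneg (|a α| - |a β|),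
            sq_nonneg (2 * B * p.2)]
        rw [abs_mul]
        exact mul_le_mul h4 (hC α β) (abs_nonneg _) (by linarith)
    have h5 : (Fintype.card (Fin (n - 1)) : ℝ) * (Fintype.card (Fin (n - 1)) * (W * C))
        ≤ n * (n * (W * C)) := by gcongr
    rw [e1]
    have h6 : 0 ≤ 2 * A * s := by positivity
    have h7 := (abs_le.1 h2).1
    have h8 : W * (n * (n * C)) = n * (n * (W * C)) := by ring
    linarith
  simp only [ha] at hquad
  have hB0 : 0 < B := lt_of_le_of_lt (by positivity) hB
  have h9 : 0 ≤ (2 * B * p.2) * (2 * B * p.2) * (2 * B) := by positivity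
  have h10 : 2 * B + ∑ α, (tanD α (tanD α φ) p.1 + 2 * A) - n * (2 * B)
      + n * (n * C) ≤ n * (C + 2 * A) + n * (n * C) - 2 * B := by nlinarith
  have h11 := mul_le_mul_of_nonneg_left h10 (by linarith : 0 ≤ W)
  have h12 : W * (n * (C + 2 * A) + n * (n * C) - 2 * B) < 0 :=
    mul_neg_of_pos_of_neg (by linarith) (by linarith)
  linarith

/-- A bounded solution differs from its boundary values at most by `O(t²)`. -/
theorem exists_initial_bound {n : ℕ} (hn : 2 ≤ n) {r C M : ℝ} (hr : 0 < r) (hC : 0 ≤ C)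
    (hM : 0 ≤ M) :
    ∃ C' : ℝ, ∀ (U : TangentialSpace n × ℝ → ℝ) (φ : TangentialSpace n → ℝ),
      IsClearedSolution n r U →
      (∀ y ∈ ball (0 : TangentialSpace n) r, ContDiffAt ℝ 2 φ y) →
      (∀ y ∈ ball (0 : TangentialSpace n) r, |φ y| ≤ C) →
      (∀ y ∈ ball (0 : TangentialSpace n) r, ∀ α β, |tanD β (tanD α φ) y| ≤ C) →
      (∀ y ∈ ball (0 : TangentialSpace n) r, U (y, 0) = φ y) →
      (∀ p ∈ cylinderG n r, U p ≤ M) →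
      ∀ p ∈ cylinderG n (r / 2), U p - φ p.1 ≤ C' * p.2 ^ 2 := by
  set A : ℝ := 4 * (M + C) / r ^ 2 with hAdef
  have hA : 0 ≤ A := by positivity
  set B : ℝ := (n : ℝ) * (C + 2 * A) + n * (n * C) + A + 1 with hBdef
  have hBA : A ≤ B := by
    have : 0 ≤ (n : ℝ) * (C + 2 * A) + n * (n * C) := by positivity
    linarith
  refine ⟨B, ?_⟩
  intro U φ hU hφ hφC hφ2 hUφ hUM p₀ hp₀
  set y₀ := p₀.1 with hy₀
  have hsub := closedBall_prod_Icc_subset hp₀.1 le_rfl hr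
  have hsub' : ∀ p ∈ closedBall y₀ (r / 2) ×ˢ Icc 0 (r / 2), 0 < p.2 → p ∈ cylinderG n r := by
    intro p hp hpt
    have := hsub hp
    exact ⟨by simpa using this.1, hpt, this.2.2⟩
  have hint : ∀ p ∈ ball y₀ (r / 2) ×ˢ Ioo 0 (r / 2), p ∈ cylinderG n r := fun p hp =>
    hsub' p ⟨ball_subset_closedBall hp.1, Ioo_subset_Icc_self hp.2⟩ hp.2.1
  have hw : ∀ p ∈ closedBall y₀ (r / 2) ×ˢ Icc 0 (r / 2),
      ContDiffAt ℝ 2 (initialBarrier φ A B y₀) p := fun p hp =>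
    contDiffAt_initialBarrier A B y₀ (hφ p.1 (hsub hp).1)
  have hval : ∀ p, initialBarrier φ A B y₀ p = φ p.1 + A * ‖p.1 - y₀‖ ^ 2 + B * p.2 ^ 2 := by
    intro p
    simp [initialBarrier, sepFun]
  have key := comparison_principle (U := U) (w := initialBarrier φ A B y₀)
    (y₀ := y₀) (ρ := r / 2) (τ := r / 2) (hU.continuousOn.mono hsub)
    (fun p hp => (hw p hp).continuousAt.continuousWithinAt)
    (fun p hp => hU.contDiffAt p (hint p hp))
    (fun p hp => hw p ⟨ball_subset_closedBall hp.1, Ioo_subset_Icc_self hp.2⟩) ?_ ?_ p₀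
    ⟨mem_closedBall_self (by positivity), hp₀.2.1.le, hp₀.2.2.le⟩
  · rw [hval, ← hy₀, sub_self, norm_zero] at key
    linarith
  · intro p hp
    have hpG := hint p hp
    have hpb : p.1 ∈ ball (0 : TangentialSpace n) r := by simpa using hpG.1
    rw [hU.equation p hpG]
    exact clearedGraphOp_initialBarrier_neg hn hA (hφ p.1 hpb) (hφ2 p.1 hpb) hpG.2.1 (by linarith)
  · intro p hp hcase
    rw [hval]
    have hpb := (hsub hp).1
    have h1 : 0 ≤ A * ‖p.1 - y₀‖ ^ 2 := by positivity
    have h2 : 0 ≤ B * p.2 ^ 2 := mul_nonneg (hA.trans hBA) (sq_nonneg _)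
    rcases eq_or_lt_of_le hp.2.1 with h0 | hpos
    · have hb0 := hUφ p.1 hpb
      rw [show (p.1, (0 : ℝ)) = p by rw [h0]] at hb0
      linarith
    · have hpM := hUM p (hsub' p hp hpos)
      have hφp := (abs_le.1 (hφC p.1 hpb)).1
      have hAr : A * (r / 2) ^ 2 = M + C := by
        rw [hAdef]
        field_simp
        ring
      rcases hcase with h | h | h
      · exact absurd h hpos.ne'
      · have : A * (r / 2) ^ 2 ≤ B * p.2 ^ 2 := by rw [h]; gcongr
        linarith
      · rw [dist_eq_norm] at h
        rw [h, hAr]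
        linarith

/-! ### Families of functions with uniformly bounded derivatives -/

/-- The tangential partial derivatives of order at most `m` of the functions `F i` are bounded on
the ball of radius `R`, uniformly in `i`. -/
def BddDeriv {n : ℕ} {ι : Type*} (R : ℝ) : ℕ → (ι → TangentialSpace n → ℝ) → Prop
  | 0, F => ∃ C : ℝ, ∀ i, ∀ y ∈ ball (0 : TangentialSpace n) R, |F i y| ≤ C
  | m + 1, F => (∃ C : ℝ, ∀ i, ∀ y ∈ ball (0 : TangentialSpace n) R, |F i y| ≤ C) ∧
      ∀ α, BddDeriv R m fun i => tanD α (F i)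

/-- A bounded family in `C^m` of the ball of radius `R`. -/
structure UnifC {n : ℕ} {ι : Type*} (R : ℝ) (m : ℕ) (F : ι → TangentialSpace n → ℝ) : Prop where
  contDiffOn : ∀ i, ContDiffOn ℝ m (F i) (ball 0 R)
  bddDeriv : BddDeriv R m F

section UnifC

variable {n : ℕ} {ι : Type*} {R : ℝ} {m : ℕ} {F G : ι → TangentialSpace n → ℝ}

lemma UnifC.exists_bound (h : UnifC R m F) :
    ∃ C : ℝ, ∀ i, ∀ y ∈ ball (0 : TangentialSpace n) R, |F i y| ≤ C := by
  cases m with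
  | zero => exact h.bddDeriv
  | succ m => exact h.bddDeriv.1

lemma UnifC.contDiffAt (h : UnifC R m F) (i : ι) {y : TangentialSpace n}
    (hy : y ∈ ball (0 : TangentialSpace n) R) : ContDiffAt ℝ m (F i) y :=
  (h.contDiffOn i).contDiffAt (isOpen_ball.mem_nhds hy)

lemma ContDiffOn.tanD {f : TangentialSpace n → ℝ} (hf : ContDiffOn ℝ (m + 1 : ℕ) f (ball 0 R))
    (α : Fin (n - 1)) : ContDiffOn ℝ m (tanD α f) (ball 0 R) :=
  (hf.fderiv_of_isOpen isOpen_ball (by push_cast; exact le_rfl)).clm_apply contDiffOn_const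

lemma UnifC.tanD (h : UnifC R (m + 1) F) (α : Fin (n - 1)) :
    UnifC R m fun i => tanD α (F i) :=
  ⟨fun i => (h.contDiffOn i).tanD α, h.bddDeriv.2 α⟩

lemma UnifC.of_tanD (hc : ∀ i, ContDiffOn ℝ (m + 1 : ℕ) (F i) (ball 0 R))
    (hb : ∃ C : ℝ, ∀ i, ∀ y ∈ ball (0 : TangentialSpace n) R, |F i y| ≤ C)
    (hd : ∀ α, UnifC R m fun i => _root_.tanD α (F i)) : UnifC R (m + 1) F :=
  ⟨hc, hb, fun α => (hd α).bddDeriv⟩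

lemma UnifC.of_succ (h : UnifC R (m + 1) F) : UnifC R m F := by
  induction m generalizing F with
  | zero => exact ⟨fun i => (h.contDiffOn i).of_le (by simp), h.exists_bound⟩
  | succ m ih =>
    exact UnifC.of_tanD (fun i => (h.contDiffOn i).of_le (by norm_cast; omega)) h.exists_bound
      fun α => ih (h.tanD α)

lemma UnifC.mono {m' : ℕ} (h : UnifC R m F) (hm : m' ≤ m) : UnifC R m' F := by
  induction m, hm using Nat.le_induction with
  | base => exact h
  | succ m _ ih => exact ih h.of_succ

lemma tanD_congr {f g : TangentialSpace n → ℝ} (h : EqOn f g (ball 0 R)) (α : Fin (n - 1)) :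
    EqOn (tanD α f) (tanD α g) (ball 0 R) := by
  intro y hy
  have : f =ᶠ[nhds y] g := Filter.eventuallyEq_of_mem (isOpen_ball.mem_nhds hy) h
  simp [tanD, this.fderiv_eq]

lemma UnifC.congr (h : UnifC R m F) (hFG : ∀ i, EqOn (G i) (F i) (ball 0 R)) : UnifC R m G := by
  refine ⟨fun i => (h.contDiffOn i).congr (hFG i), ?_⟩
  replace h := h.bddDeriv
  induction m generalizing F G with
  | zero =>
    obtain ⟨C, hC⟩ := h
    exact ⟨C, fun i y hy => by rw [hFG i hy]; exact hC i y hy⟩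
  | succ m ih =>
    obtain ⟨⟨C, hC⟩, h2⟩ := h
    exact ⟨⟨C, fun i y hy => by rw [hFG i hy]; exact hC i y hy⟩,
      fun α => ih (fun i => tanD_congr (hFG i) α) (h2 α)⟩

lemma UnifC.const (c : ℝ) : UnifC R m fun (_ : ι) (_ : TangentialSpace n) => c := by
  induction m generalizing c with
  | zero => exact ⟨fun i => contDiffOn_const, |c|, fun _ _ _ => le_rfl⟩
  | succ m ih =>
    refine UnifC.of_tanD (fun i => contDiffOn_const) ⟨|c|, fun _ _ _ => le_rfl⟩ fun α => ?_
    simpa only [tanD_const] using ih 0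

lemma UnifC.add (hF : UnifC R m F) (hG : UnifC R m G) : UnifC R m fun i y => F i y + G i y := by
  have hb : ∃ C : ℝ, ∀ i, ∀ y ∈ ball (0 : TangentialSpace n) R, |F i y + G i y| ≤ C := by
    obtain ⟨C, hC⟩ := hF.exists_bound
    obtain ⟨D, hD⟩ := hG.exists_bound
    exact ⟨C + D, fun i y hy => (abs_add_le _ _).trans (add_le_add (hC i y hy) (hD i y hy))⟩
  have hc := fun i => (hF.contDiffOn i).add (hG.contDiffOn i)
  induction m generalizing F G with
  | zero => exact ⟨hc, hb⟩
  | succ m ih =>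
    refine UnifC.of_tanD hc hb fun α => ?_
    have hb' : ∃ C : ℝ, ∀ i, ∀ y ∈ ball (0 : TangentialSpace n) R,
        |_root_.tanD α (F i) y + _root_.tanD α (G i) y| ≤ C := by
      obtain ⟨C, hC⟩ := (hF.tanD α).exists_bound
      obtain ⟨D, hD⟩ := (hG.tanD α).exists_bound
      exact ⟨C + D, fun i y hy => (abs_add_le _ _).trans (add_le_add (hC i y hy) (hD i y hy))⟩
    refine (ih (hF.tanD α) (hG.tanD α) hb' fun i =>
      ((hF.tanD α).contDiffOn i).add ((hG.tanD α).contDiffOn i)).congr fun i y hy => ?_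
    have h1 := (hF.contDiffAt i hy).differentiableAt (by simp)
    have h2 := (hG.contDiffAt i hy).differentiableAt (by simp)
    simp [_root_.tanD, fderiv_fun_add h1 h2]

lemma UnifC.mul (hF : UnifC R m F) (hG : UnifC R m G) : UnifC R m fun i y => F i y * G i y := by
  have hb : ∃ C : ℝ, ∀ i, ∀ y ∈ ball (0 : TangentialSpace n) R, |F i y * G i y| ≤ C := by
    obtain ⟨C, hC⟩ := hF.exists_bound
    obtain ⟨D, hD⟩ := hG.exists_bound
    refine ⟨C * D, fun i y hy => ?_⟩
    rw [abs_mul]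
    exact mul_le_mul (hC i y hy) (hD i y hy) (abs_nonneg _) ((abs_nonneg _).trans (hC i y hy))
  have hc := fun i => (hF.contDiffOn i).mul (hG.contDiffOn i)
  induction m generalizing F G with
  | zero => exact ⟨hc, hb⟩
  | succ m ih =>
    refine UnifC.of_tanD hc hb fun α => ?_
    have hmul : ∀ {F' G' : ι → TangentialSpace n → ℝ}, UnifC R m F' → UnifC R m G' →
        UnifC R m fun i y => F' i y * G' i y := by
      intro F' G' hF' hG'
      refine ih hF' hG' ?_ fun i => (hF'.contDiffOn i).mul (hG'.contDiffOn i)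
      obtain ⟨C, hC⟩ := hF'.exists_bound
      obtain ⟨D, hD⟩ := hG'.exists_bound
      refine ⟨C * D, fun i y hy => ?_⟩
      rw [abs_mul]
      exact mul_le_mul (hC i y hy) (hD i y hy) (abs_nonneg _) ((abs_nonneg _).trans (hC i y hy))
    refine ((hmul (hF.tanD α) hG.of_succ).add (hmul hF.of_succ (hG.tanD α))).congr
      fun i y hy => ?_
    have h1 := (hF.contDiffAt i hy).differentiableAt (by simp)
    have h2 := (hG.contDiffAt i hy).differentiableAt (by simp)
    simp [_root_.tanD, fderiv_fun_mul h1 h2]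
    ring

lemma UnifC.const_mul (c : ℝ) (hF : UnifC R m F) : UnifC R m fun i y => c * F i y :=
  (UnifC.const c).mul hF

lemma UnifC.neg (hF : UnifC R m F) : UnifC R m fun i y => -F i y := by
  simpa using hF.const_mul (-1)

lemma UnifC.sum {J : Type*} (s : Finset J) {H : J → ι → TangentialSpace n → ℝ}
    (h : ∀ j ∈ s, UnifC R m (H j)) : UnifC R m fun i y => ∑ j ∈ s, H j i y := by
  classical
  induction s using Finset.induction_on with
  | empty => simpa using UnifC.const 0
  | insert a s ha ih =>
    simp only [Finset.sum_insert ha]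
    exact (h a (Finset.mem_insert_self a s)).add
      (ih fun j hj => h j (Finset.mem_insert_of_mem hj))

lemma UnifC.inv (hF : UnifC R m F) (h1 : ∀ i, ∀ y ∈ ball (0 : TangentialSpace n) R, 1 ≤ F i y) :
    UnifC R m fun i y => (F i y)⁻¹ := by
  have hne : ∀ i, ∀ y ∈ ball (0 : TangentialSpace n) R, F i y ≠ 0 := fun i y hy =>
    (lt_of_lt_of_le one_pos (h1 i y hy)).ne'
  have hb : ∃ C : ℝ, ∀ i, ∀ y ∈ ball (0 : TangentialSpace n) R, |(F i y)⁻¹| ≤ C := by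
    refine ⟨1, fun i y hy => ?_⟩
    rw [abs_of_nonneg (inv_nonneg.2 (by linarith [h1 i y hy]))]
    exact inv_le_one_of_one_le₀ (h1 i y hy)
  have hc : ∀ i, ContDiffOn ℝ m (fun y => (F i y)⁻¹) (ball 0 R) := fun i =>
    (hF.contDiffOn i).inv (hne i)
  induction m with
  | zero => exact ⟨hc, hb⟩
  | succ m ih =>
    refine UnifC.of_tanD hc hb fun α => ?_
    have hi := ih hF.of_succ fun i => (hF.of_succ.contDiffOn i).inv (hne i)
    refine ((hi.mul hi).mul (hF.tanD α)).neg.congr fun i y hy => ?_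
    have h2 := (hF.contDiffAt i hy).differentiableAt (by simp)
    have h3 : HasFDerivAt (fun y => (F i y)⁻¹) _ y :=
      HasDerivAt.comp_hasFDerivAt y (hasDerivAt_inv (hne i y hy)) h2.hasFDerivAt
    rw [_root_.tanD, h3.fderiv]
    simp [_root_.tanD, sq]

end UnifC

/-- A function family with bounded total derivatives is bounded in `C^m` in terms of partial
derivatives. -/
lemma UnifC.of_iteratedFDeriv {n : ℕ} {ι : Type*} {R : ℝ} {m : ℕ} {F : ι → TangentialSpace n → ℝ}
    {K : ℝ} (hF : ∀ i, ContDiffOn ℝ m (F i) (ball 0 R))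
    (hK : ∀ i, ∀ k ≤ m, ∀ y ∈ ball (0 : TangentialSpace n) R, ‖iteratedFDeriv ℝ k (F i) y‖ ≤ K) :
    UnifC R m F := by
  have hb : ∃ C : ℝ, ∀ i, ∀ y ∈ ball (0 : TangentialSpace n) R, |F i y| ≤ C :=
    ⟨K, fun i y hy => by simpa using hK i 0 (Nat.zero_le _) y hy⟩
  induction m generalizing F with
  | zero => exact ⟨hF, hb⟩
  | succ m ih =>
    refine UnifC.of_tanD hF hb fun α => ?_
    have hd : ∀ i, ContDiffOn ℝ m (fderiv ℝ (F i)) (ball 0 R) := fun i =>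
      (hF i).fderiv_of_isOpen isOpen_ball (by push_cast; exact le_rfl)
    have hbd : ∀ i, ∀ k ≤ m, ∀ y ∈ ball (0 : TangentialSpace n) R,
        ‖iteratedFDeriv ℝ k (_root_.tanD α (F i)) y‖ ≤ K := by
      intro i k hk y hy
      have h1 : ContDiffAt ℝ k (fderiv ℝ (F i)) y :=
        ((hd i).contDiffAt (isOpen_ball.mem_nhds hy)).of_le (by exact_mod_cast hk)
      have h2 := norm_iteratedFDeriv_clm_apply_const
        (c := EuclideanSpace.single α (1 : ℝ)) h1 le_rfl
      rw [norm_iteratedFDeriv_fderiv] at h2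
      refine h2.trans ?_
      simpa using hK i (k + 1) (by omega) y hy
    exact ih (fun i => (hF i).tanD α) hbd
      ⟨K, fun i y hy => by simpa using hbd i 0 (Nat.zero_le _) y hy⟩

/-! ### Uniform bounds for the local terms -/

section PowerSeries

variable {n : ℕ} {ι : Type*} {R : ℝ} {m : ℕ}

/-- Each coefficient of the power series is a bounded family in `C^m`. -/
def UnifCoeff (R : ℝ) (m : ℕ) (s : ι → TangentialSpace n → PowerSeries ℝ) : Prop :=
  ∀ k, UnifC R m fun i y => (s i y).coeff k

variable {s s' : ι → TangentialSpace n → PowerSeries ℝ}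

lemma UnifCoeff.add (h : UnifCoeff R m s) (h' : UnifCoeff R m s') :
    UnifCoeff R m fun i y => s i y + s' i y := fun k => by
  simpa using (h k).add (h' k)

lemma UnifCoeff.neg (h : UnifCoeff R m s) : UnifCoeff R m fun i y => -s i y := fun k => by
  simpa using (h k).neg

lemma UnifCoeff.sub (h : UnifCoeff R m s) (h' : UnifCoeff R m s') :
    UnifCoeff R m fun i y => s i y - s' i y := by
  simpa only [sub_eq_add_neg] using h.add h'.neg

lemma UnifCoeff.mul (h : UnifCoeff R m s) (h' : UnifCoeff R m s') :
    UnifCoeff R m fun i y => s i y * s' i y := fun k => by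
  simp only [PowerSeries.coeff_mul]
  exact UnifC.sum _ fun x _ => (h x.1).mul (h' x.2)

lemma UnifCoeff.const (p : PowerSeries ℝ) :
    UnifCoeff R m fun (_ : ι) (_ : TangentialSpace n) => p := fun _ => UnifC.const _

lemma UnifCoeff.sum {J : Type*} (t : Finset J) {H : J → ι → TangentialSpace n → PowerSeries ℝ}
    (h : ∀ j ∈ t, UnifCoeff R m (H j)) : UnifCoeff R m fun i y => ∑ j ∈ t, H j i y := fun k => by
  simp only [map_sum]
  exact UnifC.sum _ fun j hj => h j hj k

lemma UnifCoeff.inv (h : UnifCoeff R m s)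
    (h1 : ∀ i, ∀ y ∈ ball (0 : TangentialSpace n) R, 1 ≤ (s i y).coeff 0) :
    UnifCoeff R m fun i y => (s i y)⁻¹ := by
  intro k
  induction k using Nat.strong_induction_on with
  | _ k ih =>
    have h0 : UnifC R m fun i y => ((s i y).constantCoeff)⁻¹ := by
      simpa using (h 0).inv h1
    have e : (fun i y => (s i y)⁻¹.coeff k) = fun i y => if k = 0 then (s i y).constantCoeff⁻¹
        else -(s i y).constantCoeff⁻¹ * ∑ x ∈ Finset.HasAntidiagonal.antidiagonal k,
          if x.2 < k then (s i y).coeff x.1 * (s i y)⁻¹.coeff x.2 else 0 := by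
      funext i y
      rw [PowerSeries.coeff_inv]
    rw [e]
    split_ifs with hk
    · exact h0
    · refine h0.neg.mul (UnifC.sum _ fun x _ => ?_)
      split_ifs with hx
      · exact (h x.1).mul (ih x.2 hx)
      · exact UnifC.const 0

lemma UnifC.formalD {a : ι → ℕ → TangentialSpace n → ℝ}
    (ha : ∀ k, UnifC R (m + 1) fun i => a i k) (j : CoordIndex n) (k : ℕ) :
    UnifC R m fun i => formalD n j (a i) k := by
  cases j with
  | some α => exact (ha k).tanD α
  | none => exact (ha (k + 1)).of_succ.const_mul _

lemma UnifCoeff.seriesAt {a : ι → ℕ → TangentialSpace n → ℝ}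
    (ha : ∀ k, UnifC R m fun i => a i k) :
    UnifCoeff R m fun i y => seriesAt n (a i) y := fun k => by
  simpa [_root_.seriesAt] using ha k

lemma one_le_coeff_zero_one_add_sum_sq {I : Type*} [Fintype I] (q : I → PowerSeries ℝ) :
    1 ≤ (1 + ∑ k, q k ^ 2).coeff 0 := by
  simp only [PowerSeries.coeff_zero_eq_constantCoeff, map_add, map_one, map_sum, map_pow,
    le_add_iff_nonneg_right]
  exact Finset.sum_nonneg fun i _ => sq_nonneg _

lemma UnifCoeff.formalOp {a : ι → ℕ → TangentialSpace n → ℝ}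
    (ha : ∀ k, UnifC R (m + 2) fun i => a i k) : UnifCoeff R m fun i y => formalOp n (a i) y := by
  have h1 : ∀ j, UnifCoeff R m fun i y => _root_.seriesAt n (_root_.formalD n j (a i)) y := fun j =>
    UnifCoeff.seriesAt fun k => UnifC.formalD (fun k => (ha k).of_succ) j k
  have h2 : ∀ j l, UnifCoeff R m fun i y =>
      _root_.seriesAt n (_root_.formalD n l (_root_.formalD n j (a i))) y := fun j l =>
    UnifCoeff.seriesAt fun k => UnifC.formalD (fun k => UnifC.formalD ha j k) l k
  have h3 : UnifCoeff R m fun i y =>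
      (1 + ∑ k, _root_.seriesAt n (_root_.formalD n k (a i)) y ^ 2)⁻¹ := by
    refine UnifCoeff.inv ?_ fun i y _ => one_le_coeff_zero_one_add_sum_sq _
    refine (UnifCoeff.const 1).add (UnifCoeff.sum _ fun j _ => ?_)
    simpa only [sq] using (h1 j).mul (h1 j)
  refine ((UnifCoeff.sum _ fun i _ => h2 i i).sub (UnifCoeff.sum _ fun i _ =>
    UnifCoeff.sum _ fun j _ => (((h1 i).mul (h1 j)).mul h3).mul (h2 i j))).sub
    ((UnifCoeff.const _).mul (UnifCoeff.seriesAt fun k => ?_))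
  exact UnifC.formalD (fun k => (ha k).of_succ) none (k + 1)

lemma UnifC.localExpansion {L : ℕ} {φ : ι → TangentialSpace n → ℝ} (hφ : UnifC R L φ) (j : ℕ)
    (hj : 2 * j ≤ L) (k : ℕ) : UnifC R (L - 2 * j) fun i => localExpansion n (φ i) j k := by
  induction j generalizing k with
  | zero =>
    simp only [_root_.localExpansion]
    split_ifs
    · exact hφ
    · exact UnifC.const 0
  | succ j ih =>
    by_cases hk : k = 2 * (j + 1)
    · subst hk
      simp only [_root_.localExpansion, Function.update_self, div_eq_inv_mul]
      refine UnifC.const_mul _ (UnifCoeff.formalOp (fun k => ?_) (2 * j))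
      have e : L - 2 * (j + 1) + 2 = L - 2 * j := by omega
      rw [e]
      exact ih (by omega) k
    · simp only [_root_.localExpansion, Function.update_of_ne hk]
      exact (ih (by omega) k).mono (by omega)

end PowerSeries

/-! ### The formal solution -/

/-- The expansion in powers of `t` of `(1 + |Du|²) Q(u)` for `u = ∑ a_k(y') t^k`, `a_1 = 0`. -/
noncomputable def formalCleared (n : ℕ) (a : ℕ → TangentialSpace n → ℝ) (y : TangentialSpace n) :
    PowerSeries ℝ :=
  clearedOp (PowerSeries.C (n : ℝ)) (fun i => seriesAt n (formalD n i a) y)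
    (fun i j => seriesAt n (formalD n j (formalD n i a)) y)
    (seriesAt n (fun k => formalD n none a (k + 1)) y)

lemma constantCoeff_one_add_sum_sq_ne_zero {I : Type*} [Fintype I] (q : I → PowerSeries ℝ) :
    (1 + ∑ k, q k ^ 2).constantCoeff ≠ 0 := by
  have := one_le_coeff_zero_one_add_sum_sq q
  rw [PowerSeries.coeff_zero_eq_constantCoeff] at this
  linarith

lemma formalCleared_eq (n : ℕ) (a : ℕ → TangentialSpace n → ℝ) (y : TangentialSpace n) :
    formalCleared n a y
      = (1 + ∑ k : CoordIndex n, seriesAt n (formalD n k a) y ^ 2) * formalOp n a y := by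
  have h := PowerSeries.mul_inv_cancel _ (constantCoeff_one_add_sum_sq_ne_zero
    fun k : CoordIndex n => seriesAt n (formalD n k a) y)
  simp only [formalCleared, clearedOp, formalOp]
  set w : PowerSeries ℝ := 1 + ∑ k : CoordIndex n, seriesAt n (formalD n k a) y ^ 2
  have e : ∑ i : CoordIndex n, ∑ j : CoordIndex n,
        seriesAt n (formalD n i a) y * seriesAt n (formalD n j a) y * w⁻¹
          * seriesAt n (formalD n j (formalD n i a)) y
      = w⁻¹ * ∑ i : CoordIndex n, ∑ j : CoordIndex n,
        seriesAt n (formalD n i a) y * seriesAt n (formalD n j a) y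
          * seriesAt n (formalD n j (formalD n i a)) y := by
    simp only [Finset.mul_sum]
    exact Finset.sum_congr rfl fun i _ => Finset.sum_congr rfl fun j _ => by ring
  rw [e]
  linear_combination (∑ i : CoordIndex n, ∑ j : CoordIndex n,
        seriesAt n (formalD n i a) y * seriesAt n (formalD n j a) y
          * seriesAt n (formalD n j (formalD n i a)) y) * h

/-- Changing the sign of `t` does not change the operator. -/
lemma clearedOp_reflect {A : Type*} [CommRing A] {n : ℕ} (ν : A) (q : CoordIndex n → A)
    (h : CoordIndex n → CoordIndex n → A) (v : A) (ε : CoordIndex n → A)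
    (hε : ∀ i, ε i * ε i = 1) :
    clearedOp ν (fun i => ε i * q i) (fun i j => ε j * (ε i * h i j)) v = clearedOp ν q h v := by
  have e1 : ∀ i, (ε i * q i) ^ 2 = q i ^ 2 := fun i => by
    rw [mul_pow, sq (ε i), hε, one_mul]
  have e2 : ∀ i, ε i * (ε i * h i i) = h i i := fun i => by
    rw [← mul_assoc, hε, one_mul]
  have e3 : ∀ i j, ε i * q i * (ε j * q j) * (ε j * (ε i * h i j)) = q i * q j * h i j := by
    intro i j
    calc _ = (ε i * ε i) * (ε j * ε j) * (q i * q j * h i j) := by ring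
      _ = _ := by rw [hε, hε, one_mul, one_mul]
  simp only [clearedOp, e1, e2, e3]

/-- The sign of a coordinate under the reflection `t ↦ -t`. -/
def reflectSign {n : ℕ} : CoordIndex n → ℤ
  | some _ => 1
  | none => -1

/-- The reflected sequence `(-1)^k a_k`. -/
def reflectSeq {n : ℕ} (a : ℕ → TangentialSpace n → ℝ) : ℕ → TangentialSpace n → ℝ :=
  fun k y => (-1) ^ k * a k y

lemma rescale_seriesAt {n : ℕ} (a : ℕ → TangentialSpace n → ℝ) (y : TangentialSpace n) :
    PowerSeries.rescale (-1 : ℝ) (seriesAt n a y) = seriesAt n (reflectSeq a) y := by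
  ext k
  simp [seriesAt, reflectSeq, PowerSeries.coeff_rescale]

lemma fderiv_const_mul_apply {n : ℕ} (c : ℝ) (f : TangentialSpace n → ℝ)
    (y v : TangentialSpace n) : fderiv ℝ (fun z => c * f z) y v = c * fderiv ℝ f y v := by
  have : (fun z => c * f z) = c • f := rfl
  rw [this, fderiv_const_smul_field]
  simp

lemma reflectSeq_formalD {n : ℕ} (i : CoordIndex n) (a : ℕ → TangentialSpace n → ℝ) :
    reflectSeq (formalD n i a)
      = fun k y => (reflectSign i : ℝ) * formalD n i (reflectSeq a) k y := by
  funext k y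
  cases i with
  | some α =>
    have : reflectSeq a k = fun z => (-1 : ℝ) ^ k * a k z := rfl
    simp [formalD, reflectSign, this, fderiv_const_mul_apply, reflectSeq]
  | none =>
    simp only [formalD, reflectSign, reflectSeq, pow_succ]
    push_cast
    ring

lemma formalD_const_mul {n : ℕ} (c : ℝ) (i : CoordIndex n) (a : ℕ → TangentialSpace n → ℝ) :
    formalD n i (fun k y => c * a k y) = fun k y => c * formalD n i a k y := by
  funext k y
  cases i with
  | some α => simp [formalD, fderiv_const_mul_apply]
  | none => simp only [formalD]; ring

lemma seriesAt_const_mul {n : ℕ} (c : ℝ) (a : ℕ → TangentialSpace n → ℝ)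
    (y : TangentialSpace n) :
    seriesAt n (fun k y => c * a k y) y = PowerSeries.C c * seriesAt n a y := by
  ext k
  simp [seriesAt]

/-- The operator preserves even expansions. -/
lemma coeff_formalCleared_odd {n : ℕ} {a : ℕ → TangentialSpace n → ℝ} (ha : reflectSeq a = a)
    (y : TangentialSpace n) {k : ℕ} (hk : Odd k) : (formalCleared n a y).coeff k = 0 := by
  have h1 : ∀ i, PowerSeries.rescale (-1 : ℝ) (seriesAt n (formalD n i a) y)
      = PowerSeries.C (reflectSign i : ℝ) * seriesAt n (formalD n i a) y := fun i => by
    rw [rescale_seriesAt, reflectSeq_formalD, ha, seriesAt_const_mul]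
  have h2 : ∀ i j, PowerSeries.rescale (-1 : ℝ) (seriesAt n (formalD n j (formalD n i a)) y)
      = PowerSeries.C (reflectSign j : ℝ) * (PowerSeries.C (reflectSign i : ℝ)
        * seriesAt n (formalD n j (formalD n i a)) y) := fun i j => by
    rw [rescale_seriesAt, reflectSeq_formalD, reflectSeq_formalD, ha, formalD_const_mul,
      seriesAt_const_mul, seriesAt_const_mul]
  have h3 : PowerSeries.rescale (-1 : ℝ) (seriesAt n (fun k => formalD n none a (k + 1)) y)
      = seriesAt n (fun k => formalD n none a (k + 1)) y := by
    rw [rescale_seriesAt]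
    congr 1
    funext k y
    have h4 := congrFun (congrFun (reflectSeq_formalD none a) (k + 1)) y
    rw [ha] at h4
    simp only [reflectSeq, reflectSign, pow_succ] at h4 ⊢
    push_cast at h4
    linarith
  have h5 : PowerSeries.rescale (-1 : ℝ) (formalCleared n a y) = formalCleared n a y := by
    have hC : PowerSeries.rescale (-1 : ℝ) (PowerSeries.C (n : ℝ)) = PowerSeries.C (n : ℝ) := by
      ext k
      rw [PowerSeries.coeff_rescale, PowerSeries.coeff_C]
      split_ifs with h
      · simp [h]
      · simp
    simp only [formalCleared]
    rw [map_clearedOp]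
    simp only [h1, h2, h3, hC]
    refine clearedOp_reflect _ _ _ _ (fun i => PowerSeries.C (reflectSign i : ℝ)) fun i => ?_
    rw [← map_mul]
    cases i <;> simp [reflectSign]
  have h6 := congrArg (fun s => PowerSeries.coeff k s) h5
  simp only [PowerSeries.coeff_rescale, hk.neg_one_pow] at h6
  linarith

/-- The effect of a change of `u_tt` and `u_t / t` alone. -/
lemma clearedOp_update_none {A : Type*} [CommRing A] {n : ℕ} (ν : A) (q : CoordIndex n → A)
    (h h' : CoordIndex n → CoordIndex n → A) (v e d : A)
    (hh : ∀ i j, ¬(i = none ∧ j = none) → h' i j = h i j) (he : h' none none = h none none + e) :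
    clearedOp ν q h' (v + d)
      = clearedOp ν q h v + (1 + ∑ k, q k ^ 2) * (e - ν * d) - q none * (q none * e) := by
  have h1 : ∀ α, h' (some α) none = h (some α) none := fun α => hh _ _ (by simp)
  have h2 : ∀ α, h' none (some α) = h none (some α) := fun α => hh _ _ (by simp)
  have h3 : ∀ α β, h' (some α) (some β) = h (some α) (some β) := fun α β => hh _ _ (by simp)
  simp only [clearedOp, Fintype.sum_option, h1, h2, h3, he]
  ring

/-- Adding `f(y') t^{m+2}` to an expansion changes the coefficients of `(1 + |Du|²) Q(u)` only from
`t^m` on, and that of `t^m` by `(1 + |Dφ|²)(m + 2)(m + 1 - n) f`. -/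
lemma coeff_formalCleared_update {n m : ℕ} {a : ℕ → TangentialSpace n → ℝ} (h1 : a 1 = 0)
    (hm : a (m + 2) = 0) (f : TangentialSpace n → ℝ) (y : TangentialSpace n) {k : ℕ}
    (hk : k ≤ m) :
    (formalCleared n (Function.update a (m + 2) f) y).coeff k = (formalCleared n a y).coeff k
      + if k = m then (1 + ∑ i, seriesAt n (formalD n i a) y ^ 2).coeff 0
          * (((m : ℝ) + 2) * (m + 1 - n) * f y) else 0 := by
  set a' := Function.update a (m + 2) f with ha'
  have ha'k : ∀ k, k ≠ m + 2 → a' k = a k := fun k hk => Function.update_of_ne hk _ _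
  have ha'm : a' (m + 2) = f := Function.update_self _ _ _
  -- All changes are computed modulo `t^{m+1}`, where only `u_tt` and `u_t / t` are affected.
  set I : Ideal (PowerSeries ℝ) := Ideal.span {PowerSeries.X ^ (m + 1)} with hI
  have hmk : ∀ s s' : PowerSeries ℝ, (∀ k ≤ m, s.coeff k = s'.coeff k) →
      Ideal.Quotient.mk I s = Ideal.Quotient.mk I s' := by
    intro s s' h
    rw [Ideal.Quotient.eq, hI, Ideal.mem_span_singleton, PowerSeries.X_pow_dvd_iff]
    intro k hk
    rw [map_sub, h k (by omega), sub_self]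
  have hq : ∀ i, Ideal.Quotient.mk I (seriesAt n (formalD n i a') y)
      = Ideal.Quotient.mk I (seriesAt n (formalD n i a) y) := by
    intro i
    refine hmk _ _ fun k hk => ?_
    cases i with
    | some α => simp [seriesAt, formalD, ha'k k (by omega)]
    | none => simp [seriesAt, formalD, ha'k (k + 1) (by omega)]
  have hh : ∀ i j, ¬(i = none ∧ j = none) →
      Ideal.Quotient.mk I (seriesAt n (formalD n j (formalD n i a')) y)
        = Ideal.Quotient.mk I (seriesAt n (formalD n j (formalD n i a)) y) := by
    intro i j hij
    refine hmk _ _ fun k hk => ?_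
    rcases i with _ | α <;> rcases j with _ | β
    · simp at hij
    · have : a' (k + 1) = a (k + 1) := ha'k (k + 1) (by omega)
      simp [seriesAt, formalD, this]
    · have : a' (k + 1) = a (k + 1) := ha'k (k + 1) (by omega)
      simp [seriesAt, formalD, this]
    · have : a' k = a k := ha'k k (by omega)
      simp [seriesAt, formalD, this]
  set e : PowerSeries ℝ := PowerSeries.monomial m (((m : ℝ) + 1) * (m + 2) * f y) with he
  set d : PowerSeries ℝ := PowerSeries.monomial m (((m : ℝ) + 2) * f y) with hd
  have htt : Ideal.Quotient.mk I (seriesAt n (formalD n none (formalD n none a')) y)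
      = Ideal.Quotient.mk I (seriesAt n (formalD n none (formalD n none a)) y)
        + Ideal.Quotient.mk I e := by
    rw [← map_add]
    refine hmk _ _ fun k hk => ?_
    rw [map_add, he, PowerSeries.coeff_monomial]
    simp only [seriesAt, formalD, PowerSeries.coeff_mk]
    split_ifs with hkm
    · subst hkm
      rw [ha'm, hm]
      push_cast
      simp
      ring
    · rw [ha'k (k + 1 + 1) (by omega), add_zero]
  have hv : Ideal.Quotient.mk I (seriesAt n (fun k => formalD n none a' (k + 1)) y)
      = Ideal.Quotient.mk I (seriesAt n (fun k => formalD n none a (k + 1)) y)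
        + Ideal.Quotient.mk I d := by
    rw [← map_add]
    refine hmk _ _ fun k hk => ?_
    rw [map_add, hd, PowerSeries.coeff_monomial]
    simp only [seriesAt, formalD, PowerSeries.coeff_mk]
    split_ifs with hkm
    · subst hkm
      rw [ha'm, hm]
      push_cast
      simp only [Pi.zero_apply, mul_zero, zero_add]
      ring
    · rw [ha'k (k + 1 + 1) (by omega), add_zero]
  -- `u_t` vanishes at `t = 0`, hence `u_t²` does not see the change of `u_tt`.
  have hqe : Ideal.Quotient.mk I (seriesAt n (formalD n none a) y) * Ideal.Quotient.mk I e = 0 := by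
    rw [← map_mul, Ideal.Quotient.eq_zero_iff_mem, hI, Ideal.mem_span_singleton, pow_succ']
    refine mul_dvd_mul ?_ ?_
    · rw [PowerSeries.X_dvd_iff]
      simp [seriesAt, formalD, h1, ← PowerSeries.coeff_zero_eq_constantCoeff_apply]
    · rw [PowerSeries.X_pow_dvd_iff]
      intro k hk
      rw [he, PowerSeries.coeff_monomial, if_neg (by omega)]
  have key : Ideal.Quotient.mk I (formalCleared n a' y)
      = Ideal.Quotient.mk I (formalCleared n a y
        + (1 + ∑ i, seriesAt n (formalD n i a) y ^ 2) * (e - PowerSeries.C (n : ℝ) * d)) := by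
    rw [map_add]
    simp only [formalCleared]
    rw [map_clearedOp, map_clearedOp, hv]
    simp only [hq]
    rw [clearedOp_update_none _ _ (fun i j =>
      Ideal.Quotient.mk I (seriesAt n (formalD n j (formalD n i a)) y)) _ _ _ _ hh htt, hqe]
    simp
  rw [Ideal.Quotient.eq, hI, Ideal.mem_span_singleton, PowerSeries.X_pow_dvd_iff] at key
  have hkey := key k (by omega)
  rw [map_sub, map_add, sub_eq_zero] at hkey
  rw [hkey]
  congr 1
  have hed : e - PowerSeries.C (n : ℝ) * d
      = PowerSeries.monomial m (((m : ℝ) + 2) * (m + 1 - n) * f y) := by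
    ext k
    rw [map_sub, PowerSeries.coeff_C_mul, he, hd]
    simp only [PowerSeries.coeff_monomial]
    split_ifs
    · ring
    · ring
  rw [hed, PowerSeries.monomial_eq_C_mul_X_pow, ← mul_assoc, PowerSeries.coeff_mul_X_pow']
  by_cases hkm : k = m
  · subst hkm
    simp
  · rw [if_neg (by omega), if_neg hkm]

section localExpansion

variable {n : ℕ} {φ : TangentialSpace n → ℝ}

lemma localExpansion_eq_zero (J : ℕ) {k : ℕ} (hk : k ≠ 0) (h : 2 * J < k ∨ Odd k) :
    localExpansion n φ J k = 0 := by
  induction J with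
  | zero => simp [localExpansion, hk]
  | succ J ih =>
    have h1 : k ≠ 2 * (J + 1) := by
      rintro rfl
      rcases h with h | h
      · omega
      · exact absurd h (by simp)
    rw [localExpansion, Function.update_of_ne h1]
    exact ih (h.imp_left (by omega))

lemma localExpansion_zero_right (J : ℕ) : localExpansion n φ J 0 = φ := by
  induction J with
  | zero => simp [localExpansion]
  | succ J ih =>
    rw [localExpansion, Function.update_of_ne (by omega)]
    exact ih

lemma reflectSeq_localExpansion (J : ℕ) :
    reflectSeq (localExpansion n φ J) = localExpansion n φ J := by
  funext k y
  rcases Nat.even_or_odd k with hk | hk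
  · simp [reflectSeq, hk.neg_one_pow]
  · have : k ≠ 0 := by rintro rfl; simp at hk
    simp [reflectSeq, localExpansion_eq_zero J this (Or.inr hk)]

lemma coeff_formalCleared_of_vanishing {a : ℕ → TangentialSpace n → ℝ} {y : TangentialSpace n}
    {m : ℕ} (h : ∀ k < m, (formalCleared n a y).coeff k = 0) :
    (formalCleared n a y).coeff m = (1 + ∑ i, seriesAt n (formalD n i a) y ^ 2).coeff 0
      * (formalOp n a y).coeff m := by
  have hinv := PowerSeries.inv_mul_cancel _ (constantCoeff_one_add_sum_sq_ne_zero
    fun i : CoordIndex n => seriesAt n (formalD n i a) y)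
  have h1 : formalOp n a y
      = (1 + ∑ i : CoordIndex n, seriesAt n (formalD n i a) y ^ 2)⁻¹ * formalCleared n a y := by
    rw [formalCleared_eq, ← mul_assoc, hinv, one_mul]
  have h2 : PowerSeries.X ^ m ∣ formalOp n a y := by
    rw [h1]
    exact (PowerSeries.X_pow_dvd_iff.2 h).mul_left _
  obtain ⟨g, hg⟩ := h2
  rw [formalCleared_eq, hg, mul_left_comm, mul_comm (PowerSeries.X ^ m),
    mul_comm (PowerSeries.X ^ m), PowerSeries.coeff_mul_X_pow', PowerSeries.coeff_mul_X_pow']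
  simp

/-- The local terms are chosen such that the expansion of the operator starts with `t^{2J}`. -/
theorem coeff_formalCleared_localExpansion {J : ℕ} (hJ : 2 * J ≤ n) (y : TangentialSpace n) :
    ∀ k < 2 * J, (formalCleared n (localExpansion n φ J) y).coeff k = 0 := by
  induction J with
  | zero => intro k hk; omega
  | succ J ih =>
    intro k hk
    have hJ' := ih (by omega)
    rcases Nat.even_or_odd k with hke | hko
    swap
    · exact coeff_formalCleared_odd (reflectSeq_localExpansion _) y hko
    have hk2 : k ≤ 2 * J := by
      obtain ⟨c, hc⟩ := hke
      omega
    have hup : localExpansion n φ (J + 1) = Function.update (localExpansion n φ J) (2 * J + 2)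
        fun y => (formalOp n (localExpansion n φ J) y).coeff (2 * J)
        / ((2 * (J + 1) : ℝ) * ((n : ℝ) + 1 - 2 * (J + 1))) := by
      rw [localExpansion, mul_add, mul_one]
    rw [hup, coeff_formalCleared_update
      (localExpansion_eq_zero J (by omega) (Or.inr odd_one))
      (localExpansion_eq_zero J (by omega) (Or.inl (by omega))) _ y hk2]
    rcases lt_or_eq_of_le hk2 with hlt | rfl
    · rw [hJ' k hlt, if_neg (by omega), add_zero]
    · rw [coeff_formalCleared_of_vanishing hJ', if_pos rfl]
      have hn : (2 * ((J : ℝ) + 1)) ≤ n := by exact_mod_cast hJ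
      have h1 : (2 * ((J : ℝ) + 1)) ≠ 0 := by positivity
      have h2 : ((n : ℝ) + 1 - 2 * (J + 1)) ≠ 0 := by linarith
      have h3 : ∀ c : ℝ, ((2 * J : ℕ) + 2 : ℝ) * ((2 * J : ℕ) + 1 - n)
          * (c / (2 * (J + 1) * (n + 1 - 2 * (J + 1)))) = -c := by
        intro c
        push_cast
        field_simp
        ring
      rw [h3]
      ring

/-- The coefficient of `t^{n+1} log t` in `u_*`, which is zero for `n` even. -/
noncomputable def logTerm (n : ℕ) (φ : TangentialSpace n → ℝ) (y : TangentialSpace n) : ℝ :=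
  if Even n then 0 else logCoeff n φ y

lemma coeff_formalCleared_lt (y : TangentialSpace n) {k : ℕ} (hk : k < n - 1) :
    (formalCleared n (localExpansion n φ (n / 2)) y).coeff k = 0 :=
  coeff_formalCleared_localExpansion (Nat.mul_div_le n 2) y k (by omega)

/-- The critical coefficient, of `t^{n-1}`, vanishes by symmetry for `n` even, and is removed by the
logarithmic term for `n` odd. -/
lemma coeff_formalCleared_critical (hn : 2 ≤ n) (y : TangentialSpace n) :
    (formalCleared n (localExpansion n φ (n / 2)) y).coeff (n - 1)
      = -((n + 1) * logTerm n φ y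
        * (1 + ∑ i, seriesAt n (formalD n i (localExpansion n φ (n / 2))) y ^ 2).coeff 0) := by
  rcases Nat.even_or_odd n with he | ho
  · rw [logTerm, if_pos he]
    have := Nat.two_mul_div_two_of_even he
    rw [coeff_formalCleared_localExpansion (Nat.mul_div_le n 2) y (n - 1) (by omega)]
    ring
  · rw [logTerm, if_neg (Nat.not_even_iff_odd.2 ho), logCoeff]
    rw [coeff_formalCleared_of_vanishing fun k hk => coeff_formalCleared_lt y hk]
    have : (n : ℝ) + 1 ≠ 0 := by positivity
    field_simp

end localExpansion

/-! ### Evaluation of the formal expansions -/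

/-- The polynomial `∑_{k < N} b_k(y') t^k` in `t`, at a fixed `y'`. -/
noncomputable def polyAt {n : ℕ} (N : ℕ) (b : ℕ → TangentialSpace n → ℝ) (y : TangentialSpace n) :
    Polynomial ℝ :=
  ∑ k ∈ Finset.range N, Polynomial.monomial k (b k y)

section polyAt

variable {n N : ℕ} {b : ℕ → TangentialSpace n → ℝ}

lemma coe_polyAt (hb : ∀ k ≥ N, b k = 0) (y : TangentialSpace n) :
    (polyAt N b y : PowerSeries ℝ) = seriesAt n b y := by
  ext k
  rw [Polynomial.coeff_coe, polyAt, Polynomial.finsetSum_coeff]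
  simp only [Polynomial.coeff_monomial, Finset.sum_ite_eq', Finset.mem_range, seriesAt,
    PowerSeries.coeff_mk]
  split_ifs with h
  · rfl
  · simp [hb k (not_lt.1 h)]

lemma eval_polyAt (p : TangentialSpace n × ℝ) :
    (polyAt N b p.1).eval p.2 = evalSeries N b p := by
  simp [polyAt, evalSeries, Polynomial.eval_finsetSum]

lemma natDegree_polyAt_le (y : TangentialSpace n) : (polyAt N b y).natDegree ≤ N :=
  Polynomial.natDegree_sum_le_of_forall_le _ _ fun _ hk =>
    (Polynomial.natDegree_monomial_le _).trans (Finset.mem_range.1 hk).le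

end polyAt

lemma natDegree_clearedOp_le {I : Type*} [Fintype I] {N : ℕ} (ν : ℝ) {q : I → Polynomial ℝ}
    {h : I → I → Polynomial ℝ} {v : Polynomial ℝ} (hq : ∀ i, (q i).natDegree ≤ N)
    (hh : ∀ i j, (h i j).natDegree ≤ N) (hv : v.natDegree ≤ N) :
    (clearedOp (Polynomial.C ν) q h v).natDegree ≤ 2 * N + N := by
  have hqq : ∀ i j, (q i * q j).natDegree ≤ 2 * N := fun i j =>
    (Polynomial.natDegree_mul_le_of_le (hq i) (hq j)).trans (by omega)
  unfold clearedOp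
  refine (Polynomial.natDegree_sub_le _ _).trans (max_le ?_ ?_)
  · refine Polynomial.natDegree_mul_le_of_le ?_ ?_
    · refine Polynomial.natDegree_add_le_of_degree_le (by simp) ?_
      exact Polynomial.natDegree_sum_le_of_forall_le _ _ fun i _ => by rw [sq]; exact hqq i i
    · refine (Polynomial.natDegree_sub_le _ _).trans (max_le ?_ ?_)
      · exact Polynomial.natDegree_sum_le_of_forall_le _ _ fun i _ => hh i i
      · exact (Polynomial.natDegree_C_mul_le _ _).trans hv
  · exact Polynomial.natDegree_sum_le_of_forall_le _ _ fun i _ =>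
      Polynomial.natDegree_sum_le_of_forall_le _ _ fun j _ =>
        Polynomial.natDegree_mul_le_of_le (hqq i j) (hh i j)

/-- For a finite expansion the formal operator is a polynomial in `t` whose values are those of the
operator. -/
lemma exists_polynomial_clearedGraphOp {n N : ℕ} {a : ℕ → TangentialSpace n → ℝ}
    (hN : ∀ k ≥ N, a k = 0) (h1 : a 1 = 0) (y : TangentialSpace n)
    (ha : ∀ᶠ z in nhds y, ∀ k, ContDiffAt ℝ 2 (a k) z) :
    ∃ P : Polynomial ℝ, P.natDegree ≤ 2 * N + N ∧ (P : PowerSeries ℝ) = formalCleared n a y ∧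
      ∀ t : ℝ, 0 < t → P.eval t = clearedGraphOp n (evalSeries N a) (y, t) := by
  have hD := formalD_eq_zero hN
  have hDD := fun i => formalD_eq_zero (hD i)
  have hv : ∀ k ≥ N, (fun k => formalD n none a (k + 1)) k = 0 := fun k hk =>
    hD none (k + 1) (by omega)
  refine ⟨clearedOp (Polynomial.C (n : ℝ)) (fun i => polyAt N (formalD n i a) y)
    (fun i j => polyAt N (formalD n j (formalD n i a)) y)
    (polyAt N (fun k => formalD n none a (k + 1)) y),
    natDegree_clearedOp_le _ (fun _ => natDegree_polyAt_le _) (fun _ _ => natDegree_polyAt_le _)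
      (natDegree_polyAt_le _), ?_, fun t ht => ?_⟩
  · have := map_clearedOp (Polynomial.coeToPowerSeries.ringHom (R := ℝ)) (Polynomial.C (n : ℝ))
      (fun i => polyAt N (formalD n i a) y) (fun i j => polyAt N (formalD n j (formalD n i a)) y)
      (polyAt N (fun k => formalD n none a (k + 1)) y)
    simp only [Polynomial.coeToPowerSeries.ringHom_apply, Polynomial.coe_C] at this
    rw [this]
    simp only [coe_polyAt (hD _), coe_polyAt (hDD _ _), coe_polyAt hv]
    rfl
  · have := map_clearedOp (Polynomial.evalRingHom t) (Polynomial.C (n : ℝ))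
      (fun i => polyAt N (formalD n i a) y) (fun i j => polyAt N (formalD n j (formalD n i a)) y)
      (polyAt N (fun k => formalD n none a (k + 1)) y)
    simp only [Polynomial.coe_evalRingHom, Polynomial.eval_C] at this
    rw [this]
    have hev : ∀ b : ℕ → TangentialSpace n → ℝ, (polyAt N b y).eval t = evalSeries N b (y, t) :=
      fun b => eval_polyAt (y, t)
    have hshift : evalSeries N (fun k => formalD n none a (k + 1)) (y, t)
        = evalSeries N (formalD n none a) (y, t) / t := by
      rw [eq_div_iff ht.ne']
      have h2 := Finset.sum_range_succ (fun k => formalD n none a k y * t ^ k) N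
      rw [Finset.sum_range_succ'] at h2
      have h3 : formalD n none a 0 y = 0 := by simp [formalD, h1]
      rw [hD none N le_rfl, h3] at h2
      simp only [Pi.zero_apply, zero_mul, add_zero] at h2
      simp only [evalSeries, ← h2, Finset.sum_mul]
      exact Finset.sum_congr rfl fun k _ => by ring
    have ha' := fun k => ha.self_of_nhds k
    simp only [hev, hshift, clearedGraphOp]
    simp only [partialD_evalSeries (p := (y, t)) (fun k => (ha' k).differentiableAt (by norm_num))
        (hN N le_rfl), partialD_partialD_evalSeries (p := (y, t)) ha hN]

/-- Finitely many bounds hold with a common constant. -/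
lemma exists_forall_of_mono {J : Type*} [Finite J] {P : J → ℝ → Prop}
    (hm : ∀ j C C', C ≤ C' → P j C → P j C') (h : ∀ j, ∃ C, P j C) : ∃ C, 0 ≤ C ∧ ∀ j, P j C := by
  have := Fintype.ofFinite J
  choose C hC using h
  refine ⟨∑ j, |C j|, Finset.sum_nonneg fun j _ => abs_nonneg _, fun j => hm j (C j) _ ?_ (hC j)⟩
  exact (le_abs_self _).trans
    (Finset.single_le_sum (f := fun j => |C j|) (fun _ _ => abs_nonneg _) (Finset.mem_univ j))

section bounds

variable {n : ℕ} {ι : Type*} {R : ℝ}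

/-- The Taylor remainder of an expansion in powers of `t` is bounded uniformly in the family. -/
lemma UnifC.exists_evalSeries_remainder_bound {b : ι → ℕ → TangentialSpace n → ℝ}
    (hb : ∀ k, UnifC R 0 fun i => b i k) {N m : ℕ} (hm : m ≤ N) :
    ∃ C : ℝ, ∀ i, ∀ p : TangentialSpace n × ℝ, p.1 ∈ ball (0 : TangentialSpace n) R → 0 < p.2 →
      p.2 ≤ 1 → |evalSeries N (b i) p - ∑ k ∈ Finset.range m, b i k p.1 * p.2 ^ k|
        ≤ C * p.2 ^ m := by
  choose D hD using fun k => (hb k).exists_bound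
  refine ⟨∑ k ∈ Finset.Ico m N, D k, fun i p hp ht ht1 => ?_⟩
  rw [evalSeries, ← Finset.sum_Ico_eq_sub _ hm, Finset.sum_mul]
  refine (Finset.abs_sum_le_sum_abs _ _).trans (Finset.sum_le_sum fun k hk => ?_)
  have hkm := (Finset.mem_Ico.1 hk).1
  rw [abs_mul, abs_of_pos (pow_pos ht k)]
  have h1 := hD k i p.1 hp
  have h0 := (abs_nonneg _).trans h1
  exact mul_le_mul h1 (pow_le_pow_of_le_one ht.le ht1 hkm) (pow_pos ht k).le h0

/-- The part `φ + c_2 t² + ⋯` of `u_*` solves the equation up to `t^{n-1}`; the coefficient of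
`t^{n-1}` in the error is expressed by that of the logarithmic term. -/
lemma exists_polynomial_residual_bound (hn : 2 ≤ n) {φ : ι → TangentialSpace n → ℝ}
    (ha : ∀ k, UnifC R 2 fun i => localExpansion n (φ i) (n / 2) k) :
    ∃ C : ℝ, ∀ i, ∀ p : TangentialSpace n × ℝ, p.1 ∈ ball (0 : TangentialSpace n) R → 0 < p.2 →
      p.2 ≤ 1 →
      |clearedGraphOp n (evalSeries (n + 1) (localExpansion n (φ i) (n / 2))) p
        + (n + 1) * logTerm n (φ i) p.1
          * (1 + ∑ j, formalD n j (localExpansion n (φ i) (n / 2)) 0 p.1 ^ 2) * p.2 ^ (n - 1)|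
        ≤ C * p.2 ^ n := by
  have hD : ∀ j, UnifCoeff R 1 fun i y => seriesAt n
      (formalD n j (localExpansion n (φ i) (n / 2))) y := fun j =>
    UnifCoeff.seriesAt (UnifC.formalD ha j)
  have hcl : UnifCoeff R 0 fun i y => formalCleared n (localExpansion n (φ i) (n / 2)) y := by
    have h1 : UnifCoeff R 0 fun i y => (1 + ∑ k : CoordIndex n,
        seriesAt n (formalD n k (localExpansion n (φ i) (n / 2))) y ^ 2) := by
      refine (UnifCoeff.const 1).add (UnifCoeff.sum _ fun j _ => ?_)
      simp only [sq]
      exact UnifCoeff.mul (fun k => (hD j k).of_succ) (fun k => (hD j k).of_succ)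
    simpa only [formalCleared_eq] using h1.mul (UnifCoeff.formalOp ha)
  choose D hDk using fun k => (hcl k).exists_bound
  refine ⟨∑ k ∈ Finset.range (2 * (n + 1) + (n + 1) + 1), |D k|, ?_⟩
  rintro i ⟨y, t⟩ hy ht ht1
  simp only at hy ht ht1 ⊢
  set a := localExpansion n (φ i) (n / 2) with hadef
  have hN : ∀ k ≥ n + 1, a k = 0 := fun k hk =>
    localExpansion_eq_zero _ (by omega) (Or.inl (by omega))
  have ha1 : a 1 = 0 := localExpansion_eq_zero _ (by omega) (Or.inr odd_one)
  obtain ⟨P, hdeg, hP, heval⟩ := exists_polynomial_clearedGraphOp hN ha1 y (by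
    filter_upwards [isOpen_ball.mem_nhds hy] with z hz k using (ha k).contDiffAt i hz)
  have hcoeff : ∀ k, P.coeff k = (formalCleared n a y).coeff k := fun k => by
    rw [← hP, Polynomial.coeff_coe]
  have hcrit := coeff_formalCleared_critical (φ := φ i) hn y
  have hW : (1 + ∑ j, seriesAt n (formalD n j a) y ^ 2).coeff 0
      = 1 + ∑ j, formalD n j a 0 y ^ 2 := by
    simp only [PowerSeries.coeff_zero_eq_constantCoeff, map_add, map_one, map_sum, map_pow]
    simp [seriesAt, ← PowerSeries.coeff_zero_eq_constantCoeff_apply]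
  rw [← hadef, hW, ← hcoeff] at hcrit
  rw [← heval t ht, Polynomial.eval_eq_sum_range' (Nat.lt_succ_of_le hdeg)]
  have hmem : n - 1 ∈ Finset.range (2 * (n + 1) + (n + 1) + 1) := Finset.mem_range.2 (by omega)
  have hterm : (n + 1) * logTerm n (φ i) y * (1 + ∑ j, formalD n j a 0 y ^ 2) * t ^ (n - 1)
      = -(P.coeff (n - 1) * t ^ (n - 1)) := by
    rw [hcrit]
    ring
  rw [hterm, ← sub_eq_add_neg, ← Finset.sum_erase_eq_sub hmem]
  refine (Finset.abs_sum_le_sum_abs _ _).trans ?_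
  refine le_trans (Finset.sum_le_sum (g := fun k => |D k| * t ^ n) fun k hk => ?_) ?_
  · have hk1 := Finset.ne_of_mem_erase hk
    rcases lt_or_ge k (n - 1) with hlt | hge
    · rw [hcoeff, hadef, coeff_formalCleared_lt y hlt]
      simp only [zero_mul, abs_zero]
      positivity
    · rw [abs_mul, abs_of_pos (pow_pos ht k), hcoeff]
      exact mul_le_mul ((hDk k i y hy).trans (le_abs_self _))
        (pow_le_pow_of_le_one ht.le ht1 (by omega)) (pow_pos ht k).le (abs_nonneg _)
  · rw [Finset.sum_mul]
    exact Finset.sum_le_sum_of_subset_of_nonneg (Finset.erase_subset _ _)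
      fun k _ _ => by positivity

end bounds

/-! ### The logarithmic term -/

/-- The function `t^{n+1} log t`. -/
noncomputable def logPower (n : ℕ) (t : ℝ) : ℝ := t ^ (n + 1) * Real.log t

lemma contDiffAt_logPower (n : ℕ) {t : ℝ} (ht : 0 < t) : ContDiffAt ℝ 2 (logPower n) t :=
  (contDiffAt_id.pow (n + 1)).mul (Real.contDiffAt_log.2 ht.ne')

lemma continuous_logPower (n : ℕ) : Continuous (logPower n) := by
  have : logPower n = fun t => t ^ n * (t * Real.log t) := by
    ext t
    simp only [logPower]
    ring
  rw [this]
  exact (continuous_pow n).mul Real.continuous_mul_log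

lemma deriv_logPower {n : ℕ} {t : ℝ} (ht : 0 < t) :
    deriv (logPower n) t = (n + 1) * t ^ n * Real.log t + t ^ n := by
  have h := (hasDerivAt_pow (n + 1) t).fun_mul (Real.hasDerivAt_log ht.ne')
  have h2 : deriv (logPower n) t = _ := h.deriv
  rw [h2]
  push_cast
  field_simp
  ring

lemma deriv_deriv_logPower {m : ℕ} {t : ℝ} (ht : 0 < t) :
    deriv (deriv (logPower (m + 1))) t
      = (m + 2) * (m + 1) * t ^ m * Real.log t + (2 * m + 3) * t ^ m := by
  have h1 : deriv (logPower (m + 1))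
      =ᶠ[nhds t] fun t => ((m : ℝ) + 2) * (t ^ (m + 1) * Real.log t) + t ^ (m + 1) := by
    filter_upwards [lt_mem_nhds ht] with s hs
    rw [deriv_logPower hs]
    push_cast
    ring
  have h := (((hasDerivAt_pow (m + 1) t).fun_mul (Real.hasDerivAt_log ht.ne')).const_mul
    ((m : ℝ) + 2)).fun_add (hasDerivAt_pow (m + 1) t)
  rw [h1.deriv_eq, h.deriv]
  push_cast
  field_simp
  ring

lemma abs_mul_log_le_one {t : ℝ} (ht : 0 < t) (ht1 : t ≤ 1) : |t * Real.log t| ≤ 1 := by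
  rw [abs_le]
  constructor
  · have h := Real.one_sub_inv_le_log_of_pos ht
    have h2 := mul_le_mul_of_nonneg_left h ht.le
    rw [mul_sub, mul_one, mul_inv_cancel₀ ht.ne'] at h2
    linarith
  · nlinarith [Real.log_nonpos ht.le ht1]

/-- The exponent `n + 1` is the second root of the indicial equation, besides `0`; the logarithm
produces the nonzero multiple `(n + 1) t^{n-1}`. -/
lemma logPower_leading {n : ℕ} (hn : 1 ≤ n) {t : ℝ} (ht : 0 < t) :
    deriv (deriv (logPower n)) t - n * (deriv (logPower n) t / t) = (n + 1) * t ^ (n - 1) := by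
  obtain ⟨m, rfl⟩ := Nat.exists_eq_add_of_le' hn
  rw [deriv_deriv_logPower ht, deriv_logPower ht]
  push_cast
  field_simp
  ring

lemma logPower_bounds {m : ℕ} {t : ℝ} (ht : 0 < t) (ht1 : t ≤ 1) :
    |logPower (m + 2) t| ≤ t ^ (m + 2) ∧
    |deriv (logPower (m + 2)) t| ≤ (m + 4) * t ^ (m + 1) ∧
    |deriv (deriv (logPower (m + 2))) t| ≤ ((m + 3) * (m + 2) + (2 * m + 5)) * t ^ m := by
  have hl := abs_mul_log_le_one ht ht1
  have hp : ∀ k : ℕ, 0 < t ^ k := fun k => pow_pos ht k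
  refine ⟨?_, ?_, ?_⟩
  · have e : logPower (m + 2) t = t ^ (m + 2) * (t * Real.log t) := by
      simp only [logPower]
      ring
    rw [e, abs_mul, abs_of_pos (hp _)]
    exact mul_le_of_le_one_right (hp _).le hl
  · rw [deriv_logPower ht]
    have e : ((m + 2 : ℕ) + 1 : ℝ) * t ^ (m + 2) * Real.log t + t ^ (m + 2)
        = (((m : ℝ) + 3) * (t * Real.log t) + t) * t ^ (m + 1) := by
      push_cast
      ring
    rw [e, abs_mul, abs_of_pos (hp _)]
    gcongr
    refine (abs_add_le _ _).trans ?_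
    rw [abs_mul, abs_of_pos ht, abs_of_nonneg (by positivity : (0 : ℝ) ≤ m + 3)]
    nlinarith [(m.cast_nonneg : (0 : ℝ) ≤ m)]
  · rw [deriv_deriv_logPower ht]
    have e : ((m + 1 : ℕ) + 2 : ℝ) * ((m + 1 : ℕ) + 1) * t ^ (m + 1) * Real.log t
        + (2 * (m + 1 : ℕ) + 3) * t ^ (m + 1)
        = (((m : ℝ) + 3) * (m + 2) * (t * Real.log t) + (2 * m + 5) * t) * t ^ m := by
      push_cast
      ring
    rw [e, abs_mul, abs_of_pos (hp _)]
    gcongr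
    refine (abs_add_le _ _).trans ?_
    rw [abs_mul, abs_mul (2 * (m : ℝ) + 5), abs_of_pos ht,
      abs_of_nonneg (by positivity : (0 : ℝ) ≤ (m + 3) * (m + 2)),
      abs_of_nonneg (by positivity : (0 : ℝ) ≤ 2 * m + 5)]
    have h1 : (0 : ℝ) ≤ ((m : ℝ) + 3) * (m + 2) := by positivity
    have h2 : (0 : ℝ) ≤ 2 * (m : ℝ) + 5 := by positivity
    nlinarith

section

variable {n : ℕ} {ι : Type*} {R : ℝ}

/-- The weighted sizes of the derivatives of `f(y') t^{n+1} log t`. -/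
lemma exists_sepFun_logPower_bounds (hn : 2 ≤ n) {f : ι → TangentialSpace n → ℝ}
    (hf : UnifC R 2 f) :
    ∃ C : ℝ, 0 ≤ C ∧ ∀ i, ∀ p : TangentialSpace n × ℝ, p.1 ∈ ball (0 : TangentialSpace n) R →
      0 < p.2 → p.2 ≤ 1 →
      (|sepFun (f i) (logPower n) p| ≤ C * p.2 ^ n) ∧
      (∀ j, |partialD n j (sepFun (f i) (logPower n)) p| ≤ C * p.2) ∧
      (∀ j, |partialD n j (sepFun (f i) (logPower n)) p| * weight p.2 j ≤ C * p.2 ^ n) ∧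
      (∀ j l, |partialD n l (partialD n j (sepFun (f i) (logPower n))) p|
        * (weight p.2 j * weight p.2 l) ≤ C * p.2 ^ n) := by
  obtain ⟨m, rfl⟩ := Nat.exists_eq_add_of_le' hn
  obtain ⟨D, hD⟩ := hf.exists_bound
  obtain ⟨D1, hD10, hD1⟩ := exists_forall_of_mono
    (P := fun α C => ∀ i, ∀ y ∈ ball (0 : TangentialSpace (m + 2)) R, |tanD α (f i) y| ≤ C)
    (fun α C C' h hC i y hy => (hC i y hy).trans h) fun α => (hf.tanD α).exists_bound
  obtain ⟨D2, hD20, hD2⟩ := exists_forall_of_mono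
    (P := fun (α : Fin (m + 2 - 1) × Fin (m + 2 - 1)) C =>
      ∀ i, ∀ y ∈ ball (0 : TangentialSpace (m + 2)) R, |tanD α.2 (tanD α.1 (f i)) y| ≤ C)
    (fun α C C' h hC i y hy => (hC i y hy).trans h) fun α =>
      ((hf.tanD α.1).tanD α.2).exists_bound
  set E : ℝ := |D| + D1 + D2 with hE
  set G : ℝ := (m + 3) * (m + 2) + (2 * m + 5) with hG
  have hG0 : 0 ≤ G := by positivity
  have hG1 : 1 ≤ G := by nlinarith [(m.cast_nonneg : (0 : ℝ) ≤ m)]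
  have hG4 : (m : ℝ) + 4 ≤ G := by nlinarith [(m.cast_nonneg : (0 : ℝ) ≤ m)]
  have hE0 : 0 ≤ E := by positivity
  refine ⟨E * G, by positivity, fun i p hp ht ht1 => ?_⟩
  obtain ⟨y, t⟩ := p
  simp only at hp ht ht1 ⊢
  obtain ⟨g0, g1, g2⟩ := logPower_bounds (m := m) ht ht1
  have hpow : ∀ k : ℕ, 0 < t ^ k := fun k => pow_pos ht k
  have g0' : |logPower (m + 2) t| ≤ G * t ^ (m + 2) :=
    g0.trans (le_mul_of_one_le_left (hpow _).le hG1)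
  have g1' : |deriv (logPower (m + 2)) t| ≤ G * t ^ (m + 1) := g1.trans (by gcongr)
  have f0 : |f i y| ≤ E := by
    have := (hD i y hp).trans (le_abs_self _)
    linarith
  have f1 : ∀ α, |tanD α (f i) y| ≤ E := fun α => by
    linarith [hD1 α i y hp, abs_nonneg D]
  have f2 : ∀ α β, |tanD β (tanD α (f i)) y| ≤ E := fun α β => by
    linarith [hD2 (α, β) i y hp, abs_nonneg D]
  have hmul : ∀ {a b c : ℝ}, |a| ≤ E → |b| ≤ G * c → |a * b| ≤ E * G * c := by
    intro a b c ha hb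
    rw [abs_mul, mul_assoc]
    exact mul_le_mul ha hb (abs_nonneg _) hE0
  have hfd : ContDiffAt ℝ 2 (f i) (y, t).1 := hf.contDiffAt i hp
  have hgd : ContDiffAt ℝ 2 (logPower (m + 2)) (y, t).2 := contDiffAt_logPower _ ht
  have hqd : ∀ j, partialD (m + 2) j (sepFun (f i) (logPower (m + 2))) (y, t) = _ :=
    partialD_sepFun (hfd.differentiableAt (by norm_num)) (hgd.differentiableAt (by norm_num))
  have hle : ∀ k l : ℕ, l ≤ k → E * G * t ^ k ≤ E * G * t ^ l := fun k l hkl =>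
    mul_le_mul_of_nonneg_left (pow_le_pow_of_le_one ht.le ht1 hkl) (by positivity)
  refine ⟨hmul f0 g0', fun j => ?_, fun j => ?_, fun j l => ?_⟩
  · rw [hqd]
    rcases j with _ | α
    · exact ((hmul f0 g1').trans (hle _ 1 (by omega))).trans_eq (by rw [pow_one])
    · exact ((hmul (f1 α) g0').trans (hle _ 1 (by omega))).trans_eq (by rw [pow_one])
  · rw [hqd]
    rcases j with _ | α
    · calc _ ≤ E * G * t ^ (m + 1) * t := mul_le_mul_of_nonneg_right (hmul f0 g1') ht.le
        _ = _ := by ring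
    · simp only [weight, mul_one]
      exact hmul (f1 α) g0'
  · rw [partialD_partialD_sepFun hfd hgd]
    rcases j with _ | α <;> rcases l with _ | β
    · calc _ ≤ E * G * t ^ m * (t * t) :=
          mul_le_mul_of_nonneg_right (hmul f0 g2) (by positivity)
        _ = _ := by ring
    · simp only [weight, mul_one]
      calc _ ≤ E * G * t ^ (m + 1) * t := mul_le_mul_of_nonneg_right (hmul (f1 β) g1') ht.le
        _ = _ := by ring
    · simp only [weight, one_mul]
      calc _ ≤ E * G * t ^ (m + 1) * t := mul_le_mul_of_nonneg_right (hmul (f1 α) g1') ht.le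
        _ = _ := by ring
    · simp only [weight, mul_one]
      exact hmul (f2 α β) g0'

end

/-! ### The expansion as an approximate solution -/

section

variable {n : ℕ} {ι : Type*} {R : ℝ}

/-- The weighted sizes of the derivatives of an expansion without linear term. -/
lemma exists_evalSeries_derivative_bounds {N : ℕ} (hN1 : 1 ≤ N)
    {a : ι → ℕ → TangentialSpace n → ℝ} (ha : ∀ k, UnifC R 2 fun i => a i k)
    (h1 : ∀ i, a i 1 = 0) (hN : ∀ i, ∀ k ≥ N, a i k = 0) :
    ∃ C : ℝ, 0 ≤ C ∧ ∀ i, ∀ p : TangentialSpace n × ℝ, p.1 ∈ ball (0 : TangentialSpace n) R →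
      0 < p.2 → p.2 ≤ 1 →
      (∀ j, |partialD n j (evalSeries N (a i)) p| ≤ C * weight p.2 j) ∧
      (∀ j, |partialD n j (evalSeries N (a i)) p - formalD n j (a i) 0 p.1| ≤ C * p.2) ∧
      (∀ j l, |partialD n l (partialD n j (evalSeries N (a i))) p| * weight p.2 l
        ≤ C * weight p.2 j) ∧
      (∀ j l, |partialD n l (partialD n j (evalSeries N (a i))) p| * weight p.2 j
        ≤ C * weight p.2 l) := by
  have hD : ∀ j k, UnifC R 0 fun i => formalD n j (a i) k := fun j k =>
    (UnifC.formalD ha j k).of_succ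
  have hDD : ∀ j l k, UnifC R 0 fun i => formalD n l (formalD n j (a i)) k := fun j l k =>
    UnifC.formalD (fun k => UnifC.formalD ha j k) l k
  obtain ⟨C0, hC00, hC0⟩ := exists_forall_of_mono
    (P := fun j C => ∀ i, ∀ p : TangentialSpace n × ℝ, p.1 ∈ ball (0 : TangentialSpace n) R →
      0 < p.2 → p.2 ≤ 1 → |evalSeries N (formalD n j (a i)) p| ≤ C)
    (fun j C C' h hC i p hp ht ht1 => (hC i p hp ht ht1).trans h)
    fun j => by simpa using UnifC.exists_evalSeries_remainder_bound (hD j) (Nat.zero_le N)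
  obtain ⟨C1, hC10, hC1⟩ := exists_forall_of_mono
    (P := fun j C => ∀ i, ∀ p : TangentialSpace n × ℝ, p.1 ∈ ball (0 : TangentialSpace n) R →
      0 < p.2 → p.2 ≤ 1 →
      |evalSeries N (formalD n j (a i)) p - formalD n j (a i) 0 p.1| ≤ C * p.2)
    (fun j C C' h hC i p hp ht ht1 => (hC i p hp ht ht1).trans (by gcongr))
    fun j => by simpa using UnifC.exists_evalSeries_remainder_bound (hD j) hN1
  obtain ⟨C2, hC20, hC2⟩ := exists_forall_of_mono
    (P := fun (j : CoordIndex n × CoordIndex n) C => ∀ i, ∀ p : TangentialSpace n × ℝ,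
      p.1 ∈ ball (0 : TangentialSpace n) R → 0 < p.2 → p.2 ≤ 1 →
        |evalSeries N (formalD n j.2 (formalD n j.1 (a i))) p| ≤ C)
    (fun j C C' h hC i p hp ht ht1 => (hC i p hp ht ht1).trans h)
    fun j => by simpa using UnifC.exists_evalSeries_remainder_bound (hDD j.1 j.2) (Nat.zero_le N)
  obtain ⟨C3, hC30, hC3⟩ := exists_forall_of_mono
    (P := fun (j : CoordIndex n × CoordIndex n) C => ∀ i, ∀ p : TangentialSpace n × ℝ,
      p.1 ∈ ball (0 : TangentialSpace n) R → 0 < p.2 → p.2 ≤ 1 →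
        |evalSeries N (formalD n j.2 (formalD n j.1 (a i))) p
          - formalD n j.2 (formalD n j.1 (a i)) 0 p.1| ≤ C * p.2)
    (fun j C C' h hC i p hp ht ht1 => (hC i p hp ht ht1).trans (by gcongr))
    fun j => by simpa using UnifC.exists_evalSeries_remainder_bound (hDD j.1 j.2) hN1
  refine ⟨C0 + C1 + C2 + C3, by positivity, fun i p hp ht ht1 => ?_⟩
  have had : ∀ᶠ z in nhds p.1, ∀ k, ContDiffAt ℝ 2 (a i k) z := by
    filter_upwards [isOpen_ball.mem_nhds hp] with z hz k using (ha k).contDiffAt i hz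
  have hq : ∀ j, partialD n j (evalSeries N (a i)) p = evalSeries N (formalD n j (a i)) p :=
    partialD_evalSeries (fun k => (had.self_of_nhds k).differentiableAt (by norm_num))
      (hN i N le_rfl)
  have hh := partialD_partialD_evalSeries had (hN i)
  have hbig : ∀ j l, |evalSeries N (formalD n l (formalD n j (a i))) p| ≤ C0 + C1 + C2 + C3 :=
    fun j l => (hC2 (j, l) i p hp ht ht1).trans (by linarith)
  have hmixed : ∀ j l, formalD n l (formalD n j (a i)) 0 p.1 = 0 →
      |evalSeries N (formalD n l (formalD n j (a i))) p| ≤ (C0 + C1 + C2 + C3) * p.2 := by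
    intro j l h0
    have := hC3 (j, l) i p hp ht ht1
    rw [h0, sub_zero] at this
    exact this.trans (by gcongr; linarith)
  have hm1 : ∀ α, formalD n none (formalD n (some α) (a i)) 0 p.1 = 0 := fun α => by
    simp [formalD, h1 i]
  have hm2 : ∀ α, formalD n (some α) (formalD n none (a i)) 0 p.1 = 0 := fun α => by
    simp [formalD, h1 i]
  refine ⟨fun j => ?_, fun j => ?_, fun j l => ?_, fun j l => ?_⟩
  · rw [hq]
    rcases j with _ | α
    · have := hC1 none i p hp ht ht1
      have h0 : formalD n none (a i) 0 p.1 = 0 := by simp [formalD, h1 i]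
      rw [h0, sub_zero] at this
      simp only [weight]
      exact this.trans (by gcongr; linarith)
    · simp only [weight, mul_one]
      exact (hC0 (some α) i p hp ht ht1).trans (by linarith)
  · rw [hq]
    exact (hC1 j i p hp ht ht1).trans (by gcongr; linarith)
  · rw [hh]
    rcases j with _ | α <;> rcases l with _ | β <;> simp only [weight, mul_one]
    · exact mul_le_mul_of_nonneg_right (hbig _ _) ht.le
    · exact hmixed _ _ (hm2 β)
    · exact (mul_le_of_le_one_right (abs_nonneg _) ht1).trans (hbig _ _)
    · exact hbig _ _
  · rw [hh]
    rcases j with _ | α <;> rcases l with _ | β <;> simp only [weight, mul_one]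
    · exact mul_le_mul_of_nonneg_right (hbig _ _) ht.le
    · exact (mul_le_of_le_one_right (abs_nonneg _) ht1).trans (hbig _ _)
    · exact hmixed _ _ (hm1 α)
    · exact hbig _ _

lemma evalSeries_localExpansion {φ : TangentialSpace n → ℝ} {N J : ℕ} (hJ : 2 * J < N)
    (p : TangentialSpace n × ℝ) :
    evalSeries N (localExpansion n φ J) p
      = ∑ j ∈ Finset.range (J + 1), localCoeff n φ j p.1 * p.2 ^ (2 * j) := by
  induction J with
  | zero =>
    rw [evalSeries, Finset.sum_eq_single_of_mem 0 (Finset.mem_range.2 (by omega))]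
    · simp [localExpansion, localCoeff]
    · intro k _ hk
      simp [localExpansion, hk]
  | succ J ih =>
    rw [Finset.sum_range_succ, ← ih (by omega)]
    have hz : localExpansion n φ J (2 * (J + 1)) = 0 :=
      localExpansion_eq_zero J (by omega) (Or.inl (by omega))
    have hk : ∀ k, localExpansion n φ (J + 1) k p.1 * p.2 ^ k
        = localExpansion n φ J k p.1 * p.2 ^ k
          + if k = 2 * (J + 1) then localCoeff n φ (J + 1) p.1 * p.2 ^ (2 * (J + 1)) else 0 := by
      intro k
      split_ifs with h
      · rw [h, hz, localCoeff]
        simp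
      · rw [localExpansion, Function.update_of_ne h, add_zero]
    simp only [evalSeries, hk, Finset.sum_add_distrib, Finset.sum_ite_eq', Finset.mem_range,
      if_pos hJ]

lemma uStar_eq (φ : TangentialSpace n → ℝ) (p : TangentialSpace n × ℝ) :
    uStar n φ p = evalSeries (n + 1) (localExpansion n φ (n / 2)) p
      + sepFun (logTerm n φ) (logPower n) p := by
  rw [uStar, evalSeries_localExpansion (by omega)]
  congr 1
  simp only [sepFun, logTerm, logPower]
  split_ifs
  · simp
  · ring

lemma unifC_localExpansion_half {φ : ι → TangentialSpace n → ℝ} (hφ : UnifC R (dataOrder n) φ)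
    (k : ℕ) : UnifC R 2 fun i => localExpansion n (φ i) (n / 2) k := by
  have h : 2 * (n / 2) + 2 ≤ dataOrder n := by
    unfold dataOrder
    split_ifs <;> omega
  exact (UnifC.localExpansion hφ (n / 2) (by omega) k).mono (by omega)

lemma unifC_logTerm {φ : ι → TangentialSpace n → ℝ} (hφ : UnifC R (dataOrder n) φ) :
    UnifC R 2 fun i => logTerm n (φ i) := by
  by_cases hn : Even n
  · have e : (fun i => logTerm n (φ i)) = fun _ _ => 0 := by
      funext i y
      rw [logTerm, if_pos hn]
    rw [e]
    exact UnifC.const 0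
  · have h : 2 * (n / 2) + 4 ≤ dataOrder n := by
      have := Nat.not_even_iff.1 hn
      rw [dataOrder, if_neg hn]
      omega
    have e : (fun i => logTerm n (φ i)) = fun i => logCoeff n (φ i) := by
      funext i y
      rw [logTerm, if_neg hn]
    rw [e]
    exact UnifC.const_mul _ (UnifCoeff.formalOp (fun k =>
      (UnifC.localExpansion hφ (n / 2) (by omega) k).mono (by omega)) (n - 1))

/-- The functions `u_*` are approximate solutions with a uniform constant. -/
theorem exists_isApproxSolution_uStar (hn : 2 ≤ n) {φ : ι → TangentialSpace n → ℝ}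
    (hφ : UnifC R (dataOrder n) φ) {r : ℝ} (hrR : r ≤ R) (hr1 : r ≤ 1) :
    ∃ C : ℝ, 0 ≤ C ∧ ∀ i, IsApproxSolution n r C (uStar n (φ i)) := by
  set a : ι → ℕ → TangentialSpace n → ℝ := fun i => localExpansion n (φ i) (n / 2) with hadef
  have ha : ∀ k, UnifC R 2 fun i => a i k := unifC_localExpansion_half hφ
  have ha1 : ∀ i, a i 1 = 0 := fun i => localExpansion_eq_zero _ (by omega) (Or.inr odd_one)
  have haN : ∀ i, ∀ k ≥ n + 1, a i k = 0 := fun i k hk =>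
    localExpansion_eq_zero _ (by omega) (Or.inl (by omega))
  have hl : UnifC R 2 fun i => logTerm n (φ i) := unifC_logTerm hφ
  obtain ⟨C1, hC1, H1⟩ := exists_evalSeries_derivative_bounds (by omega) ha ha1 haN
  obtain ⟨C2, hC2, H2⟩ := exists_sepFun_logPower_bounds hn hl
  obtain ⟨C3, H3⟩ := exists_polynomial_residual_bound hn ha
  obtain ⟨C4, H4⟩ := hl.exists_bound
  set D : ℝ := C1 + C2 with hD
  have hD0 : 0 ≤ D := by positivity
  obtain ⟨K, hK0, hK⟩ := exists_clearedOp_perturbation_bound n n D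
  set m : ℝ := (Fintype.card (CoordIndex n) : ℝ) with hm
  set E : ℝ := |C3| + K * C2 + (n + 1) * |C4| * (m * (D * (3 * D))) with hE
  have hE0 : 0 ≤ E := by positivity
  have hmem : ∀ p ∈ cylinderG n r, p.1 ∈ ball (0 : TangentialSpace n) R ∧ 0 < p.2 ∧ p.2 ≤ 1 :=
    fun p hp => ⟨by simpa using hp.1.trans_le hrR, hp.2.1, hp.2.2.le.trans hr1⟩
  have hS0 : ∀ i, ∀ y ∈ ball (0 : TangentialSpace n) R, ∀ t,
      ContDiffAt ℝ 2 (evalSeries (n + 1) (a i)) (y, t) := fun i y hy t =>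
    ContDiffAt.evalSeries fun k => (ha k).contDiffAt i hy
  have hL : ∀ i, ∀ p ∈ cylinderG n r, ContDiffAt ℝ 2 (sepFun (logTerm n (φ i)) (logPower n)) p :=
    fun i p hp => (hl.contDiffAt i (hmem p hp).1).sepFun (contDiffAt_logPower n hp.2.1)
  have hfun : ∀ i, uStar n (φ i) = fun p => evalSeries (n + 1) (a i) p
      + sepFun (logTerm n (φ i)) (logPower n) p := fun i => funext fun p => uStar_eq (φ i) p
  have hgrad : ∀ i, ∀ p ∈ cylinderG n r, ∀ j, partialD n j (uStar n (φ i)) p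
      = partialD n j (evalSeries (n + 1) (a i)) p
        + partialD n j (sepFun (logTerm n (φ i)) (logPower n)) p := by
    intro i p hp j
    rw [hfun i]
    exact partialD_add ((hS0 i p.1 (hmem p hp).1 p.2).differentiableAt (by norm_num))
      ((hL i p hp).differentiableAt (by norm_num)) j
  have hhess : ∀ i, ∀ p ∈ cylinderG n r, ∀ j l, partialD n l (partialD n j (uStar n (φ i))) p
      = partialD n l (partialD n j (evalSeries (n + 1) (a i))) p
        + partialD n l (partialD n j (sepFun (logTerm n (φ i)) (logPower n))) p := by
    intro i p hp j l
    rw [hfun i]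
    exact partialD_partialD_add (hS0 i p.1 (hmem p hp).1 p.2) (hL i p hp) j l
  have hdw : ∀ i, ∀ p ∈ cylinderG n r, ∀ j,
      |partialD n j (sepFun (logTerm n (φ i)) (logPower n)) p| ≤ C2 * weight p.2 j := by
    intro i p hp j
    obtain ⟨hy, ht, ht1⟩ := hmem p hp
    refine ((H2 i p hy ht ht1).2.1 j).trans ?_
    rcases j with _ | α
    · rfl
    · exact mul_le_mul_of_nonneg_left ht1 hC2
  have hLhess : ∀ i, ∀ p ∈ cylinderG n r, ∀ j l,
      |partialD n l (partialD n j (sepFun (logTerm n (φ i)) (logPower n))) p| * weight p.2 l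
        ≤ C2 * weight p.2 j ∧
      |partialD n l (partialD n j (sepFun (logTerm n (φ i)) (logPower n))) p| * weight p.2 j
        ≤ C2 * weight p.2 l := by
    intro i p hp j l
    obtain ⟨hy, ht, ht1⟩ := hmem p hp
    have h := (H2 i p hy ht ht1).2.2.2 j l
    have hw : ∀ k : CoordIndex n, p.2 ^ n ≤ weight p.2 k ^ 2 := fun k => by
      have h2 : p.2 ^ n ≤ p.2 ^ 2 := pow_le_pow_of_le_one ht.le ht1 hn
      rcases k with _ | α
      · exact h2
      · simp only [weight, one_pow]
        exact pow_le_one₀ ht.le ht1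
    have hwp : ∀ k : CoordIndex n, 0 < weight p.2 k := weight_pos ht
    constructor
    · refine le_of_mul_le_mul_right ?_ (hwp j)
      calc _ = |partialD n l (partialD n j (sepFun (logTerm n (φ i)) (logPower n))) p|
            * (weight p.2 j * weight p.2 l) := by ring
        _ ≤ C2 * p.2 ^ n := h
        _ ≤ C2 * weight p.2 j ^ 2 := mul_le_mul_of_nonneg_left (hw j) hC2
        _ = _ := by ring
    · refine le_of_mul_le_mul_right ?_ (hwp l)
      calc _ = |partialD n l (partialD n j (sepFun (logTerm n (φ i)) (logPower n))) p|
            * (weight p.2 j * weight p.2 l) := by ring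
        _ ≤ C2 * p.2 ^ n := h
        _ ≤ C2 * weight p.2 l ^ 2 := mul_le_mul_of_nonneg_left (hw l) hC2
        _ = _ := by ring
  have hwle : ∀ i, ∀ p ∈ cylinderG n r, ∀ j,
      |partialD n j (uStar n (φ i)) p| ≤ D * weight p.2 j := by
    intro i p hp j
    obtain ⟨hy, ht, ht1⟩ := hmem p hp
    rw [hgrad i p hp]
    refine (abs_add_le _ _).trans ?_
    rw [hD, add_mul]
    exact add_le_add ((H1 i p hy ht ht1).1 j) (hdw i p hp j)
  have hDE : D ≤ D + E := by linarith
  refine ⟨D + E, by positivity, fun i => ⟨fun p hp => ?_, ?_, fun p hp j => ?_, fun p hp j l => ?_,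
    fun p hp j l => ?_, fun p hp => ?_⟩⟩
  · rw [hfun i]
    exact (hS0 i p.1 (hmem p hp).1 p.2).add (hL i p hp)
  · rw [hfun i]
    have hball : ∀ p ∈ ball (0 : TangentialSpace n) r ×ˢ Ico 0 r,
        p.1 ∈ ball (0 : TangentialSpace n) R := fun p hp => ball_subset_ball hrR hp.1
    refine ContinuousOn.add (fun p hp => ?_) (fun p hp => ?_)
    · exact (hS0 i p.1 (hball p hp) p.2).continuousAt.continuousWithinAt
    · refine ContinuousAt.continuousWithinAt (ContinuousAt.mul ?_ ?_)
      · exact ContinuousAt.comp (f := Prod.fst) (hl.contDiffAt i (hball p hp)).continuousAt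
          continuousAt_fst
      · exact ((continuous_logPower n).comp continuous_snd).continuousAt
  · exact (hwle i p hp j).trans (mul_le_mul_of_nonneg_right hDE (weight_pos hp.2.1 j).le)
  · obtain ⟨hy, ht, ht1⟩ := hmem p hp
    have hwj := weight_pos ht j
    rw [hhess i p hp]
    calc _ ≤ (|partialD n l (partialD n j (evalSeries (n + 1) (a i))) p|
          + |partialD n l (partialD n j (sepFun (logTerm n (φ i)) (logPower n))) p|)
          * weight p.2 l :=
          mul_le_mul_of_nonneg_right (abs_add_le _ _) (weight_pos ht l).le
      _ ≤ D * weight p.2 j := by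
        rw [add_mul, hD, add_mul]
        exact add_le_add ((H1 i p hy ht ht1).2.2.1 j l) (hLhess i p hp j l).1
      _ ≤ _ := mul_le_mul_of_nonneg_right hDE hwj.le
  · obtain ⟨hy, ht, ht1⟩ := hmem p hp
    have hwl := weight_pos ht l
    rw [hhess i p hp]
    calc _ ≤ (|partialD n l (partialD n j (evalSeries (n + 1) (a i))) p|
          + |partialD n l (partialD n j (sepFun (logTerm n (φ i)) (logPower n))) p|)
          * weight p.2 j :=
          mul_le_mul_of_nonneg_right (abs_add_le _ _) (weight_pos ht j).le
      _ ≤ D * weight p.2 l := by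
        rw [add_mul, hD, add_mul]
        exact add_le_add ((H1 i p hy ht ht1).2.2.2 j l) (hLhess i p hp j l).2
      _ ≤ _ := mul_le_mul_of_nonneg_right hDE hwl.le
  · obtain ⟨hy, ht, ht1⟩ := hmem p hp
    obtain ⟨H11, H12, H13, H14⟩ := H1 i p hy ht ht1
    obtain ⟨H21, H22, H23, H24⟩ := H2 i p hy ht ht1
    have hw : ∀ j, 0 ≤ weight (n := n) p.2 j := fun j => (weight_pos ht j).le
    have hC1D : C1 ≤ D := by linarith
    have hC2D : C2 ≤ D := by linarith
    have hper := hK p.2 (C2 * p.2 ^ n) (fun j => partialD n j (evalSeries (n + 1) (a i)) p)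
      (fun j => partialD n j (sepFun (logTerm n (φ i)) (logPower n)) p)
      (fun j l => partialD n l (partialD n j (evalSeries (n + 1) (a i))) p)
      (fun j l => partialD n l (partialD n j (sepFun (logTerm n (φ i)) (logPower n))) p) ht ht1
      (fun j => (H11 j).trans (mul_le_mul_of_nonneg_right hC1D (hw j)))
      (fun j => (hdw i p hp j).trans (mul_le_mul_of_nonneg_right hC2D (hw j)))
      (fun j l => (H13 j l).trans (mul_le_mul_of_nonneg_right hC1D (hw j)))
      (fun j l => (H14 j l).trans (mul_le_mul_of_nonneg_right hC1D (hw l)))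
      H23 H24
    have eS : clearedGraphOp n (uStar n (φ i)) p = clearedOp (n : ℝ)
        (fun j => partialD n j (evalSeries (n + 1) (a i)) p
          + partialD n j (sepFun (logTerm n (φ i)) (logPower n)) p)
        (fun j l => partialD n l (partialD n j (evalSeries (n + 1) (a i))) p
          + partialD n l (partialD n j (sepFun (logTerm n (φ i)) (logPower n))) p)
        ((partialD n none (evalSeries (n + 1) (a i)) p
          + partialD n none (sepFun (logTerm n (φ i)) (logPower n)) p) / p.2) := by
      simp only [clearedGraphOp, hgrad i p hp, hhess i p hp]
    have e0 : clearedGraphOp n (evalSeries (n + 1) (a i)) p = clearedOp (n : ℝ)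
        (fun j => partialD n j (evalSeries (n + 1) (a i)) p)
        (fun j l => partialD n l (partialD n j (evalSeries (n + 1) (a i))) p)
        (partialD n none (evalSeries (n + 1) (a i)) p / p.2) := rfl
    rw [← eS, ← e0] at hper
    have hlead : partialD n none (partialD n none (sepFun (logTerm n (φ i)) (logPower n))) p
        - n * (partialD n none (sepFun (logTerm n (φ i)) (logPower n)) p / p.2)
        = logTerm n (φ i) p.1 * ((n + 1) * p.2 ^ (n - 1)) := by
      have hfd : ContDiffAt ℝ 2 (logTerm n (φ i)) p.1 := hl.contDiffAt i hy
      have hgd := contDiffAt_logPower n ht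
      rw [partialD_partialD_sepFun hfd hgd, partialD_sepFun
        (hfd.differentiableAt (by norm_num)) (hgd.differentiableAt (by norm_num)),
        ← logPower_leading (by omega) ht]
      simp only [sepFun, sepLeft, sepRight]
      ring
    rw [hlead] at hper
    have hres := H3 i p hy ht ht1
    have hc4 : |logTerm n (φ i) p.1| ≤ |C4| := (H4 i p.1 hy).trans (le_abs_self _)
    -- The factor `1 + |Du_*|²` may be replaced by its value at `t = 0`.
    have hsq : |∑ j, ((partialD n j (evalSeries (n + 1) (a i)) p
        + partialD n j (sepFun (logTerm n (φ i)) (logPower n)) p) ^ 2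
        - formalD n j (a i) 0 p.1 ^ 2)| ≤ m * (D * p.2 * (3 * D)) := by
      refine abs_sum_le_card_mul fun j => ?_
      rw [← hgrad i p hp]
      have hb1 : |partialD n j (uStar n (φ i)) p - formalD n j (a i) 0 p.1| ≤ D * p.2 := by
        rw [hgrad i p hp, add_sub_right_comm]
        refine (abs_add_le _ _).trans ?_
        rw [hD, add_mul]
        exact add_le_add (H12 j) (H22 j)
      have hb2 : |partialD n j (uStar n (φ i)) p| ≤ D := (hwle i p hp j).trans
        (mul_le_of_le_one_right hD0 (weight_le_one ht1 j))
      have hb3 : |partialD n j (uStar n (φ i)) p + formalD n j (a i) 0 p.1| ≤ 3 * D := by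
        have e : partialD n j (uStar n (φ i)) p + formalD n j (a i) 0 p.1
            = 2 * partialD n j (uStar n (φ i)) p
              - (partialD n j (uStar n (φ i)) p - formalD n j (a i) 0 p.1) := by ring
        rw [e]
        refine (abs_sub _ _).trans ?_
        rw [abs_mul, abs_two]
        have : D * p.2 ≤ D := mul_le_of_le_one_right hD0 ht1
        linarith
      have e : partialD n j (uStar n (φ i)) p ^ 2 - formalD n j (a i) 0 p.1 ^ 2
          = (partialD n j (uStar n (φ i)) p - formalD n j (a i) 0 p.1)
            * (partialD n j (uStar n (φ i)) p + formalD n j (a i) 0 p.1) := by ring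
      rw [e, abs_mul]
      exact mul_le_mul hb1 hb3 (abs_nonneg _) (by positivity)
    rw [Finset.sum_sub_distrib] at hsq
    set W : ℝ := ∑ j, (partialD n j (evalSeries (n + 1) (a i)) p
        + partialD n j (sepFun (logTerm n (φ i)) (logPower n)) p) ^ 2
    set W0 : ℝ := ∑ j, formalD n j (a i) 0 p.1 ^ 2
    have hpn : p.2 ^ n = p.2 ^ (n - 1) * p.2 := by
      rw [← pow_succ]
      congr 1
      omega
    have hpp : 0 < p.2 ^ (n - 1) := pow_pos ht _
    have hpp' : 0 < p.2 ^ n := pow_pos ht _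
    have hdiff : |(n + 1) * logTerm n (φ i) p.1 * (W - W0) * p.2 ^ (n - 1)|
        ≤ (n + 1) * |C4| * (m * (D * (3 * D))) * p.2 ^ n := by
      rw [abs_mul, abs_mul, abs_mul, abs_of_pos hpp, abs_of_pos (by positivity : (0 : ℝ) < n + 1)]
      calc (n + 1) * |logTerm n (φ i) p.1| * |W - W0| * p.2 ^ (n - 1)
          ≤ (n + 1) * |C4| * (m * (D * p.2 * (3 * D))) * p.2 ^ (n - 1) := by gcongr
        _ = _ := by rw [hpn]; ring
    have h3' : C3 * p.2 ^ n ≤ |C3| * p.2 ^ n := by gcongr; exact le_abs_self _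
    have etot : clearedGraphOp n (uStar n (φ i)) p
        = (clearedGraphOp n (uStar n (φ i)) p - clearedGraphOp n (evalSeries (n + 1) (a i)) p
          - (1 + W) * (logTerm n (φ i) p.1 * ((n + 1) * p.2 ^ (n - 1))))
        + (clearedGraphOp n (evalSeries (n + 1) (a i)) p
          + (n + 1) * logTerm n (φ i) p.1 * (1 + W0) * p.2 ^ (n - 1))
        + (n + 1) * logTerm n (φ i) p.1 * (W - W0) * p.2 ^ (n - 1) := by ring
    rw [etot]
    refine (abs_add_le _ _).trans ?_
    refine (add_le_add (abs_add_le _ _) le_rfl).trans ?_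
    have hfin : E * p.2 ^ n ≤ (D + E) * p.2 ^ n := by gcongr; linarith
    refine le_trans ?_ hfin
    rw [hE]
    linarith

/-- `u_*` differs from its boundary values by `O(t²)`. -/
lemma exists_uStar_sub_bound (hn : 2 ≤ n) {φ : ι → TangentialSpace n → ℝ}
    (hφ : UnifC R (dataOrder n) φ) :
    ∃ C : ℝ, ∀ i, ∀ p : TangentialSpace n × ℝ, p.1 ∈ ball (0 : TangentialSpace n) R →
      0 < p.2 → p.2 ≤ 1 → |uStar n (φ i) p - φ i p.1| ≤ C * p.2 ^ 2 := by
  obtain ⟨C1, H1⟩ := UnifC.exists_evalSeries_remainder_bound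
    (b := fun i => localExpansion n (φ i) (n / 2))
    (fun k => (unifC_localExpansion_half hφ k).of_succ.of_succ) (by omega : 2 ≤ n + 1)
  obtain ⟨C2, hC2, H2⟩ := exists_sepFun_logPower_bounds hn (unifC_logTerm hφ)
  refine ⟨C1 + C2, fun i p hp ht ht1 => ?_⟩
  have h1 := H1 i p hp ht ht1
  have h2 := (H2 i p hp ht ht1).1
  have h3 : C2 * p.2 ^ n ≤ C2 * p.2 ^ 2 :=
    mul_le_mul_of_nonneg_left (pow_le_pow_of_le_one ht.le ht1 hn) hC2
  have e1 : localExpansion n (φ i) (n / 2) 1 = 0 :=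
    localExpansion_eq_zero _ (by omega) (Or.inr odd_one)
  simp only [Finset.sum_range_succ, Finset.sum_range_zero, localExpansion_zero_right, e1,
    Pi.zero_apply, zero_mul, pow_zero, mul_one, zero_add, add_zero] at h1
  rw [uStar_eq, add_sub_right_comm]
  refine (abs_add_le _ _).trans ?_
  linarith

end

/-! ### The estimate -/

lemma cylinderG_eq_prod (n : ℕ) (r : ℝ) : cylinderG n r = ball 0 r ×ˢ Ioo 0 r := by
  ext p
  simp [cylinderG]

lemma cylinderG_mono {n : ℕ} {r R : ℝ} (h : r ≤ R) : cylinderG n r ⊆ cylinderG n R := fun _ hp =>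
  ⟨hp.1.trans_le h, hp.2.1, hp.2.2.trans_le h⟩

lemma uStar_zero_right (n : ℕ) (φ : TangentialSpace n → ℝ) (y : TangentialSpace n) :
    uStar n φ (y, 0) = φ y := by
  rw [uStar_eq, evalSeries, Finset.sum_eq_single_of_mem 0 (Finset.mem_range.2 (by omega))]
  · simp [localExpansion_zero_right, sepFun, logPower]
  · intro k _ hk
    simp [hk]

lemma IsMinimalGraphSolution.isClearedSolution {n : ℕ} {r R : ℝ} {φ : TangentialSpace n → ℝ}
    {u : TangentialSpace n × ℝ → ℝ} (hu : IsMinimalGraphSolution n R φ u) (hr : 0 < r)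
    (hrR : r ≤ R) : IsClearedSolution n r u where
  contDiffAt p hp := by
    have hopen : IsOpen (cylinderG n R) := by
      rw [cylinderG_eq_prod]
      exact isOpen_ball.prod isOpen_Ioo
    exact (hu.smoothOn.contDiffAt (hopen.mem_nhds (cylinderG_mono hrR hp))).of_le
      (WithTop.coe_le_coe.2 (le_top : (2 : ℕ∞) ≤ ⊤))
  continuousOn := by
    refine hu.continuousOn.mono ?_
    rw [cylinderG_eq_prod, closure_prod_eq, closure_Ioo (hr.trans_le hrR).ne]
    exact prod_mono ((ball_subset_ball hrR).trans subset_closure)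
      fun t ht => ⟨ht.1, ht.2.le.trans hrR⟩
  equation p hp := by rw [clearedGraphOp_eq, hu.equation p (cylinderG_mono hrR hp), mul_zero]

/-- The estimate with constants that depend only on `n`, `R` and the bounds `M` of the solution and
`K` of the derivatives of the boundary values. -/
theorem exists_uniform_expansion_bound {n : ℕ} (hn : 2 ≤ n) {R : ℝ} (hR : 0 < R) (M K : ℝ) :
    ∃ r ∈ Ioo 0 R, ∃ C : ℝ, 0 < C ∧
      ∀ (φ : TangentialSpace n → ℝ) (u : TangentialSpace n × ℝ → ℝ),
        ContDiffOn ℝ (dataOrder n) φ (ball 0 R) →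
        IsMinimalGraphSolution n R φ u →
        (∀ p ∈ cylinderG n R, |u p| ≤ M) →
        (∀ k ≤ dataOrder n, ∀ y ∈ ball (0 : TangentialSpace n) R,
          ‖iteratedFDeriv ℝ k φ y‖ ≤ K) →
        ∀ p ∈ cylinderG n r, |u p - uStar n φ p| ≤ C * p.2 ^ (n + 1) := by
  -- The family of all admissible pairs of boundary values and solutions.
  let ι := {x : (TangentialSpace n → ℝ) × (TangentialSpace n × ℝ → ℝ) //
    ContDiffOn ℝ (dataOrder n) x.1 (ball 0 R) ∧ IsMinimalGraphSolution n R x.1 x.2 ∧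
    (∀ p ∈ cylinderG n R, |x.2 p| ≤ M) ∧ ∀ k ≤ dataOrder n, ∀ y ∈ ball (0 : TangentialSpace n) R,
      ‖iteratedFDeriv ℝ k x.1 y‖ ≤ K}
  have hφ : UnifC R (dataOrder n) fun i : ι => i.1.1 :=
    UnifC.of_iteratedFDeriv (fun i => i.2.1) fun i => i.2.2.2.2
  have hℓ : 2 ≤ dataOrder n := by
    unfold dataOrder
    split_ifs <;> omega
  have hφ2 : UnifC R 2 fun i : ι => i.1.1 := hφ.mono hℓ
  suffices H : ∀ k, 2 ≤ k → k ≤ n + 1 → ∃ r, 0 < r ∧ r < R ∧ r ≤ 1 ∧ ∃ C : ℝ, ∀ i : ι,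
      ∀ p ∈ cylinderG n r, |i.1.2 p - uStar n i.1.1 p| ≤ C * p.2 ^ k by
    obtain ⟨r, hr, hrR, -, C, hC⟩ := H (n + 1) (by omega) le_rfl
    refine ⟨r, ⟨hr, hrR⟩, |C| + 1, by positivity, fun φ u h1 h2 h3 h4 p hp => ?_⟩
    refine (hC ⟨(φ, u), h1, h2, h3, h4⟩ p hp).trans ?_
    have : 0 < p.2 ^ (n + 1) := pow_pos hp.2.1 _
    gcongr
    linarith [le_abs_self C]
  intro k hk
  induction k, hk using Nat.le_induction with
  | base =>
    intro _
    set r : ℝ := min (R / 2) 1 with hr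
    have hr0 : 0 < r := by positivity
    have hrR : r < R := (min_le_left _ _).trans_lt (by linarith)
    have hr1 : r ≤ 1 := min_le_right _ _
    obtain ⟨C0, hC0⟩ := hφ.exists_bound
    obtain ⟨C2, hC20, hC2⟩ := exists_forall_of_mono
      (P := fun (α : Fin (n - 1) × Fin (n - 1)) C =>
        ∀ i : ι, ∀ y ∈ ball (0 : TangentialSpace n) R, |tanD α.2 (tanD α.1 i.1.1) y| ≤ C)
      (fun α C C' h hC i y hy => (hC i y hy).trans h) fun α =>
        ((hφ2.tanD α.1).tanD α.2).exists_bound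
    obtain ⟨C', hC'⟩ := exists_initial_bound hn (r := r) (C := |C0| + C2) (M := |M|) hr0
      (by positivity) (by positivity)
    obtain ⟨C'', hC''⟩ := exists_uStar_sub_bound hn hφ
    refine ⟨r / 2, by positivity, by linarith, by linarith, C' + C'', fun i p hp => ?_⟩
    have hb : ∀ y ∈ ball (0 : TangentialSpace n) r, y ∈ ball (0 : TangentialSpace n) R :=
      fun y hy => ball_subset_ball hrR.le hy
    have hcl := i.2.2.1.isClearedSolution hr0 hrR.le
    have hd : ∀ y ∈ ball (0 : TangentialSpace n) r, ContDiffAt ℝ 2 i.1.1 y := fun y hy =>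
      hφ2.contDiffAt i (hb y hy)
    have hb0 : ∀ y ∈ ball (0 : TangentialSpace n) r, |i.1.1 y| ≤ |C0| + C2 := fun y hy => by
      linarith [hC0 i y (hb y hy), le_abs_self C0]
    have hb2 : ∀ y ∈ ball (0 : TangentialSpace n) r, ∀ α β,
        |tanD β (tanD α i.1.1) y| ≤ |C0| + C2 := fun y hy α β => by
      linarith [hC2 (α, β) i y (hb y hy), abs_nonneg C0]
    have hM : ∀ p ∈ cylinderG n r, |i.1.2 p| ≤ |M| := fun p hp =>
      (i.2.2.2.1 p (cylinderG_mono hrR.le hp)).trans (le_abs_self M)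
    have hup := hC' _ _ hcl hd hb0 hb2 (fun y hy => i.2.2.1.boundary y (hb y hy))
      (fun p hp => (abs_le.1 (hM p hp)).2) p hp
    have htan : ∀ y α β, tanD β (tanD α fun y => -i.1.1 y) y = -tanD β (tanD α i.1.1) y := by
      intro y α β
      have h1 : ∀ (f : TangentialSpace n → ℝ) α, tanD α (fun y => -f y) = fun y => -tanD α f y := by
        intro f α
        ext z
        simp [tanD, fderiv_fun_neg]
      rw [h1, h1]
    have hlow := hC' _ (fun y => -i.1.1 y) hcl.neg (fun y hy => (hd y hy).neg)
      (fun y hy => by simpa using hb0 y hy) (fun y hy α β => by simpa [htan] using hb2 y hy α β)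
      (fun y hy => by rw [i.2.2.1.boundary y (hb y hy)])
      (fun p hp => by linarith [(abs_le.1 (hM p hp)).1]) p hp
    have hpR : p.1 ∈ ball (0 : TangentialSpace n) R := by
      have := hp.1
      simp only [mem_ball_zero_iff]
      linarith
    have hS := abs_le.1 (hC'' i p hpR hp.2.1 (by linarith [hp.2.2]))
    rw [abs_le]
    constructor <;> linarith [hS.1, hS.2]
  | succ k hk ih =>
    intro hkn
    obtain ⟨m, rfl⟩ := Nat.exists_eq_add_of_le' hk
    obtain ⟨r, hr, hrR, hr1, C, hC⟩ := ih (by omega)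
    obtain ⟨CS, hCS, hS⟩ := exists_isApproxSolution_uStar hn hφ hrR.le hr1
    obtain ⟨r', ⟨hr', hr'r⟩, C', hC'⟩ := exists_step_bound (n := n) (m := m) (by omega) hr hr1 hCS
      (abs_nonneg C)
    refine ⟨r', hr', hr'r.trans hrR, hr'r.le.trans hr1, C', fun i p hp => ?_⟩
    have hcl := i.2.2.1.isClearedSolution hr hrR.le
    have hbd : ∀ y ∈ ball (0 : TangentialSpace n) r, i.1.2 (y, 0) = uStar n i.1.1 (y, 0) :=
      fun y hy => by
        rw [uStar_zero_right, i.2.2.1.boundary y (ball_subset_ball hrR.le hy)]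
    have hprev : ∀ p ∈ cylinderG n r, |i.1.2 p - uStar n i.1.1 p| ≤ |C| * p.2 ^ (m + 2) := by
      intro p hp
      have : 0 < p.2 ^ (m + 2) := pow_pos hp.2.1 _
      exact (hC i p hp).trans (by gcongr; exact le_abs_self C)
    have hup := hC' _ _ hcl (hS i) hbd (fun p hp => (abs_le.1 (hprev p hp)).2) p hp
    have hlow := hC' _ _ hcl.neg (hS i).neg (fun y hy => by rw [hbd y hy])
      (fun p hp => by linarith [(abs_le.1 (hprev p hp)).1]) p hp
    rw [abs_le]
    constructor <;> linarith

lemma exists_bound_iteratedFDeriv {n m : ℕ} {R : ℝ} (hR : 0 < R) {φ : TangentialSpace n → ℝ}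
    (hφ : ContDiffOn ℝ m φ (ball 0 R)) :
    ∃ K : ℝ, ∀ k ≤ m, ∀ y ∈ ball (0 : TangentialSpace n) (R / 2),
      ‖iteratedFDeriv ℝ k φ y‖ ≤ K := by
  obtain ⟨K, -, hK⟩ := exists_forall_of_mono
    (P := fun (k : Fin (m + 1)) C => ∀ y ∈ ball (0 : TangentialSpace n) (R / 2),
      ‖iteratedFDeriv ℝ k φ y‖ ≤ C)
    (fun k C C' h hC y hy => (hC y hy).trans h) fun k => by
      have h1 : ContinuousOn (iteratedFDerivWithin ℝ k φ (ball 0 R)) (ball 0 R) :=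
        hφ.continuousOn_iteratedFDerivWithin (by exact_mod_cast Nat.lt_succ_iff.1 k.2)
          isOpen_ball.uniqueDiffOn
      have h2 : ContinuousOn (iteratedFDeriv ℝ k φ) (ball 0 R) :=
        h1.congr fun y hy => (iteratedFDerivWithin_of_isOpen (k : ℕ) isOpen_ball hy).symm
      obtain ⟨C, hC⟩ := (isCompact_closedBall (0 : TangentialSpace n)
        (R / 2)).exists_bound_of_continuousOn (h2.mono (closedBall_subset_ball (by linarith)))
      exact ⟨C, fun y hy => hC y (ball_subset_closedBall hy)⟩
  exact ⟨K, fun k hk => hK ⟨k, by omega⟩⟩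

theorem mainTheorem4 (n : ℕ) (hn : 2 ≤ n) (R : ℝ) (hR : 0 < R) :
    (∀ (φ : TangentialSpace n → ℝ) (u : TangentialSpace n × ℝ → ℝ),
      ContDiffOn ℝ (dataOrder n) φ (ball 0 R) →
      IsMinimalGraphSolution n R φ u →
      ∃ r ∈ Ioo 0 R, ∃ C : ℝ, 0 < C ∧
        ∀ p ∈ cylinderG n r, |u p - uStar n φ p| ≤ C * p.2 ^ (n + 1)) ∧
    (∀ M K : ℝ, ∃ r ∈ Ioo 0 R, ∃ C : ℝ, 0 < C ∧
      ∀ (φ : TangentialSpace n → ℝ) (u : TangentialSpace n × ℝ → ℝ),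
        ContDiffOn ℝ (dataOrder n) φ (ball 0 R) →
        IsMinimalGraphSolution n R φ u →
        (∀ p ∈ cylinderG n R, |u p| ≤ M) →
        (∀ k ≤ dataOrder n, ∀ y ∈ ball (0 : TangentialSpace n) R,
          ‖iteratedFDeriv ℝ k φ y‖ ≤ K) →
        ∀ p ∈ cylinderG n r, |u p - uStar n φ p| ≤ C * p.2 ^ (n + 1)) := by
  refine ⟨fun φ u hφ hu => ?_, fun M K => exists_uniform_expansion_bound hn hR M K⟩
  -- On the cylinder of half the size `φ` and `u` are bounded as required by compactness.
  have hsub : cylinderG n (R / 2) ⊆ cylinderG n R := cylinderG_mono (by linarith)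
  have hball : ball (0 : TangentialSpace n) (R / 2) ⊆ ball 0 R := ball_subset_ball (by linarith)
  have hcomp : IsCompact (closure (cylinderG n R)) := by
    refine Bornology.IsBounded.isCompact_closure ?_
    rw [cylinderG_eq_prod]
    exact isBounded_ball.prod (isBounded_Ioo 0 R)
  obtain ⟨M, hM⟩ := hcomp.exists_bound_of_continuousOn hu.continuousOn
  obtain ⟨K, hK⟩ := exists_bound_iteratedFDeriv hR hφ
  obtain ⟨r, ⟨hr, hrR⟩, C, hC, H⟩ :=
    exists_uniform_expansion_bound hn (by positivity : 0 < R / 2) M K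
  exact ⟨r, ⟨hr, by linarith⟩, C, hC, H φ u (hφ.mono hball)
    ⟨hu.continuousOn.mono (closure_mono hsub), hu.smoothOn.mono hsub,
      fun p hp => hu.equation p (hsub hp), fun y hy => hu.boundary y (hball hy)⟩
    (fun p hp => hM p (subset_closure (hsub hp))) hK⟩
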